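/- A colored graph is a finite bipartite graph, with white and black vertices, in which parallel edges of different colors are allowed, and whose edges carry colors $0,1,2,3$ so that every vertex is incident to exactly one edge of each color. A bubble is a non-empty connected graph of the same kind with colors $1,2,3$ only. The bubbles of a colored graph $G$ are the connected components left after removing the edges of color $0$; copies of a bubble are taken up to isomorphisms preserving the edge colors and the white/black shades. A bubble is planar if its canonical embedding (cyclic order $(123)$ of the colors around white vertices, $(132)$ around black vertices) is a planar map. Let $C_0(G)$ be the number of cycles of $G$ whose edges alternate the colors $0$ and $a$, summed over $a\in\{1,2,3\}$, and let $C(G)$ be the total number of bicolored cycles over all pairs of colors $0\le a<b\le 3$. For a bubble $B$, a pairing $\pi$ is a perfect matching of its white with its black vertices; joining the pairs by edges of color $0$ gives a one-bubble graph. Let $C_1(B)$ be the maximum of $C_0$ over all pairings of $B$, and call the pairings which attain it optimal. A bubble $B$ of a connected colored graph $G$ satisfies the maximal 2-cut property if there is an optimal pairing $\pi$ of $B$ such that, for every vertex $v$ of $B$, either $v$ and $\pi(v)$ are joined by an edge of color $0$, or the edges of color $0$ at $v$ and at $\pi(v)$ both have their other end outside $B$ and form a 2-edge-cut of $G$ (removing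 both disconnects $G$, removing fewer does not). Theorem. Let $B_1,\dots,B_N$ be planar bubbles, let $n_1,\dots,n_N\ge 0$ be integers, and let $B$ be an arbitrary bubble. Let $\mathcal G$ be the set of connected colored graphs whose bubbles are one marked copy of $B$ and, for each $i$, exactly $n_i$ further bubbles, which are copies of $B_i$. Then: 1. $G\in\mathcal G$ maximizes $C_0$ over $\mathcal G$ if and only if all its bubbles satisfy the maximal 2-cut property; likewise, $G\in\mathcal G$ maximizes $C$ over $\mathcal G$ if and only if all its bubbles satisfy the maximal 2-cut property. 2. The maximum of $C_0$ over $\mathcal G$ exists and equals $$C_1(B)+\sum_{i=1}^N n_i\bigl(C_1(B_i)-3\bigr).$$ 3. Every maximizer $G$ is tree-like: one can choose an optimal pairing of each of its bubbles such that, calling chains the closed sequences of vertices which alternate edges of color $0$ and pairs, each chain visits each bubble along at most one pair, and the bipartite incidence graph between the bubbles and the chains of $G$ is a tree. -/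

import Mathlib

universe u

/-- A finite-or-infinite bipartite regular edge-colored (multi)graph with vertex set `V` and colors
`C`: the vertices are white or black, and every vertex is incident to exactly one edge of each
color `c`, whose other end `nbr c v` has the opposite shade. (Connectedness is a separate
predicate. Edges of different colors may be parallel.) -/
structure ColoredGraph (C : Type) (V : Type u) where
  white : V → Bool
  nbr : C → V → V
  nbr_nbr : ∀ c v, nbr c (nbr c v) = v
  white_nbr : ∀ c v, white (nbr c v) = !white v

namespace ColoredGraph

variable {C : Type} {V W : Type u}

theorem nbr_ne (G : ColoredGraph C V) (c : C) (v : V) : G.nbr c v ≠ v := by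
  intro h
  have := G.white_nbr c v
  rw [h] at this
  cases hw : G.white v <;> simp [hw] at this

/-- The subgraph `G(S)` which keeps all vertices and the edges with colors in `S`
(up to multiplicity of edges, which is irrelevant for its connected components). -/
def sub (G : ColoredGraph C V) (S : Set C) : SimpleGraph V where
  Adj v w := ∃ c ∈ S, G.nbr c v = w
  symm := ⟨by rintro v w ⟨c, hc, rfl⟩; exact ⟨c, hc, G.nbr_nbr c v⟩⟩
  loopless := ⟨by rintro v ⟨c, _, h⟩; exact G.nbr_ne c v h⟩

/-- Connectedness (in particular there is at least one vertex). -/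
def IsConnected (G : ColoredGraph C V) : Prop := (G.sub Set.univ).Connected

/-- `C_{ab}(G)`: the number of bicolored cycles with colors `{a, b}`. -/
noncomputable def numCycles (G : ColoredGraph C V) (a b : C) : ℕ :=
  Nat.card (G.sub {a, b}).ConnectedComponent

/-- Isomorphism of colored graphs (respecting edge colors and the shades of the vertices). -/
def Isomorphic (G : ColoredGraph C V) (H : ColoredGraph C W) : Prop :=
  ∃ f : V ≃ W, (∀ v, H.white (f v) = G.white v) ∧ ∀ c v, H.nbr c (f v) = f (G.nbr c v)

/-! ### Bubbles: three colors, here indexed by `Fin 3` -/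

section Planarity

variable (B : ColoredGraph (Fin 3) V)

/-- The edge involution of the canonical embedding, acting on the half-edges `(v, c)`. -/
def edgePerm : Equiv.Perm (V × Fin 3) where
  toFun d := (B.nbr d.2 d.1, d.2)
  invFun d := (B.nbr d.2 d.1, d.2)
  left_inv d := by simp [B.nbr_nbr]
  right_inv d := by simp [B.nbr_nbr]

/-- The rotation system of the canonical embedding: the cyclic order of the colors is `(123)`
around white vertices and `(132)` around black vertices. -/
def rotation : Equiv.Perm (V × Fin 3) where
  toFun d := (d.1, if B.white d.1 then d.2 + 1 else d.2 - 1)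
  invFun d := (d.1, if B.white d.1 then d.2 - 1 else d.2 + 1)
  left_inv d := by rcases d with ⟨v, c⟩; cases h : B.white v <;> simp [h]
  right_inv d := by rcases d with ⟨v, c⟩; cases h : B.white v <;> simp [h]

/-- The number of orbits of a permutation (fixed points included). -/
noncomputable def numOrbits {D : Type u} (σ : Equiv.Perm D) : ℕ :=
  Nat.card (Quotient (Equiv.Perm.SameCycle.setoid σ))

/-- A bubble is planar if it is connected and its canonical embedding, as a combinatorial map,
has Euler characteristic `2`. The vertices, edges and faces of the map are the orbits of the
rotation, of the edge involution and of their composition. -/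
def IsPlanar : Prop :=
  B.IsConnected ∧
    (numOrbits B.rotation : ℤ) - numOrbits B.edgePerm + numOrbits (B.rotation * B.edgePerm) = 2

end Planarity

/-! ### Colored graphs with colors `0, 1, 2, 3` -/

/-- `C_0(G)`: the number of bicolored cycles with colors `{0, a}`, `a = 1, 2, 3`. -/
noncomputable def zeroCycles (G : ColoredGraph (Fin 4) V) : ℕ :=
  ∑ a : Fin 3, G.numCycles 0 a.succ

/-- `C(G)`: the total number of bicolored cycles with colors `{a, b}`, `0 ≤ a < b ≤ 3`. -/
noncomputable def totalCycles (G : ColoredGraph (Fin 4) V) : ℕ :=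
  ∑ a : Fin 4, ∑ b ∈ Finset.Ioi a, G.numCycles a b

/-- The bubbles of `G`: the connected components left after removing the edges of color `0`. -/
abbrev Bubble (G : ColoredGraph (Fin 4) V) : Type u := (G.sub {c | c ≠ 0}).ConnectedComponent

/-- The bubble containing a vertex. -/
abbrev bubbleOf (G : ColoredGraph (Fin 4) V) (v : V) : G.Bubble :=
  (G.sub {c | c ≠ 0}).connectedComponentMk v

theorem bubbleOf_nbr_succ (G : ColoredGraph (Fin 4) V) (c : Fin 3) (v : V) :
    G.bubbleOf (G.nbr c.succ v) = G.bubbleOf v :=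
  SimpleGraph.ConnectedComponent.sound
    (SimpleGraph.Adj.reachable (G := G.sub {c | c ≠ 0})
      ⟨c.succ, Fin.succ_ne_zero c, G.nbr_nbr _ _⟩)

/-- A bubble of `G` as a colored graph of its own; the colors `1, 2, 3` are renamed `0, 1, 2`. -/
def bubbleGraph (G : ColoredGraph (Fin 4) V) (b : G.Bubble) :
    ColoredGraph (Fin 3) {v : V // G.bubbleOf v = b} where
  white v := G.white v
  nbr c v := ⟨G.nbr c.succ v, (G.bubbleOf_nbr_succ c v).trans v.2⟩
  nbr_nbr c v := Subtype.ext (G.nbr_nbr c.succ v)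
  white_nbr c v := G.white_nbr c.succ v

/-! ### Pairings -/

/-- A pairing of a bubble: a perfect matching between its white and its black vertices. -/
structure Pairing (B : ColoredGraph (Fin 3) V) where
  pair : V → V
  pair_pair : ∀ v, pair (pair v) = v
  white_pair : ∀ v, B.white (pair v) = !B.white v

/-- The one-bubble graph defined by a pairing, whose pairs are joined by edges of color `0`. -/
def Pairing.graph {B : ColoredGraph (Fin 3) V} (π : Pairing B) : ColoredGraph (Fin 4) V where
  white := B.white
  nbr c := Fin.cases π.pair B.nbr c
  nbr_nbr c := by cases c using Fin.cases <;> simp [π.pair_pair, B.nbr_nbr]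
  white_nbr c := by cases c using Fin.cases <;> simp [π.white_pair, B.white_nbr]

/-- `C_1(B)`: the maximal number of bicolored cycles with colors `{0, a}` of the one-bubble graphs
of `B`. -/
noncomputable def oneMax (B : ColoredGraph (Fin 3) V) : ℕ := ⨆ π : Pairing B, π.graph.zeroCycles

/-- The pairings whose one-bubble graphs maximize the number of bicolored cycles. -/
def Pairing.IsMax {B : ColoredGraph (Fin 3) V} (π : Pairing B) : Prop :=
  ∀ π' : Pairing B, π'.graph.zeroCycles ≤ π.graph.zeroCycles

/-! ### Edge-cuts and the maximal 2-cut property -/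

section Cuts

variable (G : ColoredGraph (Fin 4) V)

/-- The edge of color `0` at a vertex. -/
def zeroEdge (v : V) : Sym2 V := s(v, G.nbr 0 v)

/-- `G` with the edges of color `0` belonging to `S` removed (edges of other colors parallel to
them are kept). -/
def deleteZero (S : Set (Sym2 V)) : SimpleGraph V where
  Adj v w := ∃ c, G.nbr c v = w ∧ (c = 0 → G.zeroEdge v ∉ S)
  symm := ⟨by
    rintro v w ⟨c, rfl, h⟩
    refine ⟨c, G.nbr_nbr c v, ?_⟩
    rintro rfl
    simpa [zeroEdge, G.nbr_nbr, Sym2.eq_swap] using h rfl⟩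
  loopless := ⟨by rintro v ⟨c, h, _⟩; exact G.nbr_ne c v h⟩

/-- `S` is an edge-cut formed by edges of color `0`: removing `S` disconnects the graph, removing
only a proper subset of `S` does not. -/
def IsZeroEdgeCut (S : Set (Sym2 V)) : Prop :=
  S ⊆ Set.range G.zeroEdge ∧ ¬ (G.deleteZero S).Connected ∧
    ∀ T, T ⊂ S → (G.deleteZero T).Connected

/-- The edge of color `0` at the vertex `v` of the bubble `b` has its other end outside `b`. -/
def Leaves (b : G.Bubble) (v : V) : Prop := G.bubbleOf v = b ∧ G.bubbleOf (G.nbr 0 v) ≠ b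

/-- The maximal 2-cut property of the bubble `b` of `G`: there is an optimal pairing `π` of `b`
such that for each pair `{v, π v}` either `v` and `π v` are joined by an edge of color `0`, or the
two edges of color `0` at `v` and `π v` form a 2-edge-cut incident on `b` (i.e. they both have one
end in `b` and the other end outside `b`). -/
def MaximalTwoCut (b : G.Bubble) : Prop :=
  ∃ π : Pairing (G.bubbleGraph b), π.IsMax ∧
    ∀ v : {v : V // G.bubbleOf v = b},
      G.nbr 0 v = π.pair v ∨
        (G.Leaves b v ∧ G.Leaves b (π.pair v) ∧
          G.IsZeroEdgeCut {G.zeroEdge v, G.zeroEdge (π.pair v)})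

end Cuts

/-! ### Graphs built from prescribed bubbles -/

/-- `G` is a connected colored graph with one marked bubble `B` and, for each `i`, exactly `n i`
further bubbles, which are copies of `B_i`. -/
def IsBuiltFrom (G : ColoredGraph (Fin 4) V) {U : Type u} (B : ColoredGraph (Fin 3) U) {N : ℕ}
    {Us : Fin N → Type u} (Bs : ∀ i, ColoredGraph (Fin 3) (Us i)) (n : Fin N → ℕ) : Prop :=
  G.IsConnected ∧ ∃ (marked : G.Bubble) (type : {b : G.Bubble // b ≠ marked} → Fin N),
    (G.bubbleGraph marked).Isomorphic B ∧
    (∀ b, (G.bubbleGraph b.1).Isomorphic (Bs (type b))) ∧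
    ∀ i, Nat.card {b // type b = i} = n i

/-- `G` is one of the graphs built from `B` and `n i` copies of each `B_i`, and it maximizes the
quantity `F` among all of them. -/
def MaximizesAmong (F : ∀ {V' : Type u}, ColoredGraph (Fin 4) V' → ℕ)
    (G : ColoredGraph (Fin 4) V) {U : Type u} (B : ColoredGraph (Fin 3) U) {N : ℕ}
    {Us : Fin N → Type u} (Bs : ∀ i, ColoredGraph (Fin 3) (Us i)) (n : Fin N → ℕ) : Prop :=
  G.IsBuiltFrom B Bs n ∧
    ∀ (V' : Type u) [Finite V'] (G' : ColoredGraph (Fin 4) V'),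
      G'.IsBuiltFrom B Bs n → F G' ≤ F G

/-! ### Tree-like graphs -/

section Tree

variable (G : ColoredGraph (Fin 4) V) (π : ∀ b : G.Bubble, Pairing (G.bubbleGraph b))

/-- The partner of a vertex in the pairing of its bubble. -/
def partner (v : V) : V := (π (G.bubbleOf v)).pair ⟨v, rfl⟩

/-- The edges of color `0` together with the pairs of all the pairings. Its connected components
are the closed chains which alternate pairs and edges of color `0`. -/
def chainGraph : SimpleGraph V :=
  SimpleGraph.fromRel fun v w => w = G.nbr 0 v ∨ w = G.partner π v

/-- The incidence graph between bubbles and closed chains. -/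
def incidenceGraph : SimpleGraph (G.Bubble ⊕ (G.chainGraph π).ConnectedComponent) :=
  SimpleGraph.fromRel fun x y =>
    ∃ v : V, x = Sum.inl (G.bubbleOf v) ∧ y = Sum.inr ((G.chainGraph π).connectedComponentMk v)

/-- `G` is tree-like: for suitable optimal pairings of its bubbles, each closed chain visits each
bubble along at most one pair, and the incidence graph of bubbles and closed chains is a tree. -/
def IsTreeLike : Prop :=
  ∃ π : ∀ b : G.Bubble, Pairing (G.bubbleGraph b), (∀ b, (π b).IsMax) ∧
    (∀ v w : V, G.bubbleOf v = G.bubbleOf w → (G.chainGraph π).Reachable v w →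
      w = v ∨ w = G.partner π v) ∧
    (G.incidenceGraph π).IsTree

end Tree

end ColoredGraph

/-!
A colored graph is encoded by permutations of its white vertices. Identifying the black vertices
with the white ones along color `1`, the colors `1, 2, 3` become permutations `τ 0 = 1, τ 1, τ 2`
and color `0` a permutation `π`; the bicolored cycles with color `0` are the cycles of the
`(τ d)⁻¹ * π`. Multiplying `π` by a transposition `swap x y` reconnects the edges of color `0` at
`x` and `y`, and splits or merges one cycle for each of the three other colors. If the reconnection
disconnects a component, all three are split, so that the score

  `score τ π = (number of bicolored cycles with color 0) - 3 * (number of components)`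

is unchanged (`score_cut`).

A permutation `ρ` which stays within the bubbles is a choice of pairings, and the chains are the
cycles of `ρ⁻¹ * π`. The gluing is tree-like if the incidence graph of bubbles and chains is a
forest; then it can be cut along its chains into the one-bubble graphs of the pairings, so that
`score τ π = score τ ρ` (`TreeLike.score_eq`). The heart of the proof is
`PlanarOff.exists_treeLike`: if all bubbles except possibly one are planar, then *every* maximizer
of the score is tree-like for suitable pairings. This goes by induction on the number of white
vertices in planar bubbles with more than two vertices. A vertex `v` at which color `0` is parallel to some color can be contracted, which changes
the score of all competing gluings by the same amount (`PlanarOff.contract`,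
`exists_treeLike_of_contract`). Two edges of color `0` which share two bicolored cycles form a cut
in a maximizer (`IsMaximizer.cut`), so that one may reconnect them to create a contractible vertex.
If this is never possible, one uses a face with two or four edges of a planar bubble, which exists
by Euler's formula (`exists_short_face`). A face with two edges would create a cut as before, and
for a face with four edges, reconnecting the edges of color `0` at both of its black vertices
preserves the score; the pairings of the
resulting tree-like gluing can be changed back into pairings of the given one
(`exists_treeLike_of_square`).

For graphs with a given set of bubbles this yields the upper bound for the number of bicolored
cycles with color `0`, with equality exactly for the graphs which are tree-like for optimal pairings
(`ColoredGraph.zeroCycles_le_and_eq_iff`). That these are the graphs with the maximal 2-cut property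
is `ColoredGraph.forall_maximalTwoCut_iff`: in a tree-like gluing the two edges of color `0` at a
pair follow each other on a chain, hence form a cut unless they coincide, and conversely cutting
successively along such pairs exhibits the tree. The bound is attained since optimal pairings can
be connected in a tree-like way by merging components one after another
(`exists_connected_treeLike`). The bicolored cycles without color `0` only depend on the bubbles,
so the total number of cycles is maximized by the same graphs.
-/

set_option linter.unusedSectionVars false

/-! ### Permutations, their cycles and transpositions -/

namespace PermGluing

open Equiv Equiv.Perm

variable {α : Type u}

/-- The number of classes of an equivalence relation. -/
noncomputable def classes (r : Setoid α) : ℕ := Nat.card (Quotient r)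

/-- The equivalence relation generated by `r` and the additional pair `(x, y)`. -/
def glue (r : Setoid α) (x y : α) : Setoid α where
  r a b := r a b ∨ (r a x ∧ r y b) ∨ (r a y ∧ r x b)
  iseqv :=
    { refl := fun a => Or.inl (r.refl a)
      symm := by
        rintro a b (h | ⟨h, h'⟩ | ⟨h, h'⟩)
        · exact Or.inl (r.symm h)
        · exact Or.inr (Or.inr ⟨r.symm h', r.symm h⟩)
        · exact Or.inr (Or.inl ⟨r.symm h', r.symm h⟩)
      trans := by
        rintro a b c (h | ⟨h, h'⟩ | ⟨h, h'⟩) (k | ⟨k, k'⟩ | ⟨k, k'⟩)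
        · exact Or.inl (r.trans h k)
        · exact Or.inr (Or.inl ⟨r.trans h k, k'⟩)
        · exact Or.inr (Or.inr ⟨r.trans h k, k'⟩)
        · exact Or.inr (Or.inl ⟨h, r.trans h' k⟩)
        · exact Or.inr (Or.inl ⟨h, k'⟩)
        · exact Or.inl (r.trans h k')
        · exact Or.inr (Or.inr ⟨h, r.trans h' k⟩)
        · exact Or.inl (r.trans h k')
        · exact Or.inr (Or.inr ⟨h, k'⟩) }

theorem glue_def {r : Setoid α} {x y a b : α} :
    glue r x y a b ↔ r a b ∨ (r a x ∧ r y b) ∨ (r a y ∧ r x b) := Iff.rfl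

theorem le_glue (r : Setoid α) (x y : α) : r ≤ glue r x y := fun _ _ h => Or.inl h

theorem glue_pair (r : Setoid α) (x y : α) : glue r x y x y :=
  Or.inr (Or.inl ⟨r.refl x, r.refl y⟩)

theorem glue_le {r t : Setoid α} {x y : α} (h : r ≤ t) (hxy : t x y) : glue r x y ≤ t := by
  rintro a b (k | ⟨k, k'⟩ | ⟨k, k'⟩)
  · exact h k
  · exact t.trans (h k) (t.trans hxy (h k'))
  · exact t.trans (h k) (t.trans (t.symm hxy) (h k'))

theorem glue_mono {r t : Setoid α} (x y : α) (h : r ≤ t) : glue r x y ≤ glue t x y :=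
  glue_le (h.trans (le_glue t x y)) (glue_pair t x y)

theorem glue_eq_self {r : Setoid α} {x y : α} (h : r x y) : glue r x y = r :=
  le_antisymm (glue_le le_rfl h) (le_glue r x y)

theorem classes_glue [Finite α] {r : Setoid α} {x y : α} (h : ¬ r x y) :
    classes (glue r x y) + 1 = classes r := by
  classical
  let f : Quotient r → Option (Quotient (glue r x y)) := fun q =>
    if q = Quotient.mk r y then none
    else some (Quotient.map' (s₁ := r) (s₂ := glue r x y) id (le_glue r x y) q)
  have hf : Function.Bijective f := by
    constructor
    · intro p q
      induction p using Quotient.inductionOn with | h a => ?_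
      induction q using Quotient.inductionOn with | h b => ?_
      intro hab
      by_cases ha : Quotient.mk r a = Quotient.mk r y <;>
        by_cases hb : Quotient.mk r b = Quotient.mk r y
      · rw [ha, hb]
      · simp [f, ha, hb] at hab
      · simp [f, ha, hb] at hab
      · simp only [f, ha, hb, if_false, Option.some.injEq] at hab
        have hab' : glue r x y a b := Quotient.exact hab
        rcases hab' with k | ⟨_, k'⟩ | ⟨k, _⟩
        · exact Quotient.sound k
        · exact absurd (Quotient.sound (r.symm k')) hb
        · exact absurd (Quotient.sound k) ha
    · intro o
      cases o with
      | none => exact ⟨Quotient.mk r y, by simp [f]⟩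
      | some q =>
        induction q using Quotient.inductionOn with | h a => ?_
        by_cases ha : r a y
        · refine ⟨Quotient.mk r x, ?_⟩
          have hx : ¬ Quotient.mk r x = Quotient.mk r y := fun e => h (Quotient.exact e)
          simp only [f, hx, if_false, Option.some.injEq]
          exact Quotient.sound (Or.inr (Or.inl ⟨r.refl x, r.symm ha⟩))
        · refine ⟨Quotient.mk r a, ?_⟩
          have hx : ¬ Quotient.mk r a = Quotient.mk r y := fun e => ha (Quotient.exact e)
          simp only [f, hx, if_false, Option.some.injEq]
          rfl
  have := Nat.card_eq_of_bijective f hf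
  rw [Finite.card_option] at this
  exact this.symm

theorem classes_anti [Finite α] {r t : Setoid α} (h : r ≤ t) : classes t ≤ classes r :=
  Nat.card_le_card_of_surjective (Quotient.map' (s₁ := r) (s₂ := t) id h) (by
    intro q
    induction q using Quotient.inductionOn with | h a => ?_
    exact ⟨Quotient.mk r a, rfl⟩)

theorem classes_le_glue_add_one [Finite α] (r : Setoid α) (x y : α) :
    classes r ≤ classes (glue r x y) + 1 := by
  by_cases h : r x y
  · rw [glue_eq_self h]; omega
  · rw [classes_glue h]

theorem inv_apply_self' (σ : Perm α) (x : α) : σ⁻¹ (σ x) = x := σ.symm_apply_apply x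

theorem apply_inv_self' (σ : Perm α) (x : α) : σ (σ⁻¹ x) = x := σ.apply_symm_apply x

/-- The partition of `α` into the cycles of a permutation. -/
abbrev cyc (σ : Perm α) : Setoid α := SameCycle.setoid σ

theorem cyc_apply (σ : Perm α) (x : α) : cyc σ x (σ x) :=
  sameCycle_apply_right.2 (SameCycle.refl σ x)

theorem cyc_inv (σ : Perm α) : cyc σ⁻¹ = cyc σ := by
  ext x y; exact sameCycle_inv

theorem cyc_le_iff [Finite α] {σ : Perm α} {r : Setoid α} : cyc σ ≤ r ↔ ∀ x, r x (σ x) := by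
  constructor
  · intro h x
    exact h (cyc_apply σ x)
  · intro h x y hxy
    obtain ⟨n, rfl⟩ := SameCycle.exists_nat_pow_eq hxy
    clear hxy
    induction n with
    | zero => exact r.refl x
    | succ n ih =>
      rw [pow_succ', Perm.mul_apply]
      exact r.trans ih (h _)

theorem cyc_one_iff {x y : α} : cyc (1 : Perm α) x y ↔ x = y := sameCycle_one

theorem classes_cyc_one : classes (cyc (1 : Perm α)) = Nat.card α := by
  refine Nat.card_congr (Equiv.ofBijective (Quotient.mk (cyc (1 : Perm α)))
    ⟨fun x y h => ?_, Quotient.mk_surjective⟩).symm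
  exact cyc_one_iff.1 (Quotient.exact h)

variable [Finite α] [DecidableEq α]

theorem cyc_mul_swap_le (σ : Perm α) (x y : α) : cyc (σ * swap x y) ≤ glue (cyc σ) x y := by
  rw [cyc_le_iff]
  intro z
  rw [Perm.mul_apply]
  by_cases hx : z = x
  · subst hx
    rw [swap_apply_left]
    exact Or.inr (Or.inl ⟨(cyc σ).refl z, cyc_apply σ y⟩)
  · by_cases hy : z = y
    · subst hy
      rw [swap_apply_right]
      exact Or.inr (Or.inr ⟨(cyc σ).refl z, cyc_apply σ x⟩)
    · rw [swap_apply_of_ne_of_ne hx hy]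
      exact Or.inl (cyc_apply σ z)

theorem cyc_le_mul_swap (σ : Perm α) (x y : α) : cyc σ ≤ glue (cyc (σ * swap x y)) x y := by
  have := cyc_mul_swap_le (σ * swap x y) x y
  rwa [mul_assoc, swap_mul_self, mul_one] at this

/-- Multiplication by the transposition of two elements of different cycles merges these cycles. -/
theorem cyc_mul_swap_of_not {σ : Perm α} {x y : α} (h : ¬ cyc σ x y) :
    cyc (σ * swap x y) x y := by
  have key : ∀ n : ℕ, cyc (σ * swap x y) x ((σ ^ (n + 1)) y) ∨ cyc (σ * swap x y) x y := by
    intro n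
    induction n with
    | zero =>
      left
      have := cyc_apply (σ * swap x y) x
      rwa [Perm.mul_apply, swap_apply_left] at this
    | succ n ih =>
      rcases ih with ih | ih
      · by_cases hy : (σ ^ (n + 1)) y = y
        · right; rwa [hy] at ih
        · left
          have hx : (σ ^ (n + 1)) y ≠ x := by
            intro e
            exact h (SameCycle.symm ⟨(n + 1 : ℕ), by rw [zpow_natCast]; exact e⟩)
          have := cyc_apply (σ * swap x y) ((σ ^ (n + 1)) y)
          rw [Perm.mul_apply, swap_apply_of_ne_of_ne hx hy] at this
          rw [pow_succ', Perm.mul_apply]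
          exact (cyc _).trans ih this
      · exact Or.inr ih
  have ho : (σ ^ ((orderOf σ - 1) + 1)) y = y := by
    rw [Nat.sub_add_cancel (orderOf_pos σ), pow_orderOf_eq_one]; rfl
  rcases key (orderOf σ - 1) with k | k
  · rwa [ho] at k
  · exact k

/-- Multiplication by the transposition of two elements of one cycle splits this cycle. -/
theorem not_cyc_mul_swap {σ : Perm α} {x y : α} (hxy : x ≠ y) (h : cyc σ x y) :
    ¬ cyc (σ * swap x y) x y := by
  intro h'
  obtain ⟨m, hm0, -, hm⟩ := SameCycle.exists_pow_eq'' h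
  have hex : ∃ n : ℕ, 0 < n ∧ (σ ^ n) x = y := ⟨m, hm0, hm⟩
  classical
  obtain ⟨n, ⟨hn0, hn⟩, hmin⟩ : ∃ n : ℕ, (0 < n ∧ (σ ^ n) x = y) ∧
      ∀ i, i < n → ¬ (0 < i ∧ (σ ^ i) x = y) :=
    ⟨Nat.find hex, Nat.find_spec hex, fun i hi => Nat.find_min hex hi⟩
  have hnx : ∀ i, 0 < i → i ≤ n → (σ ^ i) x ≠ x := by
    intro i hi hin e
    rcases hin.lt_or_eq with hlt | rfl
    · refine hmin (n - i) (by omega) ⟨by omega, ?_⟩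
      have : (σ ^ (n - i)) ((σ ^ i) x) = y := by
        rw [← Perm.mul_apply, ← pow_add, Nat.sub_add_cancel hin, hn]
      rwa [e] at this
    · exact hxy (e.symm.trans hn)
  have hclosed : ∀ j : ℕ, ∃ i, 0 < i ∧ i ≤ n ∧ ((σ * swap x y) ^ j) y = (σ ^ i) x := by
    intro j
    induction j with
    | zero => exact ⟨n, hn0, le_rfl, hn.symm⟩
    | succ j ih =>
      obtain ⟨i, hi, hin, e⟩ := ih
      rw [pow_succ', Perm.mul_apply, e, Perm.mul_apply]
      rcases hin.lt_or_eq with hlt | rfl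
      · refine ⟨i + 1, by omega, hlt, ?_⟩
        rw [swap_apply_of_ne_of_ne (hnx i hi hin) (fun e' => hmin i hlt ⟨hi, e'⟩), pow_succ',
          Perm.mul_apply]
      · refine ⟨1, one_pos, hi, ?_⟩
        rw [hn, swap_apply_right, pow_one]
  obtain ⟨j, hj⟩ := SameCycle.exists_nat_pow_eq (SameCycle.symm h')
  obtain ⟨i, hi, hin, e⟩ := hclosed j
  exact hnx i hi hin (e.symm.trans hj)

theorem cyc_mul_swap_eq_glue {σ : Perm α} {x y : α} (h : ¬ cyc σ x y) :
    cyc (σ * swap x y) = glue (cyc σ) x y := by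
  refine le_antisymm (cyc_mul_swap_le σ x y) ?_
  have := cyc_le_mul_swap σ x y
  rw [glue_eq_self (cyc_mul_swap_of_not h)] at this
  exact glue_le this (cyc_mul_swap_of_not h)

theorem cyc_eq_glue_mul_swap {σ : Perm α} {x y : α} (hxy : x ≠ y) (h : cyc σ x y) :
    cyc σ = glue (cyc (σ * swap x y)) x y := by
  have := cyc_mul_swap_eq_glue (not_cyc_mul_swap hxy h)
  rwa [mul_assoc, swap_mul_self, mul_one] at this

theorem classes_cyc_merge {σ : Perm α} {x y : α} (h : ¬ cyc σ x y) :
    classes (cyc (σ * swap x y)) + 1 = classes (cyc σ) := by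
  rw [cyc_mul_swap_eq_glue h, classes_glue h]

theorem classes_cyc_split {σ : Perm α} {x y : α} (hxy : x ≠ y) (h : cyc σ x y) :
    classes (cyc (σ * swap x y)) = classes (cyc σ) + 1 := by
  rw [cyc_eq_glue_mul_swap hxy h, classes_glue (not_cyc_mul_swap hxy h)]

theorem classes_cyc_le_mul_swap (σ : Perm α) (x y : α) :
    classes (cyc σ) ≤ classes (cyc (σ * swap x y)) + 1 := by
  by_cases hxy : x = y
  · subst hxy
    rw [swap_self]
    change _ ≤ classes (cyc (σ * 1)) + 1
    rw [mul_one]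
    omega
  by_cases h : cyc σ x y
  · rw [classes_cyc_split hxy h]; omega
  · rw [classes_cyc_merge h]

theorem classes_cyc_swap_mul {α : Type u} [DecidableEq α] (σ : Perm α) (x y : α) :
    classes (cyc (swap x y * σ)) = classes (cyc (σ * swap x y)) := by
  have h : ∀ a b, cyc (σ * swap x y) a b ↔ cyc (swap x y * σ) (swap x y a) (swap x y b) := by
    intro a b
    have := sameCycle_conj (g := swap x y) (f := σ * swap x y) (x := swap x y a)
      (y := swap x y b)
    rw [swap_inv, swap_apply_self, swap_apply_self, mul_assoc, mul_assoc, swap_mul_self,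
      mul_one] at this
    exact this.symm
  exact Nat.card_congr (Quotient.congr (swap x y) h).symm

end PermGluing

/-! ### Gluings of bubbles -/

namespace PermGluing

open Equiv Equiv.Perm

variable {α : Type u} [Finite α] [DecidableEq α]

/-- The bubbles of the colors `1, 2, 3`, as a partition of the white vertices: `τ d` sends a white
vertex to its black neighbor along the color `d + 1`, the black vertices being identified with
`α`. -/
def bub (τ : Fin 3 → Perm α) : Setoid α := ⨆ a, ⨆ b, cyc ((τ a)⁻¹ * τ b)

/-- The connected components of the gluing with color `0` given by `π`, as a partition of the white
vertices. -/
def conn (τ : Fin 3 → Perm α) (π : Perm α) : Setoid α := bub τ ⊔ cyc ((τ 0)⁻¹ * π)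

/-- The number of bicolored cycles with color `0` and another color. -/
noncomputable def zc (τ : Fin 3 → Perm α) (π : Perm α) : ℕ :=
  ∑ d, classes (cyc ((τ d)⁻¹ * π))

/-- The number of bicolored cycles with color `0`, corrected by the number of components: this
does not change when one reconnects the two edges of a 2-edge-cut of color `0`. -/
noncomputable def score (τ : Fin 3 → Perm α) (π : Perm α) : ℤ :=
  zc τ π - 3 * classes (conn τ π)

/-- The edges of color `0` given by `ρ` stay within the bubbles, so that `ρ` is a choice of one
pairing of each bubble. -/
def Preserves (τ : Fin 3 → Perm α) (ρ : Perm α) : Prop := ∀ x, bub τ x ((τ 0)⁻¹ (ρ x))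

/-- The gluing `π` is tree-like for the pairings `ρ`: the incidence graph of the bubbles and the
chains, which are the cycles of `ρ⁻¹ * π`, is a forest. The vertices of this graph are the bubbles
and the chains, its edges are the white vertices and its components are those of the gluing, so
this is the vanishing of its first Betti number. -/
def TreeLike (τ : Fin 3 → Perm α) (ρ π : Perm α) : Prop :=
  classes (bub τ) + classes (cyc (ρ⁻¹ * π)) = Nat.card α + classes (conn τ π)

variable {τ : Fin 3 → Perm α} {π ρ : Perm α} {x y : α}

theorem bub_le_iff {r : Setoid α} : bub τ ≤ r ↔ ∀ a b x, r x ((τ a)⁻¹ (τ b x)) := by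
  simp only [bub, iSup_le_iff, cyc_le_iff, Perm.mul_apply]

theorem bub_step (τ : Fin 3 → Perm α) (a b : Fin 3) (x : α) : bub τ x ((τ a)⁻¹ (τ b x)) :=
  bub_le_iff.1 le_rfl a b x

theorem cyc_le_bub (τ : Fin 3 → Perm α) (a b : Fin 3) : cyc ((τ a)⁻¹ * τ b) ≤ bub τ :=
  cyc_le_iff.2 (bub_step τ a b)

theorem bub_of_eq {a b : Fin 3} {x y : α} (h : τ a x = τ b y) : bub τ x y := by
  have := bub_step τ b a x
  rwa [h, inv_apply_self'] at this

theorem conn_le_iff {r : Setoid α} :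
    conn τ π ≤ r ↔ (∀ a b x, r x ((τ a)⁻¹ (τ b x))) ∧ ∀ x, r x ((τ 0)⁻¹ (π x)) := by
  simp only [conn, sup_le_iff, bub_le_iff, cyc_le_iff, Perm.mul_apply]

theorem bub_le_conn (τ : Fin 3 → Perm α) (π : Perm α) : bub τ ≤ conn τ π := le_sup_left

theorem conn_step (τ : Fin 3 → Perm α) (π : Perm α) (d : Fin 3) (x : α) :
    conn τ π x ((τ d)⁻¹ (π x)) := by
  have h0 : conn τ π x ((τ 0)⁻¹ (π x)) := (conn_le_iff.1 le_rfl).2 x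
  refine (conn τ π).trans h0 (bub_le_conn τ π ?_)
  have := bub_step τ d 0 ((τ 0)⁻¹ (π x))
  rwa [apply_inv_self'] at this

theorem cyc_le_conn (τ : Fin 3 → Perm α) (π : Perm α) (d : Fin 3) :
    cyc ((τ d)⁻¹ * π) ≤ conn τ π :=
  cyc_le_iff.2 (conn_step τ π d)

theorem conn_eq (τ : Fin 3 → Perm α) (π : Perm α) (d : Fin 3) :
    conn τ π = bub τ ⊔ cyc ((τ d)⁻¹ * π) := by
  refine le_antisymm (conn_le_iff.2 ⟨fun a b x => ?_, fun x => ?_⟩)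
    (sup_le (bub_le_conn τ π) (cyc_le_conn τ π d))
  · exact (le_sup_left : bub τ ≤ _) (bub_step τ a b x)
  · refine Setoid.trans' _ ((le_sup_right : cyc ((τ d)⁻¹ * π) ≤ _) (cyc_apply _ x)) ?_
    refine (le_sup_left : bub τ ≤ _) ?_
    have := bub_step τ 0 d ((τ d)⁻¹ (π x))
    rwa [apply_inv_self'] at this

theorem Preserves.bub_inv (h : Preserves τ ρ) (d : Fin 3) (x : α) :
    bub τ x (ρ⁻¹ (τ d x)) := by
  have h1 := h (ρ⁻¹ (τ d x))
  rw [apply_inv_self'] at h1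
  exact (bub τ).trans (bub_step τ 0 d x) ((bub τ).symm h1)

theorem Preserves.bub_apply (h : Preserves τ ρ) (d : Fin 3) (x : α) :
    bub τ x ((τ d)⁻¹ (ρ x)) := by
  have h1 := bub_step τ d 0 ((τ 0)⁻¹ (ρ x))
  rw [apply_inv_self'] at h1
  exact (bub τ).trans (h x) h1

/-- If `ρ` preserves the bubbles, the components are generated by the bubbles and the chains. -/
theorem Preserves.conn_eq (h : Preserves τ ρ) : conn τ π = bub τ ⊔ cyc (ρ⁻¹ * π) := by
  refine le_antisymm (conn_le_iff.2 ⟨fun a b x => ?_, fun x => ?_⟩)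
    (sup_le (bub_le_conn τ π) (cyc_le_iff.2 fun x => ?_))
  · exact (le_sup_left : bub τ ≤ _) (bub_step τ a b x)
  · refine Setoid.trans' _ ((le_sup_right : cyc (ρ⁻¹ * π) ≤ _) (cyc_apply _ x)) ?_
    refine (le_sup_left : bub τ ≤ _) ?_
    have := h (ρ⁻¹ (π x))
    rwa [apply_inv_self'] at this
  · refine (conn τ π).trans (conn_step τ π 0 x) (bub_le_conn τ π ?_)
    have := h.bub_inv 0 ((τ 0)⁻¹ (π x))
    rwa [apply_inv_self'] at this

theorem Preserves.chain_le (h : Preserves τ ρ) : cyc (ρ⁻¹ * π) ≤ conn τ π := by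
  rw [h.conn_eq]; exact le_sup_right

theorem Preserves.conn_self (h : Preserves τ ρ) : conn τ ρ = bub τ :=
  le_antisymm (conn_le_iff.2 ⟨bub_step τ, h⟩) (bub_le_conn τ ρ)

theorem Preserves.mul_swap (h : Preserves τ ρ) {x y : α} (hxy : bub τ x y) :
    Preserves τ (ρ * swap x y) := by
  intro z
  rw [Perm.mul_apply]
  by_cases hx : z = x
  · subst hx; rw [swap_apply_left]; exact (bub τ).trans hxy (h y)
  · by_cases hy : z = y
    · subst hy; rw [swap_apply_right]; exact (bub τ).trans ((bub τ).symm hxy) (h x)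
    · rw [swap_apply_of_ne_of_ne hx hy]; exact h z

theorem conn_mul_swap_le (τ : Fin 3 → Perm α) (π : Perm α) (x y : α) :
    conn τ (π * swap x y) ≤ glue (conn τ π) x y := by
  refine sup_le ((bub_le_conn τ π).trans (le_glue _ _ _)) ?_
  rw [← mul_assoc]
  exact (cyc_mul_swap_le _ x y).trans (glue_mono x y (cyc_le_conn τ π 0))

theorem conn_le_mul_swap (τ : Fin 3 → Perm α) (π : Perm α) (x y : α) :
    conn τ π ≤ glue (conn τ (π * swap x y)) x y := by
  have := conn_mul_swap_le τ (π * swap x y) x y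
  rwa [mul_assoc, swap_mul_self, mul_one] at this

theorem conn_eq_glue (h : conn τ π x y) :
    conn τ π = glue (conn τ (π * swap x y)) x y :=
  le_antisymm (conn_le_mul_swap τ π x y)
    (glue_le ((conn_mul_swap_le τ π x y).trans (glue_eq_self h).le) h)

theorem classes_conn_eq (h : conn τ π x y) (h' : conn τ (π * swap x y) x y) :
    classes (conn τ (π * swap x y)) = classes (conn τ π) := by
  rw [conn_eq_glue h, glue_eq_self h']

theorem classes_conn_cut (h : conn τ π x y) (h' : ¬ conn τ (π * swap x y) x y) :
    classes (conn τ (π * swap x y)) = classes (conn τ π) + 1 := by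
  rw [conn_eq_glue h, classes_glue h']

theorem zc_mul_swap_eq (τ : Fin 3 → Perm α) (π : Perm α) (x y : α) :
    zc τ (π * swap x y) = ∑ d, classes (cyc ((τ d)⁻¹ * π * swap x y)) := by
  simp only [zc, mul_assoc]

/-- If reconnecting two edges disconnects a component, it splits a cycle of each color. -/
theorem zc_cut (hne : x ≠ y) (h' : ¬ conn τ (π * swap x y) x y) :
    zc τ (π * swap x y) = zc τ π + 3 := by
  have key : ∀ d, classes (cyc ((τ d)⁻¹ * π * swap x y)) = classes (cyc ((τ d)⁻¹ * π)) + 1 := by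
    intro d
    refine classes_cyc_split hne ?_
    by_contra hc
    refine h' (cyc_le_conn τ _ d ?_)
    rw [← mul_assoc]
    exact cyc_mul_swap_of_not hc
  rw [zc_mul_swap_eq, Finset.sum_congr rfl fun d _ => key d, Finset.sum_add_distrib]
  simp [zc]

theorem cyc_of_cut (d : Fin 3) (h' : ¬ conn τ (π * swap x y) x y) :
    cyc ((τ d)⁻¹ * π) x y := by
  by_contra hc
  refine h' (cyc_le_conn τ _ d ?_)
  rw [← mul_assoc]
  exact cyc_mul_swap_of_not hc

theorem conn_of_cut (h' : ¬ conn τ (π * swap x y) x y) : conn τ π x y :=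
  cyc_le_conn τ π 0 (cyc_of_cut 0 h')

theorem score_cut (hne : x ≠ y) (h' : ¬ conn τ (π * swap x y) x y) :
    score τ (π * swap x y) = score τ π := by
  have h1 := zc_cut hne h'
  have h2 := classes_conn_cut (conn_of_cut h') h'
  simp only [score, h1, h2]
  push_cast
  ring

theorem ne_of_cut (h' : ¬ conn τ (π * swap x y) x y) : x ≠ y := by
  rintro rfl; exact h' ((conn τ _).refl x)

/-- The first Betti number of the incidence graph of chains and bubbles is nonnegative. -/
theorem card_add_le (hρ : Preserves τ ρ) (π : Perm α) :
    classes (bub τ) + classes (cyc (ρ⁻¹ * π)) ≤ Nat.card α + classes (conn τ π) := by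
  generalize hn : Nat.card α - classes (cyc (ρ⁻¹ * π)) = n
  have hle : ∀ π : Perm α, classes (cyc (ρ⁻¹ * π)) ≤ Nat.card α := fun π =>
    Nat.card_le_card_of_surjective _ Quotient.mk_surjective
  induction n using Nat.strong_induction_on generalizing π with
  | _ n ih =>
    by_cases h1 : ρ⁻¹ * π = 1
    · have : π = ρ := by rw [← mul_left_cancel_iff (a := ρ⁻¹), h1, inv_mul_cancel]
      subst this
      rw [h1, classes_cyc_one, hρ.conn_self]
      omega
    · obtain ⟨x, hx⟩ : ∃ x, (ρ⁻¹ * π) x ≠ x := by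
        by_contra hc; push Not at hc
        exact h1 (Perm.ext hc)
      have hc : cyc (ρ⁻¹ * π) x ((ρ⁻¹ * π) x) := cyc_apply _ x
      have hsp := classes_cyc_split (Ne.symm hx) hc
      rw [mul_assoc] at hsp
      have h2 := hle (π * swap x ((ρ⁻¹ * π) x))
      have h3 := ih _ (by omega) (π * swap x ((ρ⁻¹ * π) x)) rfl
      have h4 := (classes_anti (conn_le_mul_swap τ π x ((ρ⁻¹ * π) x)))
      have h5 := classes_le_glue_add_one (conn τ (π * swap x ((ρ⁻¹ * π) x))) x ((ρ⁻¹ * π) x)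
      omega

/-- In a tree-like gluing, any two edges of one chain form a 2-edge-cut. -/
theorem TreeLike.cut (hρ : Preserves τ ρ) (h : TreeLike τ ρ π) {x y : α} (hxy : x ≠ y)
    (hc : cyc (ρ⁻¹ * π) x y) : ¬ conn τ (π * swap x y) x y := by
  intro hk
  have h1 := classes_conn_eq (hρ.chain_le hc) hk
  have h2 := classes_cyc_split hxy hc
  have h3 := card_add_le hρ (π * swap x y)
  rw [mul_assoc] at h2
  unfold TreeLike at h
  omega

/-- Reconnecting two edges of one chain keeps a gluing tree-like. -/
theorem TreeLike.mul_swap (hρ : Preserves τ ρ) (h : TreeLike τ ρ π) {x y : α} (hxy : x ≠ y)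
    (hc : cyc (ρ⁻¹ * π) x y) : TreeLike τ ρ (π * swap x y) := by
  have h1 := classes_conn_cut (hρ.chain_le hc) (h.cut hρ hxy hc)
  have h2 := classes_cyc_split hxy hc
  rw [mul_assoc] at h2
  unfold TreeLike at h ⊢
  omega

/-- In a tree-like gluing a chain visits a bubble along at most one pair. -/
theorem TreeLike.eq_of_bub (hρ : Preserves τ ρ) (h : TreeLike τ ρ π) {x y : α}
    (hb : bub τ x y) (hc : cyc (ρ⁻¹ * π) x y) : x = y := by
  by_contra hxy
  exact h.cut hρ hxy hc (bub_le_conn _ _ hb)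

/-- Undoing the separation along a 2-edge-cut keeps a gluing tree-like. -/
theorem TreeLike.of_cut (hρ : Preserves τ ρ) {x y : α}
    (h' : ¬ conn τ (π * swap x y) x y) (h : TreeLike τ ρ (π * swap x y)) : TreeLike τ ρ π := by
  have h1 := classes_conn_cut (conn_of_cut h') h'
  have h2 : ¬ cyc (ρ⁻¹ * (π * swap x y)) x y := fun k => h' (hρ.chain_le k)
  have h3 := classes_cyc_merge h2
  rw [mul_assoc, mul_assoc, swap_mul_self, mul_one] at h3
  unfold TreeLike at h ⊢
  omega

/-- The two edges of a 2-edge-cut lie on one chain, whatever the pairings. -/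
theorem cyc_chain_of_cut (hρ : Preserves τ ρ) {x y : α}
    (h' : ¬ conn τ (π * swap x y) x y) : cyc (ρ⁻¹ * π) x y := by
  by_contra hc
  refine h' (hρ.chain_le ?_)
  rw [← mul_assoc]
  exact cyc_mul_swap_of_not hc

/-- A tree-like gluing can be cut along its chains into the bubbles closed by their pairings, and
no cut changes the score. -/
theorem TreeLike.score_eq (hρ : Preserves τ ρ) (h : TreeLike τ ρ π) :
    score τ π = score τ ρ := by
  generalize hn : Nat.card α - classes (cyc (ρ⁻¹ * π)) = n
  have hle : ∀ π : Perm α, classes (cyc (ρ⁻¹ * π)) ≤ Nat.card α := fun π =>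
    Nat.card_le_card_of_surjective _ Quotient.mk_surjective
  induction n using Nat.strong_induction_on generalizing π with
  | _ n ih =>
    by_cases h1 : ρ⁻¹ * π = 1
    · have : π = ρ := by rw [← mul_left_cancel_iff (a := ρ⁻¹), h1, inv_mul_cancel]
      rw [this]
    · obtain ⟨x, hx⟩ : ∃ x, (ρ⁻¹ * π) x ≠ x := by
        by_contra hc; push Not at hc
        exact h1 (Perm.ext hc)
      have hc : cyc (ρ⁻¹ * π) x ((ρ⁻¹ * π) x) := cyc_apply _ x
      have hsp := classes_cyc_split (Ne.symm hx) hc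
      rw [mul_assoc] at hsp
      have h2 := hle (π * swap x ((ρ⁻¹ * π) x))
      rw [← score_cut (Ne.symm hx) (h.cut hρ (Ne.symm hx) hc)]
      exact ih _ (by omega) (h.mul_swap hρ (Ne.symm hx) hc) rfl

/-- On one side of a cut, the bicolored cycles are the traces of those before the cut. -/
theorem cyc_cut_of_conn {d : Fin 3} {x y z w : α} (h' : ¬ conn τ (π * swap x y) x y)
    (h : cyc ((τ d)⁻¹ * π) z w) (hzw : conn τ (π * swap x y) z w) :
    cyc ((τ d)⁻¹ * (π * swap x y)) z w := by
  have h1 := cyc_eq_glue_mul_swap (ne_of_cut h') (cyc_of_cut d h')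
  rw [h1, glue_def, mul_assoc] at h
  have hle := cyc_le_conn τ (π * swap x y) d
  rcases h with h | ⟨h, k⟩ | ⟨h, k⟩
  · exact h
  · exact absurd ((conn τ _).trans ((conn τ _).symm (hle h))
      ((conn τ _).trans hzw ((conn τ _).symm (hle k)))) h'
  · exact absurd ((conn τ _).trans (hle k) ((conn τ _).trans ((conn τ _).symm hzw) (hle h))) h'

/-- A bicolored cycle through both sides of a cut passes through its edges. -/
theorem cyc_cut_of_not_conn {d : Fin 3} {x y z w : α} (h' : ¬ conn τ (π * swap x y) x y)
    (h : cyc ((τ d)⁻¹ * π) z w) (hz : ¬ conn τ (π * swap x y) x z)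
    (hw : conn τ (π * swap x y) x w) :
    cyc ((τ d)⁻¹ * (π * swap x y)) z y ∧ cyc ((τ d)⁻¹ * (π * swap x y)) w x := by
  have h1 := cyc_eq_glue_mul_swap (ne_of_cut h') (cyc_of_cut d h')
  rw [h1, glue_def, mul_assoc] at h
  have hle := cyc_le_conn τ (π * swap x y) d
  rcases h with h | ⟨h, k⟩ | ⟨h, k⟩
  · exact absurd ((conn τ _).trans hw ((conn τ _).symm (hle h))) hz
  · exact absurd ((conn τ _).symm (hle h)) hz
  · exact ⟨h, (cyc _).symm k⟩

theorem cyc_cut_le {d : Fin 3} {x y : α} (h' : ¬ conn τ (π * swap x y) x y) :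
    cyc ((τ d)⁻¹ * (π * swap x y)) ≤ cyc ((τ d)⁻¹ * π) := by
  rw [cyc_eq_glue_mul_swap (ne_of_cut h') (cyc_of_cut d h'), ← mul_assoc]
  exact le_glue _ _ _

end PermGluing

/-! ### Maximizers and flips -/

namespace PermGluing

open Equiv Equiv.Perm

variable {α : Type u} [Finite α] [DecidableEq α] {τ σ : Fin 3 → Perm α} {π ρ : Perm α}

theorem sum_three {M : Type*} [AddCommMonoid M] {a b c : Fin 3} (hab : a ≠ b) (hca : c ≠ a)
    (hcb : c ≠ b) (f : Fin 3 → M) : ∑ d, f d = f a + f b + f c := by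
  have h : ∀ a b c : Fin 3, a ≠ b → c ≠ a → c ≠ b → (Finset.univ : Finset (Fin 3)) = {a, b, c} := by
    decide
  rw [h a b c hab hca hcb, Finset.sum_insert (by simp [hab, hca.symm]),
    Finset.sum_insert (by simp [hcb.symm]), Finset.sum_singleton, add_assoc]

theorem exists_third {a b : Fin 3} : ∃ c : Fin 3, c ≠ a ∧ c ≠ b := by
  revert a b; decide

theorem zc_eq {a b c : Fin 3} (hab : a ≠ b) (hca : c ≠ a) (hcb : c ≠ b) (π : Perm α) :
    zc τ π = classes (cyc ((τ a)⁻¹ * π)) + classes (cyc ((τ b)⁻¹ * π)) +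
      classes (cyc ((τ c)⁻¹ * π)) :=
  sum_three hab hca hcb _

/-- `π` maximizes the score among all, possibly disconnected, gluings. Admitting these makes the
property stable under the reconnection of 2-edge-cuts. -/
def IsMaximizer (τ : Fin 3 → Perm α) (π : Perm α) : Prop := ∀ π', score τ π' ≤ score τ π

theorem exists_isMaximizer (τ : Fin 3 → Perm α) : ∃ π, IsMaximizer τ π :=
  Finite.exists_max (score τ)

/-- In a maximizer, two edges of color `0` which share two bicolored cycles form a 2-edge-cut. -/
theorem IsMaximizer.cut (hπ : IsMaximizer τ π) {b c : Fin 3} (hbc : b ≠ c) {x y : α}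
    (hxy : x ≠ y) (hb : cyc ((τ b)⁻¹ * π) x y) (hc : cyc ((τ c)⁻¹ * π) x y) :
    ¬ conn τ (π * swap x y) x y := by
  intro hk
  obtain ⟨e, he, he'⟩ := exists_third (a := b) (b := c)
  have h1 := classes_conn_eq (cyc_le_conn τ π b hb) hk
  have h2 := zc_eq (τ := τ) hbc he he' π
  have h3 := zc_eq (τ := τ) hbc he he' (π * swap x y)
  have h4 := classes_cyc_split hxy hb
  have h5 := classes_cyc_split hxy hc
  have h6 := classes_cyc_le_mul_swap ((τ e)⁻¹ * π) x y
  have h7 := hπ (π * swap x y)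
  simp only [← mul_assoc] at h3
  simp only [score] at h7
  omega

theorem IsMaximizer.of_cut (hπ : IsMaximizer τ π) {x y : α}
    (h' : ¬ conn τ (π * swap x y) x y) : IsMaximizer τ (π * swap x y) := by
  intro π'
  rw [score_cut (ne_of_cut h') h']
  exact hπ π'

/-- In a tree-like maximizer, an edge of color `0` which is linked to a bubble through
bicolored cycles of two colors lies on a chain which visits this bubble. -/
theorem TreeLike.exists_visit (hρ : Preserves τ ρ) {b c : Fin 3} (hbc : b ≠ c) {v : α}
    (hπ : IsMaximizer τ π) (h : TreeLike τ ρ π) {x u y : α} (hu : bub τ v u)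
    (hxu : cyc ((τ c)⁻¹ * π) x u) (hxy : cyc ((τ b)⁻¹ * π) x y)
    (hy : bub τ v y ∨ (¬ cyc ((τ c)⁻¹ * π) x y ∧
      ∃ u', bub τ v u' ∧ cyc ((τ c)⁻¹ * π) y u')) :
    ∃ x', bub τ v x' ∧ cyc (ρ⁻¹ * π) x x' := by
  generalize hn : Nat.card α - classes (cyc (ρ⁻¹ * π)) = n
  have hle : ∀ π : Perm α, classes (cyc (ρ⁻¹ * π)) ≤ Nat.card α := fun π =>
    Nat.card_le_card_of_surjective _ Quotient.mk_surjective
  induction n using Nat.strong_induction_on generalizing π u y with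
  | _ n ih =>
  by_cases hfix : ∀ x', bub τ v x' → (ρ⁻¹ * π) x' = x'
  · refine ⟨x, ?_, (cyc _).refl x⟩
    have hker : conn τ π ≤ Setoid.ker (fun z => bub τ v z) := by
      rw [hρ.conn_eq]
      refine sup_le (fun z w hzw => ?_) (cyc_le_iff.2 fun z => ?_)
      · exact propext ⟨fun k => (bub τ).trans k hzw, fun k => (bub τ).trans k ((bub τ).symm hzw)⟩
      · refine propext ⟨fun k => ?_, fun k => ?_⟩
        · rwa [hfix z k]
        · have := (ρ⁻¹ * π).injective (hfix _ k)
          rwa [this] at k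
    have h1 : bub τ v x = bub τ v u := hker (cyc_le_conn τ π c hxu)
    rw [h1]; exact hu
  · push Not at hfix
    obtain ⟨x', hx', hne⟩ := hfix
    obtain ⟨g, hg⟩ : ∃ g, g = (ρ⁻¹ * π)⁻¹ x' := ⟨_, rfl⟩
    have hgx : (ρ⁻¹ * π) g = x' := by rw [hg, apply_inv_self']
    have hxg : x' ≠ g := by
      rintro rfl; exact hne hgx
    have hcg : cyc (ρ⁻¹ * π) x' g := by
      have := cyc_apply (ρ⁻¹ * π) g
      rw [hgx] at this
      exact (cyc _).symm this
    have hcut := h.cut hρ hxg hcg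
    have h1 := h.mul_swap hρ hxg hcg
    have hπ1 := hπ.of_cut hcut
    have hsp := classes_cyc_split hxg hcg
    have hle1 := hle (π * swap x' g)
    have hchain : cyc (ρ⁻¹ * (π * swap x' g)) ≤ cyc (ρ⁻¹ * π) := by
      rw [cyc_eq_glue_mul_swap hxg hcg, ← mul_assoc]
      exact le_glue _ _ _
    rw [mul_assoc] at hsp
    -- elements of the bubble stay connected to `x'`
    have hB : ∀ z, bub τ v z → conn τ (π * swap x' g) x' z := fun z hz =>
      bub_le_conn _ _ ((bub τ).trans ((bub τ).symm hx') hz)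
    by_cases hx : conn τ (π * swap x' g) x' x
    · have hxu1 := cyc_cut_of_conn hcut hxu ((conn τ _).trans ((conn τ _).symm hx) (hB u hu))
      by_cases hyx : conn τ (π * swap x' g) x' y
      · have hxy1 := cyc_cut_of_conn hcut hxy ((conn τ _).trans ((conn τ _).symm hx) hyx)
        obtain ⟨z, hz, hz'⟩ := ih _ (by omega) hπ1 h1 hu hxu1 hxy1 (by
          rcases hy with hy | ⟨hy, u', hu', hyu'⟩
          · exact Or.inl hy
          · exact Or.inr ⟨fun k => hy (cyc_cut_le hcut k), u', hu', cyc_cut_of_conn hcut hyu'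
              ((conn τ _).trans ((conn τ _).symm hyx) (hB u' hu'))⟩) rfl
        exact ⟨z, hz, hchain hz'⟩
      · have hxy1 := (cyc_cut_of_not_conn hcut ((cyc _).symm hxy) hyx hx).2
        obtain ⟨z, hz, hz'⟩ := ih _ (by omega) hπ1 h1 hu hxu1 hxy1 (Or.inl hx') rfl
        exact ⟨z, hz, hchain hz'⟩
    · have hxu1 := (cyc_cut_of_not_conn hcut hxu hx (hB u hu)).1
      refine ⟨x', hx', ?_⟩
      by_cases hyx : conn τ (π * swap x' g) x' y
      · have hxy1 := (cyc_cut_of_not_conn hcut hxy hx hyx).1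
        by_cases hxg' : x = g
        · subst hxg'; exact (cyc _).symm hcg
        · have hcut2 := hπ1.cut hbc hxg' hxy1 hxu1
          exact (cyc _).trans (hchain (cyc_chain_of_cut hρ hcut2)) ((cyc _).symm hcg)
      · rcases hy with hy | ⟨hy, u', hu', hyu'⟩
        · exact absurd (hB y hy) hyx
        · have hyu1 := (cyc_cut_of_not_conn hcut hyu' hyx (hB u' hu')).1
          exact absurd (cyc_cut_le hcut ((cyc _).trans hxu1 ((cyc _).symm hyu1))) hy

/-- Exchange of the ends of the edges of color `b` at `v` and `u`. If `τ b u = τ a v`, this makes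
the edges of colors `a` and `b` at `v` parallel. -/
def flip (τ : Fin 3 → Perm α) (b : Fin 3) (v u : α) : Fin 3 → Perm α :=
  Function.update τ b (τ b * swap v u)

theorem flip_self (b : Fin 3) (v u : α) : flip τ b v u b = τ b * swap v u :=
  Function.update_self _ _ _

theorem flip_of_ne {b d : Fin 3} (h : d ≠ b) (v u : α) : flip τ b v u d = τ d :=
  Function.update_of_ne h _ _

theorem flip_flip (b : Fin 3) (v u : α) : flip (flip τ b v u) b v u = τ := by
  funext d
  by_cases h : d = b
  · subst h
    rw [flip_self, flip_self, mul_assoc, swap_mul_self, mul_one]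
  · rw [flip_of_ne h, flip_of_ne h]

theorem flip_apply_of_ne {b : Fin 3} {v u x : α} (hv : x ≠ v) (hu : x ≠ u) (d : Fin 3) :
    flip τ b v u d x = τ d x := by
  by_cases h : d = b
  · subst h
    rw [flip_self, Perm.mul_apply, swap_apply_of_ne_of_ne hv hu]
  · rw [flip_of_ne h]

theorem flip_eq_self (b : Fin 3) (v : α) : flip τ b v v = τ := by
  funext d
  by_cases h : d = b
  · subst h; rw [flip_self, swap_self]; exact mul_one _
  · rw [flip_of_ne h]

theorem bub_flip_le (b : Fin 3) (v u : α) : bub (flip τ b v u) ≤ glue (bub τ) v u := by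
  have key : ∀ d x, ∃ y, glue (bub τ) v u x y ∧ flip τ b v u d x = τ d y := by
    intro d x
    by_cases h : d = b
    · subst h
      refine ⟨swap v u x, ?_, by rw [flip_self]; rfl⟩
      by_cases hv : x = v
      · subst hv; rw [swap_apply_left]; exact glue_pair _ _ _
      · by_cases hu : x = u
        · subst hu; rw [swap_apply_right]; exact Setoid.symm' _ (glue_pair _ v x)
        · rw [swap_apply_of_ne_of_ne hv hu]
    · exact ⟨x, (glue _ _ _).refl x, by rw [flip_of_ne h]⟩
  rw [bub_le_iff]
  intro c d x
  obtain ⟨y, hy, e⟩ := key d x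
  obtain ⟨z, hz, e'⟩ := key c ((flip τ b v u c)⁻¹ (flip τ b v u d x))
  rw [apply_inv_self', e] at e'
  exact (glue _ _ _).trans hy ((glue _ _ _).trans (le_glue _ _ _ (bub_of_eq e'))
    ((glue _ _ _).symm hz))

theorem bub_le_flip (b : Fin 3) (v u : α) : bub τ ≤ glue (bub (flip τ b v u)) v u := by
  have := bub_flip_le (τ := flip τ b v u) b v u
  rwa [flip_flip] at this

theorem conn_flip_le {a b : Fin 3} (hab : a ≠ b) (π : Perm α) (v u : α) :
    conn (flip τ b v u) π ≤ glue (conn τ π) v u := by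
  rw [conn_eq _ π a, flip_of_ne hab]
  exact sup_le ((bub_flip_le b v u).trans (glue_mono _ _ (bub_le_conn _ _)))
    ((cyc_le_conn τ π a).trans (le_glue _ _ _))

theorem conn_le_flip {a b : Fin 3} (hab : a ≠ b) (π : Perm α) (v u : α) :
    conn τ π ≤ glue (conn (flip τ b v u) π) v u := by
  have := conn_flip_le (τ := flip τ b v u) hab π v u
  rwa [flip_flip] at this

theorem cyc_inv_mul_comm (σ ρ : Perm α) : cyc (σ⁻¹ * ρ) = cyc (ρ⁻¹ * σ) := by
  rw [← cyc_inv, mul_inv_rev, inv_inv]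

section Flip

variable {a b : Fin 3} {v u : α} (hab : a ≠ b) (huv : τ b u = τ a v)
include huv

theorem bub_flip_le_of_eq : bub (flip τ b v u) ≤ bub τ := by
  have := bub_flip_le (τ := τ) b v u
  rwa [glue_eq_self (bub_of_eq huv.symm)] at this

include hab

/-- If color `0` is parallel to color `a` at `v`, making color `b` parallel to it as well closes a
short bicolored cycle. -/
theorem zc_flip {ρ : Perm α} (hρ : ρ v = τ a v) :
    zc (flip τ b v u) ρ = zc τ ρ + if u = v then 0 else 1 := by
  split_ifs with h
  · subst h; rw [flip_eq_self]; rfl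
  obtain ⟨c, hca, hcb⟩ := exists_third (a := a) (b := b)
  rw [zc_eq hab hca hcb, zc_eq hab hca hcb, flip_of_ne hab, flip_of_ne hcb, flip_self,
    cyc_inv_mul_comm (τ b * swap v u), cyc_inv_mul_comm (τ b), ← mul_assoc,
    classes_cyc_split (Ne.symm h)]
  · omega
  · have := cyc_apply (ρ⁻¹ * τ b) u
    rw [Perm.mul_apply, huv, ← hρ, inv_apply_self'] at this
    exact (cyc _).symm this

/-- A flip separates at most as many components as bubbles. -/
theorem classes_conn_flip_add_le (π : Perm α) :
    classes (conn (flip τ b v u) π) + classes (bub τ) ≤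
      classes (bub (flip τ b v u)) + classes (conn τ π) := by
  have h1 := classes_anti (bub_flip_le_of_eq huv)
  by_cases h : conn (flip τ b v u) π v u
  · have := conn_le_flip (τ := τ) hab π v u
    rw [glue_eq_self h] at this
    have := classes_anti this
    omega
  · have h3 : ¬ bub (flip τ b v u) v u := fun k => h (bub_le_conn _ _ k)
    have h4 := classes_anti (bub_le_flip (τ := τ) b v u)
    have h5 := classes_glue h
    have h6 := classes_glue h3
    have h9 := classes_anti (conn_le_flip (τ := τ) hab π v u)
    have h7 : glue (bub (flip τ b v u)) v u ≤ bub τ :=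
      glue_le (bub_flip_le_of_eq huv) (bub_of_eq huv.symm)
    have h8 := classes_anti h7
    omega

end Flip

/-- The number of bicolored cycles with two of the colors `1, 2, 3`; in the canonical embedding of
the bubbles these are the faces. -/
noncomputable def faces (τ : Fin 3 → Perm α) : ℕ :=
  ∑ a, classes (cyc ((τ a)⁻¹ * τ (a + 1)))

theorem classes_cyc_comm (τ : Fin 3 → Perm α) (a b : Fin 3) :
    classes (cyc ((τ a)⁻¹ * τ b)) = classes (cyc ((τ b)⁻¹ * τ a)) := by
  rw [cyc_inv_mul_comm]

theorem faces_eq {a b c : Fin 3} (hab : a ≠ b) (hca : c ≠ a) (hcb : c ≠ b) :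
    faces τ = classes (cyc ((τ a)⁻¹ * τ b)) + classes (cyc ((τ c)⁻¹ * τ b)) +
      classes (cyc ((τ a)⁻¹ * τ c)) := by
  have h : ∀ a b c : Fin 3, a ≠ b → c ≠ a → c ≠ b →
      (b = a + 1 ∧ c = b + 1 ∧ a = c + 1) ∨ (a = b + 1 ∧ b = c + 1 ∧ c = a + 1) := by decide
  rw [faces, sum_three hab hca hcb]
  rcases h a b c hab hca hcb with ⟨h1, h2, h3⟩ | ⟨h1, h2, h3⟩
  · rw [← h1, ← h2, ← h3, classes_cyc_comm τ c b, classes_cyc_comm τ c a]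
  · rw [← h1, ← h2, ← h3, classes_cyc_comm τ b a]
    ring

/-- A flip which creates a pair of parallel edges does not increase the genus. -/
theorem faces_flip {a b : Fin 3} {v u : α} (hab : a ≠ b) (huv : τ b u = τ a v) :
    faces τ + 2 * classes (bub (flip τ b v u)) ≤ faces (flip τ b v u) + 2 * classes (bub τ) := by
  by_cases h : u = v
  · subst h; rw [flip_eq_self]
  obtain ⟨c, hca, hcb⟩ := exists_third (a := a) (b := b)
  have h0 : cyc ((τ a)⁻¹ * τ b) v u := by
    have := cyc_apply ((τ a)⁻¹ * τ b) u
    rw [Perm.mul_apply, huv, inv_apply_self'] at this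
    exact (cyc _).symm this
  have h1 := classes_cyc_split (Ne.symm h) h0
  rw [faces_eq hab hca hcb, faces_eq hab hca hcb, flip_self, flip_of_ne hab, flip_of_ne hcb,
    ← mul_assoc, ← mul_assoc, h1]
  by_cases hk : bub (flip τ b v u) v u
  · have h2 := bub_le_flip (τ := τ) b v u
    rw [glue_eq_self hk] at h2
    have h2 := classes_anti h2
    have h3 := classes_cyc_le_mul_swap ((τ c)⁻¹ * τ b) v u
    omega
  · have h2 : cyc ((τ c)⁻¹ * τ b) v u := by
      by_contra hc
      refine hk (cyc_le_bub _ c b ?_)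
      rw [flip_self, flip_of_ne hcb, ← mul_assoc]
      exact cyc_mul_swap_of_not hc
    have h3 := classes_cyc_split (Ne.symm h) h2
    have h4 := classes_anti (bub_le_flip (τ := τ) b v u)
    have h5 := classes_glue hk
    have h7 : glue (bub (flip τ b v u)) v u ≤ bub τ :=
      glue_le (bub_flip_le_of_eq huv) (bub_of_eq huv.symm)
    have h8 := classes_anti h7
    omega

end PermGluing

/-! ### Contractions and short faces of planar bubbles -/

namespace PermGluing

open Equiv Equiv.Perm

variable {α : Type u} [Finite α] [DecidableEq α] {τ σ : Fin 3 → Perm α} {π ρ : Perm α}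
  {A : Set α}

/-- The vertex `x` and its black neighbor form a bubble with two vertices. -/
def IsTrivial (τ : Fin 3 → Perm α) (x : α) : Prop := ∀ a b, τ a x = τ b x

theorem IsTrivial.eq_of_bub {x y : α} (hx : IsTrivial τ x) (h : bub τ x y) : x = y := by
  have hle : bub τ ≤ Setoid.ker (fun z => z = x) := by
    rw [bub_le_iff]
    intro a b z
    have e : τ a ((τ a)⁻¹ (τ b z)) = τ b z := apply_inv_self' _ _
    refine propext ⟨fun hz => ?_, fun hz => ?_⟩
    · subst hz
      exact (τ a).injective (e.trans (hx b a))
    · rw [hz] at e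
      exact (τ b).injective (e.symm.trans (hx a b))
  have h1 : (x = x) = (y = x) := hle h
  exact (h1 ▸ rfl : y = x).symm

theorem IsTrivial.flip_apply {a b : Fin 3} {v u x : α} (hx : IsTrivial τ x)
    (huv : τ b u = τ a v) (d : Fin 3) : flip τ b v u d x = τ d x := by
  by_cases hne : u = v
  · subst hne; rw [flip_eq_self]
  refine flip_apply_of_ne ?_ ?_ d
  · rintro rfl
    exact hne ((τ b).injective (huv.trans (hx a b)))
  · rintro rfl
    exact hne ((τ a).injective ((hx a b).trans huv))

/-- All bubbles of `τ` outside the set `A` of white vertices are planar, and `A` lies in one bubble.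
Planarity is expressed by a model `σ`, in which `A` is replaced by trivial bubbles, and by Euler's
inequality for the number of its faces. The condition `connected` is stated in a form which
survives changes of `τ` outside `A`. -/
structure PlanarOff (A : Set α) (τ σ : Fin 3 → Perm α) : Prop where
  eq_off : ∀ x, x ∉ A → ∀ d, τ d x = σ d x
  trivial : ∀ x, x ∈ A → IsTrivial σ x
  connected : ∀ τ' : Fin 3 → Perm α, (∀ x, x ∈ A → ∀ d, τ' d x = τ d x) →
    ∀ x, x ∈ A → ∀ y, y ∈ A → bub τ' x y
  euler : Nat.card α + 2 * classes (bub σ) ≤ faces σ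

theorem PlanarOff.not_mem (h : PlanarOff A τ σ) {v : α} (hv : ¬ IsTrivial σ v) : v ∉ A :=
  fun k => hv (h.trivial v k)

theorem PlanarOff.not_mem_of_eq (h : PlanarOff A τ σ) {a b : Fin 3} {v u : α} (hv : v ∉ A)
    (huv : σ b u = σ a v) : u ∉ A := by
  intro k
  have := (σ a).injective ((h.trivial u k a b).trans huv)
  exact hv (this ▸ k)

theorem PlanarOff.of_flip (h : PlanarOff A τ σ) {a b : Fin 3} (hab : a ≠ b) {v u : α} (hv : v ∉ A)
    (huv : σ b u = σ a v) : PlanarOff A (flip τ b v u) (flip σ b v u) := by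
  have hu : u ∉ A := h.not_mem_of_eq hv huv
  refine ⟨fun x hx d => ?_, fun x hx c d => ?_, fun τ' hτ' x hx y hy => ?_, ?_⟩
  · by_cases hd : d = b
    · subst hd
      rw [flip_self, flip_self, Perm.mul_apply, Perm.mul_apply]
      refine h.eq_off _ ?_ d
      by_cases h1 : x = v
      · subst h1; rwa [swap_apply_left]
      · by_cases h2 : x = u
        · subst h2; rwa [swap_apply_right]
        · rwa [swap_apply_of_ne_of_ne h1 h2]
    · rw [flip_of_ne hd, flip_of_ne hd]
      exact h.eq_off x hx d
  · rw [(h.trivial x hx).flip_apply huv, (h.trivial x hx).flip_apply huv]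
    exact h.trivial x hx c d
  · refine h.connected τ' (fun z hz d => ?_) x hx y hy
    rw [hτ' z hz d, flip_apply_of_ne]
    · rintro rfl; exact hv hz
    · rintro rfl; exact hu hz
  · have := faces_flip hab huv
    have := h.euler
    omega

/-- Any color can be used to identify the black vertices with the white ones. -/
theorem Preserves.of_color (d : Fin 3) (h : ∀ x, bub τ x ((τ d)⁻¹ (ρ x))) : Preserves τ ρ := by
  intro x
  have h1 := bub_step τ 0 d ((τ d)⁻¹ (ρ x))
  rw [apply_inv_self'] at h1
  exact (bub τ).trans (h x) h1

/-- The edge of color `a` at `v` is made parallel to edges of the two other colors, which splits off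
a trivial bubble at `v`. For gluings in which color `0` is parallel to these edges, the number of
bicolored cycles changes by a constant. -/
theorem PlanarOff.contract (h : PlanarOff A τ σ) {v : α} (hv : ¬ IsTrivial σ v) (a : Fin 3) :
    ∃ (τ' σ' : Fin 3 → Perm α) (δ : ℕ), PlanarOff A τ' σ' ∧
      Nat.card {x // ¬ IsTrivial σ' x} < Nat.card {x // ¬ IsTrivial σ x} ∧
      (∀ ρ, Preserves τ' ρ → Preserves τ ρ ∧ ρ v = τ a v) ∧
      (∀ ρ : Perm α, ρ v = τ a v → zc τ' ρ = zc τ ρ + δ) ∧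
      ∀ π, classes (conn τ' π) + classes (bub τ) ≤ classes (bub τ') + classes (conn τ π) := by
  obtain ⟨b, hba, -⟩ := exists_third (a := a) (b := a)
  obtain ⟨c, hca, hcb⟩ := exists_third (a := a) (b := b)
  have hvA := h.not_mem hv
  obtain ⟨u, hu⟩ : ∃ u, σ b u = σ a v := ⟨(σ b)⁻¹ (σ a v), apply_inv_self' _ _⟩
  have hut : τ b u = τ a v := by
    rw [h.eq_off u (h.not_mem_of_eq hvA hu), hu, h.eq_off v hvA]
  have h1 := h.of_flip hba.symm hvA hu
  obtain ⟨w, hw⟩ : ∃ w, flip σ b v u c w = flip σ b v u a v :=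
    ⟨(flip σ b v u c)⁻¹ (flip σ b v u a v), apply_inv_self' _ _⟩
  have hwt : flip τ b v u c w = flip τ b v u a v := by
    rw [h1.eq_off w (h1.not_mem_of_eq hvA hw), hw, h1.eq_off v hvA]
  have h2 := h1.of_flip hca.symm hvA hw
  have hval : ∀ κ : Fin 3 → Perm α, κ b u = κ a v → flip κ b v u c w = flip κ b v u a v →
      ∀ d, flip (flip κ b v u) c v w d v = κ a v := by
    intro κ e1 e2 d
    have hd : d = a ∨ d = b ∨ d = c := by
      clear * - hba hca hcb
      revert a b c d; decide
    rcases hd with rfl | rfl | rfl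
    · rw [flip_of_ne hca.symm, flip_of_ne hba.symm]
    · rw [flip_of_ne hcb.symm, flip_self, Perm.mul_apply, swap_apply_left, e1]
    · rw [flip_self, Perm.mul_apply, swap_apply_left, e2, flip_of_ne hba.symm]
  refine ⟨flip (flip τ b v u) c v w,
    flip (flip σ b v u) c v w,
    (if u = v then 0 else 1) + if w = v then 0 else 1, h2, ?_, ?_, ?_, ?_⟩
  · have htriv : ∀ x, IsTrivial σ x → IsTrivial (flip (flip σ b v u) c v w) x := by
      intro x hx
      have h3 : IsTrivial (flip σ b v u) x := by
        intro d e; rw [hx.flip_apply hu, hx.flip_apply hu]; exact hx d e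
      intro d e
      rw [h3.flip_apply hw, h3.flip_apply hw]; exact h3 d e
    have hvt : IsTrivial (flip (flip σ b v u) c v w) v := by
      intro d e
      rw [hval σ hu hw, hval σ hu hw]
    change Set.ncard {x | ¬ IsTrivial _ x} < Set.ncard {x | ¬ IsTrivial _ x}
    refine Set.ncard_lt_ncard ⟨fun x hx k => hx (htriv x k), fun hle => ?_⟩ (Set.toFinite _)
    exact hle (show v ∈ {x | ¬ IsTrivial σ x} from hv) hvt
  · intro ρ hρ
    have hb := (bub_flip_le_of_eq hwt).trans (bub_flip_le_of_eq hut)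
    have hA : ∀ x, bub _ x _ := hρ.bub_apply a
    constructor
    · refine Preserves.of_color a fun x => hb ?_
      have := hA x
      rwa [flip_of_ne hca.symm, flip_of_ne hba.symm] at this
    · have hvt : IsTrivial (flip (flip τ b v u) c v w) v := by
        intro d e
        rw [hval τ hut hwt, hval τ hut hwt]
      have := hvt.eq_of_bub (hA v)
      rw [flip_of_ne hca.symm, flip_of_ne hba.symm] at this
      conv_rhs => rw [this]
      rw [apply_inv_self']
  · intro ρ hρ
    rw [zc_flip hca.symm hwt, zc_flip hba.symm hut hρ, add_assoc]
    rw [hρ, flip_of_ne hba.symm]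
  · intro π
    have := classes_conn_flip_add_le hba.symm hut π
    have := classes_conn_flip_add_le hca.symm hwt π
    omega

/-- Planar bubbles which are not all trivial have a face with two or four edges at a nontrivial
vertex: otherwise every face at such a vertex has at least three white vertices, and there would be
too few faces for Euler's inequality. -/
theorem exists_short_face (heuler : Nat.card α + 2 * classes (bub σ) ≤ faces σ) {v : α}
    (hv : ¬ IsTrivial σ v) : ∃ (a b : Fin 3) (x : α), a ≠ b ∧ ¬ IsTrivial σ x ∧
      ((σ a)⁻¹ * σ b) (((σ a)⁻¹ * σ b) x) = x := by
  classical
  by_contra hno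
  push Not at hno
  have hcount : ∀ a, classes (cyc ((σ a)⁻¹ * σ (a + 1))) * 3 ≤
      Nat.card α + Nat.card {x // IsTrivial σ x} * 2 := by
    intro a
    have hlong : ∀ x, ¬ IsTrivial σ x → ((σ a)⁻¹ * σ (a + 1))
        (((σ a)⁻¹ * σ (a + 1)) x) ≠ x := fun x hx => hno a (a + 1) x (by
      revert a; decide) hx
    generalize hθ : (σ a)⁻¹ * σ (a + 1) = θ at hlong
    have h1 : classes (cyc θ) * 3 = Nat.card (Quotient (cyc θ) × Fin 3) := by
      rw [Nat.card_prod, Nat.card_fin]; rfl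
    have h2 : Nat.card α + Nat.card {x // IsTrivial σ x} * 2 =
        Nat.card (α ⊕ ({x // IsTrivial σ x} × Fin 2)) := by
      rw [Nat.card_sum, Nat.card_prod, Nat.card_fin]
    rw [h1, h2]
    let f : Quotient (cyc θ) × Fin 3 → α ⊕ ({x // IsTrivial σ x} × Fin 2) := fun q =>
      if h : IsTrivial σ q.1.out then
        match q.2 with
        | 0 => Sum.inl q.1.out
        | 1 => Sum.inr (⟨q.1.out, h⟩, 0)
        | 2 => Sum.inr (⟨q.1.out, h⟩, 1)
      else Sum.inl ((θ ^ (q.2 : ℕ)) q.1.out)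
    refine Nat.card_le_card_of_injective f ?_
    let g : α ⊕ ({x // IsTrivial σ x} × Fin 2) → Quotient (cyc θ) :=
      Sum.elim (Quotient.mk (cyc θ)) fun p => Quotient.mk (cyc θ) p.1.1
    have hg : ∀ q, g (f q) = q.1 := by
      rintro ⟨q, i⟩
      by_cases h : IsTrivial σ q.out
      · fin_cases i <;> simp [f, h, g]
      · simp only [f, h, g, dif_neg, not_false_eq_true, Sum.elim_inl]
        conv_rhs => rw [← Quotient.out_eq q]
        exact Quotient.sound (sameCycle_pow_left.2 (SameCycle.refl _ _))
    rintro ⟨q, i⟩ ⟨q', j⟩ hqq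
    have e : q = q' := (hg (q, i)).symm.trans ((congrArg g hqq).trans (hg (q', j)))
    subst e
    refine Prod.ext rfl ?_
    by_cases h : IsTrivial σ q.out
    · simp only [f, h, dif_pos] at hqq
      clear hno hlong hg heuler
      fin_cases i <;> fin_cases j <;> first | rfl | exact absurd hqq (by simp)
    · have h1 := hlong _ h
      have h2 : θ q.out ≠ q.out := fun e => h1 (by rw [e, e])
      have h3 : θ (θ q.out) ≠ θ q.out := fun e => h2 (θ.injective e)
      simp only [f, h, dif_neg, not_false_eq_true, Sum.inl.injEq] at hqq
      have h4 : ∀ i j : Fin 3, (θ ^ (i : ℕ)) q.out = (θ ^ (j : ℕ)) q.out → i = j := by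
        intro i j e
        have e0 : (θ ^ 0) q.out = q.out := rfl
        have e1 : (θ ^ 1) q.out = θ q.out := by rw [pow_one]
        have e2 : (θ ^ 2) q.out = θ (θ q.out) := by rw [pow_two]; rfl
        fin_cases i <;> fin_cases j <;> simp only [Fin.zero_eta, Fin.mk_one, Fin.reduceFinMk,
          Fin.val_zero, Fin.val_one, Fin.val_two, e0, e1, e2] at e <;>
          first
          | rfl
          | exact absurd e h1
          | exact absurd e.symm h1
          | exact absurd e h2
          | exact absurd e.symm h2
          | exact absurd e h3
          | exact absurd e.symm h3
      exact h4 i j hqq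
  have hsum : faces σ ≤ Nat.card α + Nat.card {x // IsTrivial σ x} * 2 := by
    have h0 := hcount 0
    have h1 := hcount 1
    have h2 := hcount 2
    rw [faces, Fin.sum_univ_three]
    omega
  have hp : Nat.card (Option {x // IsTrivial σ x}) ≤ classes (bub σ) := by
    refine Nat.card_le_card_of_injective
      (fun o => o.elim (Quotient.mk (bub σ) v) fun x => Quotient.mk (bub σ) x.1) ?_
    intro o o' e
    cases o with
    | none =>
      cases o' with
      | none => rfl
      | some y =>
        have := y.2.eq_of_bub ((bub σ).symm (Quotient.exact e))
        exact absurd (this ▸ y.2) hv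
    | some x =>
      cases o' with
      | none =>
        have := x.2.eq_of_bub (Quotient.exact e)
        exact absurd (this ▸ x.2) hv
      | some y =>
        have := x.2.eq_of_bub (Quotient.exact e)
        exact congrArg some (Subtype.ext this)
  rw [Finite.card_option] at hp
  omega

end PermGluing

/-! ### Maximizers are tree-like -/

namespace PermGluing

open Equiv Equiv.Perm

variable {α : Type u} [Finite α] [DecidableEq α] {τ σ : Fin 3 → Perm α} {π ρ : Perm α}
  {A : Set α}

theorem Preserves.score_eq (h : Preserves τ ρ) :
    score τ ρ = zc τ ρ - 3 * classes (bub τ) := by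
  rw [score, h.conn_self]

/-- A maximizer in which color `0` is parallel to color `a` at `v` is tree-like, if this is known of
the maximizers after the contraction at `v`. -/
theorem exists_treeLike_of_contract {v : α} {a : Fin 3} {τ' : Fin 3 → Perm α} {δ : ℕ}
    (hQ : ∀ π, IsMaximizer τ' π → ∃ ρ, Preserves τ' ρ ∧ TreeLike τ' ρ π)
    (hpres : ∀ ρ, Preserves τ' ρ → Preserves τ ρ ∧ ρ v = τ a v)
    (hzc : ∀ ρ : Perm α, ρ v = τ a v → zc τ' ρ = zc τ ρ + δ)
    (hcl : ∀ π, classes (conn τ' π) + classes (bub τ) ≤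
      classes (bub τ') + classes (conn τ π))
    (hπ : IsMaximizer τ π) (hv : π v = τ a v) : ∃ ρ, Preserves τ ρ ∧ TreeLike τ ρ π := by
  obtain ⟨π₀, hπ₀⟩ := exists_isMaximizer τ'
  obtain ⟨ρ₀, hρ₀, ht₀⟩ := hQ π₀ hπ₀
  obtain ⟨hρ₀', hρ₀v⟩ := hpres ρ₀ hρ₀
  have h1 := ht₀.score_eq hρ₀
  rw [hρ₀.score_eq, hzc ρ₀ hρ₀v] at h1
  have h2 := hπ ρ₀
  rw [hρ₀'.score_eq] at h2
  have h3 : score τ' π = zc τ π + δ - 3 * classes (conn τ' π) := by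
    rw [score, hzc π hv]; push_cast; ring
  have h4 := hcl π
  have h5 := hπ₀ π
  have h6 : score τ π = zc τ π - 3 * classes (conn τ π) := rfl
  have hmax : IsMaximizer τ' π := by
    intro π'
    have := hπ₀ π'
    push_cast at h1
    omega
  obtain ⟨ρ, hρ, ht⟩ := hQ π hmax
  refine ⟨ρ, (hpres ρ hρ).1, ?_⟩
  unfold TreeLike at ht ⊢
  push_cast at h1
  omega

/-- The theorem for trivial bubbles and one arbitrary bubble: in a maximizer, the edges of color `0`
at the ends of a trivial bubble form a 2-edge-cut. -/
theorem exists_treeLike_of_trivial (hA : ∀ x, x ∉ A → IsTrivial τ x)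
    (hc : ∀ x, x ∈ A → ∀ y, y ∈ A → bub τ x y) (hπ : IsMaximizer τ π) :
    ∃ ρ, Preserves τ ρ ∧ TreeLike τ ρ π := by
  generalize hn : Set.ncard {x | x ∉ A ∧ π x ≠ τ 0 x} = n
  induction n using Nat.strong_induction_on generalizing π with
  | _ n ih =>
  by_cases hall : ∀ v, v ∉ A → π v = τ 0 v
  · have hp : Preserves τ π := fun x => by
      by_cases hx : x ∈ A
      · refine hc x hx _ ?_
        by_contra hy
        have h1 := hall _ hy
        rw [apply_inv_self'] at h1
        have h2 := π.injective h1
        exact hy (h2.symm ▸ hx)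
      · rw [hall x hx, inv_apply_self']
    refine ⟨π, hp, ?_⟩
    rw [TreeLike, inv_mul_cancel, classes_cyc_one, hp.conn_self, add_comm]
  · push Not at hall
    obtain ⟨v, hvA, hv⟩ := hall
    obtain ⟨x, hx⟩ : ∃ x, π x = τ 0 v := ⟨π⁻¹ (τ 0 v), apply_inv_self' _ _⟩
    have hvx : v ≠ x := by
      rintro rfl; exact hv hx
    have hcyc : ∀ d, cyc ((τ d)⁻¹ * π) v x := by
      intro d
      have := cyc_apply ((τ d)⁻¹ * π) x
      rw [Perm.mul_apply, hx, hA v hvA 0 d, inv_apply_self'] at this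
      exact (cyc _).symm this
    have hcut := hπ.cut (show (0 : Fin 3) ≠ 1 by decide) hvx (hcyc 0) (hcyc 1)
    have hlt : Set.ncard {z | z ∉ A ∧ (π * swap v x) z ≠ τ 0 z} < n := by
      rw [← hn]
      refine Set.ncard_lt_ncard ⟨?_, fun hle => ?_⟩ (Set.toFinite _)
      · rintro z ⟨hz, hz'⟩
        refine ⟨hz, ?_⟩
        rw [Perm.mul_apply] at hz'
        by_cases h1 : z = v
        · subst h1; exact hv
        · by_cases h2 : z = x
          · subst h2
            rw [hx]
            exact fun e => hvx ((τ 0).injective e)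
          · rwa [swap_apply_of_ne_of_ne h1 h2] at hz'
      · have := (hle ⟨hvA, hv⟩ : v ∈ {z | z ∉ A ∧ (π * swap v x) z ≠ τ 0 z}).2
        rw [Perm.mul_apply, swap_apply_left, hx] at this
        exact this rfl
    obtain ⟨ρ, hρ, ht⟩ := ih _ hlt (hπ.of_cut hcut) rfl
    exact ⟨ρ, hρ, ht.of_cut hρ hcut⟩

/-- Two successive reconnections around a face `v₁, v₂` with four edges do not disconnect `v₂` from
`x₂`: otherwise, following the bicolored cycle of `x₂` backwards, one would never leave the
component of `x₂`, since `v₁` and `v₂` are not on this cycle; but the step after `x₂` leads to the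
component of `v₂`. -/
theorem conn_of_square {v₁ v₂ x₁ x₂ : α} {c : Fin 3} (hv₁x₂ : v₁ ≠ x₂) (hv₂x₁ : v₂ ≠ x₁)
    (hv₁x₁ : v₁ ≠ x₁) (hv₂x₂ : v₂ ≠ x₂) (hv : v₁ ≠ v₂) (hx : x₁ ≠ x₂)
    (h₁ : ¬ cyc ((τ c)⁻¹ * π) v₁ x₂) (h₂ : ¬ cyc ((τ c)⁻¹ * π) v₂ x₂) (hb : bub τ v₁ v₂) :
    conn τ (π * swap v₁ x₁ * swap v₂ x₂) v₂ x₂ := by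
  obtain ⟨r, hr⟩ : ∃ r, r = conn τ (π * swap v₁ x₁ * swap v₂ x₂) := ⟨_, rfl⟩
  rw [← hr]
  by_contra hn
  have hbr : r v₁ v₂ := by rw [hr]; exact bub_le_conn _ _ hb
  have hn₁ : ¬ r v₁ x₂ := fun k => hn (r.trans (r.symm hbr) k)
  obtain ⟨θ, hθ⟩ : ∃ θ, θ = (τ c)⁻¹ * π := ⟨_, rfl⟩
  rw [← hθ] at h₁ h₂
  have hstep : ∀ z, r z (θ (swap v₁ x₁ (swap v₂ x₂ z))) := by
    intro z
    have := conn_step τ (π * swap v₁ x₁ * swap v₂ x₂) c z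
    rw [← hr] at this
    rw [hθ]
    exact this
  have hs1 : r v₂ (θ x₂) := by
    have := hstep v₂
    rwa [swap_apply_left, swap_apply_of_ne_of_ne hv₁x₂.symm hx.symm] at this
  have hs2 : r v₁ (θ x₁) := by
    have := hstep v₁
    rwa [swap_apply_of_ne_of_ne hv hv₁x₂, swap_apply_left] at this
  -- the component of `x₂` is closed under going backwards along its bicolored cycle
  have key : ∀ n : ℕ, r x₂ ((θ⁻¹ ^ n) x₂) ∧ cyc θ ((θ⁻¹ ^ n) x₂) x₂ := by
    intro n
    induction n with
    | zero => exact ⟨r.refl _, (cyc θ).refl _⟩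
    | succ n ih =>
      obtain ⟨ih1, ih2⟩ := ih
      obtain ⟨z, hz⟩ : ∃ z, z = (θ⁻¹ ^ (n + 1)) x₂ := ⟨_, rfl⟩
      have hzy : θ z = (θ⁻¹ ^ n) x₂ := by
        rw [hz, pow_succ', Perm.mul_apply, apply_inv_self']
      rw [← hz]
      rw [← hzy] at ih1 ih2
      have hzc : cyc θ z x₂ := (cyc θ).trans (cyc_apply θ z) ih2
      refine ⟨?_, hzc⟩
      by_cases e2 : z = x₂
      · subst e2; exact r.refl _
      by_cases e1 : z = x₁
      · subst e1
        exact absurd (r.trans hs2 (r.symm ih1)) hn₁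
      have e3 : z ≠ v₁ := by rintro rfl; exact h₁ hzc
      have e4 : z ≠ v₂ := by rintro rfl; exact h₂ hzc
      have := hstep z
      rw [swap_apply_of_ne_of_ne e4 e2, swap_apply_of_ne_of_ne e3 e1] at this
      exact r.trans ih1 (r.symm this)
  have hlast := (key (orderOf θ - 1)).1
  have he : (θ⁻¹ ^ (orderOf θ - 1)) = θ := by
    rw [inv_pow, inv_eq_iff_mul_eq_one, ← pow_succ, Nat.sub_add_cancel (orderOf_pos θ),
      pow_orderOf_eq_one]
  rw [he] at hlast
  exact hn (r.trans hs1 (r.symm hlast))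

/-- A face with four edges, of colors `a` and `b`, at the white vertices `v₁` and `v₂`. The edges of
color `0` at its black vertices start at `x₁` and `x₂`. Reconnecting them such that color `0`
becomes parallel to color `a` at `v₁` and `v₂` loses nothing: color `a` gains two cycles, color `b`
keeps its number of cycles, and color `c` loses two, since a smaller loss would contradict
maximality. The reconnected gluing `π₂` is then tree-like by assumption, with pairings `ρ` say, and
`TreeLike.exists_visit` shows that the chains through `x₁` and `x₂` visit the bubble of the face.
Repairing at these visits yields the pairings for `π`. -/
theorem exists_treeLike_of_square (hπ : IsMaximizer τ π) {a b c : Fin 3} (hab : a ≠ b)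
    (hca : c ≠ a) (hcb : c ≠ b) {v₁ v₂ x₁ x₂ : α} (hv : v₁ ≠ v₂)
    (h₁₂ : τ a v₁ = τ b v₂) (h₂₁ : τ a v₂ = τ b v₁) (hx₁ : π x₁ = τ a v₁) (hx₂ : π x₂ = τ a v₂)
    (hb₁₁ : ¬ cyc ((τ b)⁻¹ * π) v₁ x₁) (hc₁₁ : ¬ cyc ((τ c)⁻¹ * π) v₁ x₁)
    (hc₂₂ : ¬ cyc ((τ c)⁻¹ * π) v₂ x₂)
    (hc₁₂ : ¬ cyc ((τ c)⁻¹ * π) v₁ x₂)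
    (ha₂₁ : ¬ cyc ((τ a)⁻¹ * π) v₂ x₁)
    (hrec : ∀ π', IsMaximizer τ π' → π' v₁ = τ a v₁ → ∃ ρ, Preserves τ ρ ∧ TreeLike τ ρ π') :
    ∃ ρ, Preserves τ ρ ∧ TreeLike τ ρ π := by
  have hv₁x₁ : v₁ ≠ x₁ := fun e => hc₁₁ (e ▸ (cyc _).refl _)
  have hv₂x₂ : v₂ ≠ x₂ := fun e => hc₂₂ (e ▸ (cyc _).refl _)
  have hv₁x₂ : v₁ ≠ x₂ := fun e => hc₁₂ (e ▸ (cyc _).refl _)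
  have hv₂x₁ : v₂ ≠ x₁ := fun e => ha₂₁ (e ▸ (cyc _).refl _)
  have hx : x₁ ≠ x₂ := by
    rintro rfl
    exact hv ((τ a).injective (hx₁.symm.trans hx₂))
  have hbv : bub τ v₁ v₂ := bub_of_eq h₁₂
  -- the gluing in which color `0` is parallel to color `a` at `v₁` and `v₂`
  obtain ⟨π₂, hπ₂⟩ : ∃ π₂, π₂ = π * swap v₁ x₁ * swap v₂ x₂ := ⟨_, rfl⟩
  have hval₁ : π₂ v₁ = τ a v₁ := by
    rw [hπ₂, Perm.mul_apply, Perm.mul_apply, swap_apply_of_ne_of_ne hv hv₁x₂, swap_apply_left, hx₁]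
  have hval₂ : π₂ v₂ = τ a v₂ := by
    rw [hπ₂, Perm.mul_apply, Perm.mul_apply, swap_apply_left,
      swap_apply_of_ne_of_ne hv₁x₂.symm hx.symm, hx₂]
  have hassoc : ∀ d, (τ d)⁻¹ * π₂ = (τ d)⁻¹ * π * swap v₁ x₁ * swap v₂ x₂ := by
    intro d; rw [hπ₂]; simp only [mul_assoc]
  -- both reconnections split a cycle of color `a`
  have ha₁ : cyc ((τ a)⁻¹ * π) v₁ x₁ := by
    have := cyc_apply ((τ a)⁻¹ * π) x₁
    rw [Perm.mul_apply, hx₁, inv_apply_self'] at this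
    exact (cyc _).symm this
  have ha₂ : cyc ((τ a)⁻¹ * π * swap v₁ x₁) v₂ x₂ := by
    have := cyc_apply ((τ a)⁻¹ * π * swap v₁ x₁) x₂
    rw [Perm.mul_apply, Perm.mul_apply, swap_apply_of_ne_of_ne hv₁x₂.symm hx.symm, hx₂,
      inv_apply_self'] at this
    exact (cyc _).symm this
  have na₁ := classes_cyc_split hv₁x₁ ha₁
  have na₂ := classes_cyc_split hv₂x₂ ha₂
  -- the first reconnection merges two cycles of color `b`, the second one splits a cycle
  have hb₁ : cyc ((τ b)⁻¹ * π * swap v₁ x₁) v₁ x₁ := cyc_mul_swap_of_not hb₁₁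
  have ev₁ : ((τ b)⁻¹ * π * swap v₁ x₁) v₁ = v₂ := by
    rw [Perm.mul_apply, Perm.mul_apply, swap_apply_left, hx₁, h₁₂, inv_apply_self']
  have ex₂ : ((τ b)⁻¹ * π * swap v₁ x₁) x₂ = v₁ := by
    rw [Perm.mul_apply, Perm.mul_apply, swap_apply_of_ne_of_ne hv₁x₂.symm hx.symm, hx₂, h₂₁,
      inv_apply_self']
  have hb₁₂ : cyc ((τ b)⁻¹ * π * swap v₁ x₁) v₁ v₂ := by
    have := cyc_apply ((τ b)⁻¹ * π * swap v₁ x₁) v₁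
    rwa [ev₁] at this
  have hb₂ : cyc ((τ b)⁻¹ * π * swap v₁ x₁) v₂ x₂ := by
    have := cyc_apply ((τ b)⁻¹ * π * swap v₁ x₁) x₂
    rw [ex₂] at this
    exact (cyc _).trans ((cyc _).symm hb₁₂) ((cyc _).symm this)
  have nb₁ := classes_cyc_merge hb₁₁
  have nb₂ := classes_cyc_split hv₂x₂ hb₂
  -- the number of components does not change, so maximality forces two mergers in color `c`
  have nc₁ := classes_cyc_merge hc₁₁
  have k₁ : classes (conn τ (π * swap v₁ x₁)) = classes (conn τ π) :=
    classes_conn_eq (cyc_le_conn τ π a ha₁) (cyc_le_conn τ _ b (by rwa [← mul_assoc]))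
  have k₂ : classes (conn τ π₂) = classes (conn τ (π * swap v₁ x₁)) := by
    rw [hπ₂]
    refine classes_conn_eq (cyc_le_conn τ _ a (by rwa [← mul_assoc])) ?_
    exact conn_of_square hv₁x₂ hv₂x₁ hv₁x₁ hv₂x₂ hv hx hc₁₂ hc₂₂ hbv
  have z₀ := zc_eq (τ := τ) hab hca hcb π
  have z₂ := zc_eq (τ := τ) hab hca hcb π₂
  have hs := hπ π₂
  rw [hassoc, hassoc, hassoc] at z₂
  simp only [score] at hs
  have hc₂ : ¬ cyc ((τ c)⁻¹ * π * swap v₁ x₁) v₂ x₂ := by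
    intro k
    have nc₂ := classes_cyc_split hv₂x₂ k
    omega
  have nc₂ := classes_cyc_merge hc₂
  have hmax : IsMaximizer τ π₂ := by
    intro π'
    have := hπ π'
    simp only [score] at this ⊢
    omega
  obtain ⟨ρ, hρ, ht⟩ := hrec π₂ hmax hval₁
  -- how the four edges share bicolored cycles
  have rc₁ : cyc ((τ c)⁻¹ * π₂) x₁ v₁ := by
    rw [hassoc, cyc_mul_swap_eq_glue hc₂]
    exact le_glue _ _ _ ((cyc _).symm (cyc_mul_swap_of_not hc₁₁))
  have rc₂ : cyc ((τ c)⁻¹ * π₂) x₂ v₂ := by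
    rw [hassoc]
    exact (cyc _).symm (cyc_mul_swap_of_not hc₂)
  have rb : cyc ((τ b)⁻¹ * π₂) x₁ x₂ := by
    have hclosed : ¬ cyc ((τ b)⁻¹ * π₂) x₁ v₂ := by
      have e₁ : ((τ b)⁻¹ * π₂) v₁ = v₂ := by
        rw [Perm.mul_apply, hval₁, h₁₂, inv_apply_self']
      have e₂ : ((τ b)⁻¹ * π₂) v₂ = v₁ := by
        rw [Perm.mul_apply, hval₂, h₂₁, inv_apply_self']
      have hker : cyc ((τ b)⁻¹ * π₂) ≤ Setoid.ker (fun z => z = v₁ ∨ z = v₂) := by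
        refine cyc_le_iff.2 fun z => propext ⟨?_, ?_⟩
        · rintro (rfl | rfl)
          · exact Or.inr e₁
          · exact Or.inl e₂
        · rintro (k | k)
          · exact Or.inr (((τ b)⁻¹ * π₂).injective (k.trans e₂.symm))
          · exact Or.inl (((τ b)⁻¹ * π₂).injective (k.trans e₁.symm))
      intro k
      have h1 : (x₁ = v₁ ∨ x₁ = v₂) = (v₂ = v₁ ∨ v₂ = v₂) := hker k
      rcases h1.symm ▸ (Or.inr rfl : v₂ = v₁ ∨ v₂ = v₂) with k | k
      · exact hv₁x₁ k.symm
      · exact hv₂x₁ k.symm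
    have h1 : cyc ((τ b)⁻¹ * π * swap v₁ x₁) x₁ v₂ := (cyc _).trans ((cyc _).symm hb₁) hb₁₂
    rw [cyc_eq_glue_mul_swap hv₂x₂ hb₂, ← hassoc] at h1
    rcases h1 with h1 | ⟨h1, -⟩ | ⟨h1, -⟩
    · exact absurd h1 hclosed
    · exact absurd h1 hclosed
    · exact h1
  have ra : ¬ cyc ((τ a)⁻¹ * π₂) x₁ x₂ := by
    intro k
    have l₁ : cyc ((τ a)⁻¹ * π * swap v₁ x₁) ≤ cyc ((τ a)⁻¹ * π) := by
      conv_rhs => rw [cyc_eq_glue_mul_swap hv₁x₁ ha₁]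
      exact le_glue _ _ _
    have l₂ : cyc ((τ a)⁻¹ * π₂) ≤ cyc ((τ a)⁻¹ * π * swap v₁ x₁) := by
      rw [hassoc]
      conv_rhs => rw [cyc_eq_glue_mul_swap hv₂x₂ ha₂]
      exact le_glue _ _ _
    exact ha₂₁ ((cyc _).trans (l₁ ha₂) ((cyc _).symm (l₁ (l₂ k))))
  have rcn : ¬ cyc ((τ c)⁻¹ * π₂) x₁ x₂ := fun k =>
    ra (cyc_of_cut a (hmax.cut hcb.symm hx rb k))
  obtain ⟨y₁, hy₁, hxy₁⟩ := ht.exists_visit hρ hcb.symm hmax ((bub τ).refl v₁) rc₁ rb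
    (Or.inr ⟨rcn, v₂, hbv, rc₂⟩)
  obtain ⟨y₂, hy₂, hxy₂⟩ := ht.exists_visit hρ hcb.symm hmax hbv rc₂ ((cyc _).symm rb)
    (Or.inr ⟨fun k => rcn ((cyc _).symm k), v₁, (bub τ).refl v₁, rc₁⟩)
  -- the chains of `π₂` through `v₁` and `v₂` have length one
  obtain ⟨θ, hθ⟩ : ∃ θ, θ = ρ⁻¹ * π₂ := ⟨_, rfl⟩
  have hfix : ∀ v, π₂ v = τ a v → θ v = v := by
    intro v e
    have h1 := hρ.bub_inv a v
    have h2 := cyc_apply (ρ⁻¹ * π₂) v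
    rw [Perm.mul_apply, e] at h2
    rw [hθ, Perm.mul_apply, e]
    exact (ht.eq_of_bub hρ h1 h2).symm
  have hf₁ := hfix v₁ hval₁
  have hf₂ := hfix v₂ hval₂
  have hxn : ¬ cyc θ x₁ x₂ := by
    intro k
    rw [hθ] at k
    exact rcn (cyc_of_cut c (ht.cut hρ hx k))
  rw [← hθ] at hxy₁ hxy₂
  have hyv : ∀ {x y v}, cyc θ x y → θ v = v → v ≠ x → y ≠ v := by
    rintro x y v k e hne rfl
    exact hne (SameCycle.eq_of_right k e).symm
  have n₁₁ := hyv hxy₁ hf₁ hv₁x₁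
  have n₁₂ := hyv hxy₁ hf₂ hv₂x₁
  have n₂₁ := hyv hxy₂ hf₁ hv₁x₂
  have n₂₂ := hyv hxy₂ hf₂ hv₂x₂
  have hfixed : ∀ {σ : Perm α} {v z}, σ v = v → v ≠ z → ¬ cyc σ v z := fun e hne k =>
    hne (SameCycle.eq_of_left k e)
  obtain ⟨σ₁, hσ₁⟩ : ∃ σ₁, σ₁ = swap v₁ y₁ * (θ * swap v₁ x₁) := ⟨_, rfl⟩
  have m₁ : classes (cyc σ₁) = classes (cyc θ) := by
    have h1 := hfixed hf₁ hv₁x₁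
    have h2 := classes_cyc_merge h1
    have h3 : cyc (θ * swap v₁ x₁) v₁ y₁ := by
      rw [cyc_mul_swap_eq_glue h1]
      exact (glue _ _ _).trans (glue_pair _ _ _) (le_glue _ _ _ hxy₁)
    rw [hσ₁, classes_cyc_swap_mul, classes_cyc_split n₁₁.symm h3]
    omega
  have hσv : σ₁ v₂ = v₂ := by
    rw [hσ₁, Perm.mul_apply, Perm.mul_apply, swap_apply_of_ne_of_ne hv.symm hv₂x₁, hf₂,
      swap_apply_of_ne_of_ne hv.symm n₁₂.symm]
  have hσx : cyc σ₁ x₂ y₂ := by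
    have hpow : ∀ n : ℕ, (σ₁ ^ n) x₂ = (θ ^ n) x₂ := by
      intro n
      induction n with
      | zero => rfl
      | succ n ih =>
        have k : cyc θ x₂ ((θ ^ n) x₂) := sameCycle_pow_right.2 (SameCycle.refl _ _)
        have k' : cyc θ x₂ ((θ ^ (n + 1)) x₂) := sameCycle_pow_right.2 (SameCycle.refl _ _)
        rw [pow_succ', Perm.mul_apply, ih, hσ₁, Perm.mul_apply, Perm.mul_apply,
          swap_apply_of_ne_of_ne (hyv k hf₁ hv₁x₂), pow_succ', Perm.mul_apply,
          swap_apply_of_ne_of_ne]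
        · rw [← Perm.mul_apply, ← pow_succ']
          exact hyv k' hf₁ hv₁x₂
        · rw [← Perm.mul_apply, ← pow_succ']
          intro e
          rw [e] at k'
          exact hxn ((cyc θ).trans hxy₁ ((cyc θ).symm k'))
        · intro e
          rw [e] at k
          exact hxn ((cyc θ).symm k)
    obtain ⟨n, hn⟩ := SameCycle.exists_nat_pow_eq hxy₂
    rw [← hn, ← hpow]
    exact sameCycle_pow_right.2 (SameCycle.refl _ _)
  have m₂ : classes (cyc (swap v₂ y₂ * (σ₁ * swap v₂ x₂))) = classes (cyc σ₁) := by
    have h1 := hfixed hσv hv₂x₂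
    have h2 := classes_cyc_merge h1
    have h3 : cyc (σ₁ * swap v₂ x₂) v₂ y₂ := by
      rw [cyc_mul_swap_eq_glue h1]
      exact (glue _ _ _).trans (glue_pair _ _ _) (le_glue _ _ _ hσx)
    rw [classes_cyc_swap_mul, classes_cyc_split n₂₂.symm h3]
    omega
  refine ⟨ρ * swap v₁ y₁ * swap v₂ y₂, (hρ.mul_swap hy₁).mul_swap
    ((bub τ).trans ((bub τ).symm hbv) hy₂), ?_⟩
  have hcomm : swap v₁ x₁ * swap v₂ x₂ = swap v₂ x₂ * swap v₁ x₁ :=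
    (Perm.disjoint_swap_swap (by
      simp [hv, hv₁x₁, hv₁x₂, hv₂x₁.symm, hv₂x₂, hx])).commute
  have hprod : (ρ * swap v₁ y₁ * swap v₂ y₂)⁻¹ * π = swap v₂ y₂ * (σ₁ * swap v₂ x₂) := by
    have h1 : π = π₂ * (swap v₁ x₁ * swap v₂ x₂) := by
      conv_rhs => rw [hcomm, hπ₂, mul_assoc, mul_assoc π,
        ← mul_assoc (swap v₂ x₂) (swap v₂ x₂), swap_mul_self, one_mul, swap_mul_self, mul_one]
    rw [hσ₁, hθ, h1]
    simp only [mul_inv_rev, swap_inv, mul_assoc]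
  rw [TreeLike, hprod, m₂, m₁, hθ]
  unfold TreeLike at ht
  omega

/-- In a maximizer which is not tree-like, the edge of color `0` at the black end of the edge of
color `a` at `v` shares no bicolored cycle of another color with `v`: the two edges of color `0`
would form a 2-edge-cut, and reconnecting them makes color `0` parallel to color `a` at `v`. -/
theorem not_cyc_of_not_exists_treeLike (hπ : IsMaximizer τ π) {a b : Fin 3} (hba : b ≠ a) {v x : α}
    (hx : π x = τ a v)
    (hrec : ∀ π', IsMaximizer τ π' → π' v = τ a v → ∃ ρ, Preserves τ ρ ∧ TreeLike τ ρ π')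
    (hno : ¬ ∃ ρ, Preserves τ ρ ∧ TreeLike τ ρ π) : ¬ cyc ((τ b)⁻¹ * π) v x := by
  intro hb
  by_cases hvx : v = x
  · subst hvx; exact hno (hrec π hπ hx)
  have ha : cyc ((τ a)⁻¹ * π) v x := by
    have := cyc_apply ((τ a)⁻¹ * π) x
    rw [Perm.mul_apply, hx, inv_apply_self'] at this
    exact (cyc _).symm this
  have hcut := hπ.cut hba hvx hb ha
  obtain ⟨ρ, hρ, ht⟩ := hrec _ (hπ.of_cut hcut) (by
    rw [Perm.mul_apply, swap_apply_left, hx])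
  exact hno ⟨ρ, hρ, ht.of_cut hρ hcut⟩

/-- If all bubbles but one are planar, then every maximizer is tree-like. By induction on the number
of nontrivial vertices of the planar bubbles: a short face exists by Euler's inequality, and after
reconnections along it a contraction is possible. -/
theorem PlanarOff.exists_treeLike (h : PlanarOff A τ σ) (hπ : IsMaximizer τ π) :
    ∃ ρ, Preserves τ ρ ∧ TreeLike τ ρ π := by
  generalize hn : Nat.card {x // ¬ IsTrivial σ x} = n
  induction n using Nat.strong_induction_on generalizing τ σ π with
  | _ n ih =>
  by_cases hall : ∀ x, IsTrivial σ x
  · refine exists_treeLike_of_trivial (A := A) (fun x hx a b => ?_)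
      (h.connected τ fun _ _ _ => rfl) hπ
    rw [h.eq_off x hx, h.eq_off x hx]
    exact hall x a b
  push Not at hall
  obtain ⟨v, hv⟩ := hall
  have hrec : ∀ v, ¬ IsTrivial σ v → ∀ a π', IsMaximizer τ π' → π' v = τ a v →
      ∃ ρ, Preserves τ ρ ∧ TreeLike τ ρ π' := by
    intro v hv a π' hπ' hv'
    obtain ⟨τ', σ', δ, h', hlt, hpres, hzc, hcl⟩ := h.contract hv a
    exact exists_treeLike_of_contract (fun π hπ => ih _ (hn ▸ hlt) h' hπ rfl) hpres hzc
      hcl hπ' hv'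
  by_contra hno
  obtain ⟨a, b, v₁, hab, hv₁, hface⟩ := exists_short_face h.euler hv
  obtain ⟨c, hca, hcb⟩ := exists_third (a := a) (b := b)
  obtain ⟨v₂, hv₂⟩ : ∃ v₂, v₂ = ((σ a)⁻¹ * σ b) v₁ := ⟨_, rfl⟩
  rw [← hv₂] at hface
  have e₂₁ : σ a v₂ = σ b v₁ := by rw [hv₂, Perm.mul_apply, apply_inv_self']
  have e₁₂ : σ a v₁ = σ b v₂ := by
    rw [← hface, Perm.mul_apply, apply_inv_self']
  have hv₂' : ¬ IsTrivial σ v₂ := by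
    intro k
    have h1 := (σ a).injective (e₁₂.trans (k b a))
    exact hv₁ (h1 ▸ k)
  have t₁ := h.eq_off v₁ (h.not_mem hv₁)
  have t₂ := h.eq_off v₂ (h.not_mem hv₂')
  have f₂₁ : τ a v₂ = τ b v₁ := by rw [t₁, t₂, e₂₁]
  have f₁₂ : τ a v₁ = τ b v₂ := by rw [t₁, t₂, e₁₂]
  obtain ⟨x₁, hx₁⟩ : ∃ x, π x = τ a v₁ := ⟨π⁻¹ (τ a v₁), apply_inv_self' _ _⟩
  obtain ⟨x₂, hx₂⟩ : ∃ x, π x = τ a v₂ := ⟨π⁻¹ (τ a v₂), apply_inv_self' _ _⟩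
  have hedge : ∀ v, ¬ IsTrivial σ v → ∀ {a b x}, b ≠ a → π x = τ a v →
      ¬ cyc ((τ b)⁻¹ * π) v x := fun v hv a b x hba hx =>
    not_cyc_of_not_exists_treeLike hπ hba hx (hrec v hv a) hno
  by_cases hv : v₁ = v₂
  · subst hv
    refine hedge v₁ hv₁ hab.symm hx₁ ?_
    have := cyc_apply ((τ b)⁻¹ * π) x₁
    rw [Perm.mul_apply, hx₁, f₁₂, inv_apply_self'] at this
    exact (cyc _).symm this
  · exact hno (exists_treeLike_of_square hπ hab hca hcb hv f₁₂ f₂₁ hx₁ hx₂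
      (hedge v₁ hv₁ hab.symm hx₁) (hedge v₁ hv₁ hca hx₁) (hedge v₂ hv₂' hca hx₂)
      (hedge v₁ hv₁ hcb (hx₂.trans f₂₁)) (hedge v₂ hv₂' hab (hx₁.trans f₁₂))
      (hrec v₁ hv₁ a))

end PermGluing

/-! ### Tree-like gluings and 2-edge-cuts -/

namespace PermGluing

open Equiv Equiv.Perm

variable {α : Type u} [Finite α] [DecidableEq α] {τ : Fin 3 → Perm α} {π ρ : Perm α}

/-- If any two consecutive edges of a chain form a 2-edge-cut, then the gluing is tree-like.
Reconnecting such a pair of edges splits off a chain of length one, and consecutive edges of the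
shortened chain still form cuts. -/
theorem TreeLike.of_forall_cut (hρ : Preserves τ ρ)
    (h : ∀ y x, (ρ⁻¹ * π) y = x → x ≠ y → ¬ conn τ (π * swap y x) y x) : TreeLike τ ρ π := by
  generalize hn : Nat.card α - classes (cyc (ρ⁻¹ * π)) = n
  have hle : ∀ π : Perm α, classes (cyc (ρ⁻¹ * π)) ≤ Nat.card α := fun π =>
    Nat.card_le_card_of_surjective _ Quotient.mk_surjective
  induction n using Nat.strong_induction_on generalizing π with
  | _ n ih =>
    by_cases h1 : ρ⁻¹ * π = 1
    · have : π = ρ := by rw [← mul_left_cancel_iff (a := ρ⁻¹), h1, inv_mul_cancel]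
      rw [TreeLike, h1, classes_cyc_one, this, hρ.conn_self, add_comm]
    · obtain ⟨y, hy⟩ : ∃ y, (ρ⁻¹ * π) y ≠ y := by
        by_contra hc; push Not at hc
        exact h1 (Perm.ext hc)
      obtain ⟨x, hx⟩ : ∃ x, (ρ⁻¹ * π) y = x := ⟨_, rfl⟩
      rw [hx] at hy
      have hcut := h y x hx hy
      have hsp := classes_cyc_split hy.symm (hx ▸ cyc_apply (ρ⁻¹ * π) y)
      rw [mul_assoc] at hsp
      refine TreeLike.of_cut hρ hcut (ih _ ?_ ?_ rfl)
      · have := hle (π * swap y x)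
        omega
      -- a step of the chain of `π₂` between two points whose edges get reconnected
      have key : ∀ (π₂ : Perm α) (a : α), (ρ⁻¹ * π₂) a = x →
          conn τ (π₂ * swap a x) ≤ conn τ π₂ := by
        intro π₂ a ha
        have hax : conn τ π₂ a x := by
          have := hρ.chain_le (cyc_apply (ρ⁻¹ * π₂) a)
          rwa [ha] at this
        exact (conn_mul_swap_le τ π₂ a x).trans (glue_eq_self hax).le
      intro z z' hz hzz hk
      have hzx : z ≠ x := by
        rintro rfl
        refine hzz (hz.symm.trans ?_)
        rw [← mul_assoc, Perm.mul_apply, swap_apply_right, hx]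
      by_cases hzy : z = y
      · subst hzy
        rw [← mul_assoc, Perm.mul_apply, swap_apply_left] at hz
        have hzx' : z' ≠ x := by
          rintro rfl
          exact hy ((ρ⁻¹ * π).injective (hz.trans hx.symm))
        have e : π * swap z x * swap z z' = π * swap x z' * swap z x := by
          have h3 : swap z x * swap z z' = swap x z' * swap z x := by
            rw [mul_swap_eq_swap_mul, swap_apply_left, swap_apply_of_ne_of_ne hzz hzx']
          rw [mul_assoc, h3, mul_assoc]
        have h2 : (ρ⁻¹ * (π * swap x z')) z = x := by
          rw [← mul_assoc, Perm.mul_apply, swap_apply_of_ne_of_ne hzx hzz.symm, hx]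
        rw [e] at hk
        have h4 := hρ.chain_le (cyc_apply (ρ⁻¹ * (π * swap x z')) z)
        rw [h2] at h4
        exact h x z' hz hzx' ((conn τ _).trans ((conn τ _).symm h4) (key _ z h2 hk))
      · have hz2 : (ρ⁻¹ * π) z = z' := by
          rwa [← mul_assoc, Perm.mul_apply, swap_apply_of_ne_of_ne hzy hzx] at hz
        have hzx' : z' ≠ x := by
          rintro rfl
          exact hzy ((ρ⁻¹ * π).injective (hz2.trans hx.symm))
        have e : π * swap y x * swap z z' = π * swap z z' * swap (swap z z' y) x := by
          rw [mul_assoc, swap_mul_eq_mul_swap (swap z z'), swap_inv,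
            swap_apply_of_ne_of_ne hzx.symm hzx'.symm, mul_assoc]
        have h2 : (ρ⁻¹ * (π * swap z z')) (swap z z' y) = x := by
          rw [← mul_assoc, Perm.mul_apply, swap_apply_self, hx]
        rw [e] at hk
        exact h z z' hz2 hzz (key _ _ h2 hk)

/-- Any pairing can be extended to a connected tree-like gluing. -/
theorem exists_connected_treeLike [Nonempty α] (hρ : Preserves τ ρ) :
    ∃ π, classes (conn τ π) = 1 ∧ TreeLike τ ρ π := by
  have h0 : TreeLike τ ρ ρ := by
    rw [TreeLike, inv_mul_cancel, classes_cyc_one, hρ.conn_self, add_comm]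
  have hpos : 0 < classes (conn τ ρ) :=
    Nat.card_pos_iff.2 ⟨‹Nonempty α›.map (Quotient.mk _), inferInstance⟩
  have : ∀ (n : ℕ) (π : Perm α), TreeLike τ ρ π → classes (conn τ π) = n + 1 →
      ∃ π, classes (conn τ π) = 1 ∧ TreeLike τ ρ π := by
    intro n
    induction n with
    | zero => exact fun π h hc => ⟨π, hc, h⟩
    | succ n ih =>
      intro π h hc
      obtain ⟨x, y, hxy⟩ : ∃ x y, ¬ conn τ π x y := by
        by_contra hcon
        push Not at hcon
        have : Subsingleton (Quotient (conn τ π)) :=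
          ⟨fun p q => Quotient.inductionOn₂ p q fun a b => Quotient.sound (hcon a b)⟩
        have := Finite.card_le_one_iff_subsingleton (α := Quotient (conn τ π)) |>.2 this
        unfold classes at hc
        omega
      have e : π * swap x y * swap x y = π := by rw [mul_assoc, swap_mul_self, mul_one]
      have hcut : ¬ conn τ (π * swap x y * swap x y) x y := by rwa [e]
      have h1 := classes_conn_cut (conn_of_cut hcut) hcut
      rw [e] at h1
      exact ih (π * swap x y) (TreeLike.of_cut hρ hcut (by rwa [e])) (by omega)
  exact this (classes (conn τ ρ) - 1) ρ h0 (by omega)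

end PermGluing

open PermGluing

/-! ### Components and bicolored cycles of colored graphs -/

theorem SimpleGraph.rel_of_reachable {V : Type*} {β : Type*} {S : SimpleGraph V} {r : Setoid β}
    {f : V → β} (hf : ∀ v w, S.Adj v w → r (f v) (f w)) {v w : V} (h : S.Reachable v w) :
    r (f v) (f w) := by
  obtain ⟨p⟩ := h
  induction p with
  | nil => exact r.refl _
  | cons h _ ih => exact r.trans (hf _ _ h) ih

/-- The components of a graph on `V`, counted as the classes of a relation on `β`, where `i` and `f`
are mutually inverse up to these relations. -/
theorem SimpleGraph.card_connectedComponent_eq {V β : Type*} (S : SimpleGraph V) (r : Setoid β)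
    (i : β → V) (f : V → β) (hr : ∀ x y, r x y → S.Reachable (i x) (i y))
    (hf : ∀ v w, S.Adj v w → r (f v) (f w)) (hi : ∀ x, r (f (i x)) x)
    (hv : ∀ v, S.Reachable (i (f v)) v) : Nat.card S.ConnectedComponent = Nat.card (Quotient r) := by
  refine (Nat.card_congr (Equiv.ofBijective (Quotient.lift (fun x => S.connectedComponentMk (i x))
    fun x y h => SimpleGraph.ConnectedComponent.sound (hr x y h)) ⟨?_, ?_⟩)).symm
  · intro p q
    induction p using Quotient.inductionOn with | h x => ?_
    induction q using Quotient.inductionOn with | h y => ?_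
    intro h
    have h1 := rel_of_reachable hf (SimpleGraph.ConnectedComponent.exact h)
    exact Quotient.sound (r.trans (r.symm (hi x)) (r.trans h1 (hi y)))
  · intro C
    induction C using SimpleGraph.ConnectedComponent.ind with | h v => ?_
    exact ⟨Quotient.mk r (f v), SimpleGraph.ConnectedComponent.sound (hv v)⟩

/-- The components of a graph, counted along a function which is constant on components. -/
theorem SimpleGraph.card_connectedComponent_fiber {V ι : Type*} [Finite V] [Fintype ι]
    (S : SimpleGraph V) (f : V → ι) (hf : ∀ v w, S.Adj v w → f v = f w)
    (T : ∀ i, SimpleGraph {v // f v = i})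
    (hT : ∀ i v w, (T i).Adj v w ↔ S.Adj v.1 w.1) :
    Nat.card S.ConnectedComponent = ∑ i, Nat.card (T i).ConnectedComponent := by
  rw [← Nat.card_sigma]
  have hreach : ∀ {v w : V}, S.Reachable v w → ∀ (i : ι) (hv : f v = i) (hw : f w = i),
      (T i).Reachable ⟨v, hv⟩ ⟨w, hw⟩ := by
    rintro v w ⟨p⟩
    induction p with
    | nil => intro i _ _; exact SimpleGraph.Reachable.refl _
    | cons h _ ih =>
      intro i hv hw
      have hu := (hf _ _ h).symm.trans hv
      exact (SimpleGraph.Adj.reachable ((hT i ⟨_, hv⟩ ⟨_, hu⟩).2 h)).trans (ih i hu hw)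
  let g : ∀ i, (T i).ConnectedComponent → S.ConnectedComponent := fun i =>
    SimpleGraph.ConnectedComponent.lift (fun v => S.connectedComponentMk v.1) fun v w p _ => by
      refine SimpleGraph.ConnectedComponent.sound ?_
      clear * - hT p
      induction p with
      | nil => exact SimpleGraph.Reachable.refl _
      | cons h _ ih => exact (SimpleGraph.Adj.reachable ((hT i _ _).1 h)).trans ih
  have hfr : ∀ {v w : V}, S.Reachable v w → f v = f w := by
    rintro v w ⟨p⟩
    induction p with
    | nil => rfl
    | cons h _ ih => exact (hf _ _ h).trans ih
  refine (Nat.card_congr (Equiv.ofBijective (fun p : Σ i, (T i).ConnectedComponent => g p.1 p.2)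
    ⟨?_, ?_⟩)).symm
  · rintro ⟨i, C⟩ ⟨j, D⟩
    induction C using SimpleGraph.ConnectedComponent.ind with | h v => ?_
    induction D using SimpleGraph.ConnectedComponent.ind with | h w => ?_
    intro h
    have h1 : S.Reachable v.1 w.1 := SimpleGraph.ConnectedComponent.exact h
    have h2 : i = j := v.2.symm.trans ((hfr h1).trans w.2)
    subst h2
    have h3 := SimpleGraph.ConnectedComponent.sound (hreach h1 i v.2 w.2)
    exact congrArg (Sigma.mk i) h3
  · intro C
    induction C using SimpleGraph.ConnectedComponent.ind with | h v => ?_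
    exact ⟨⟨f v, (T (f v)).connectedComponentMk ⟨v, rfl⟩⟩, rfl⟩

namespace ColoredGraph

variable {C : Type} {V W : Type u}

theorem sub_adj_nbr (G : ColoredGraph C V) {S : Set C} {c : C} (hc : c ∈ S) (v : V) :
    (G.sub S).Adj v (G.nbr c v) := ⟨c, hc, rfl⟩

/-- The type of white vertices. -/
abbrev Whites (G : ColoredGraph C V) : Type u := {v : V // G.white v = true}

theorem white_nbr_eq_false (G : ColoredGraph C V) (c : C) (x : G.Whites) :
    G.white (G.nbr c x) = false := by
  rw [G.white_nbr, x.2]; rfl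

theorem white_nbr_eq_true (G : ColoredGraph C V) (c : C) {v : V} (h : G.white v = false) :
    G.white (G.nbr c v) = true := by
  rw [G.white_nbr, h]; rfl

/-- The permutation of the white vertices which follows the edge of color `c` and comes back along
the edge of color `c₀`. -/
def whitePerm (G : ColoredGraph C V) (c₀ c : C) : Equiv.Perm G.Whites where
  toFun x := ⟨G.nbr c₀ (G.nbr c x), G.white_nbr_eq_true c₀ (G.white_nbr_eq_false c x)⟩
  invFun x := ⟨G.nbr c (G.nbr c₀ x), G.white_nbr_eq_true c (G.white_nbr_eq_false c₀ x)⟩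
  left_inv x := Subtype.ext (by simp [G.nbr_nbr])
  right_inv x := Subtype.ext (by simp [G.nbr_nbr])

theorem coe_whitePerm (G : ColoredGraph C V) (c₀ c : C) (x : G.Whites) :
    (G.whitePerm c₀ c x : V) = G.nbr c₀ (G.nbr c x) := rfl

theorem coe_whitePerm_inv (G : ColoredGraph C V) (c₀ c : C) (x : G.Whites) :
    ((G.whitePerm c₀ c)⁻¹ x : V) = G.nbr c (G.nbr c₀ x) := rfl

theorem whitePerm_inv_mul (G : ColoredGraph C V) (c₀ a b : C) :
    (G.whitePerm c₀ a)⁻¹ * G.whitePerm c₀ b = G.whitePerm a b := by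
  ext x
  rw [Equiv.Perm.mul_apply, coe_whitePerm_inv, coe_whitePerm, coe_whitePerm, G.nbr_nbr]

/-- The white end of the edge of color `c` at a vertex. -/
def whiteEnd (G : ColoredGraph C V) (c : C) (v : V) : G.Whites :=
  if h : G.white v = true then ⟨v, h⟩
  else ⟨G.nbr c v, G.white_nbr_eq_true c (by simpa using h)⟩

theorem whiteEnd_coe (G : ColoredGraph C V) (c : C) (x : G.Whites) : G.whiteEnd c x = x := by
  rw [whiteEnd, dif_pos x.2]

theorem coe_whiteEnd_of_false (G : ColoredGraph C V) (c : C) {v : V} (h : G.white v = false) :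
    (G.whiteEnd c v : V) = G.nbr c v := by
  rw [whiteEnd, dif_neg (by simp [h])]

theorem coe_whiteEnd_nbr (G : ColoredGraph C V) (c d : C) (x : G.Whites) :
    (G.whiteEnd c (G.nbr d x) : V) = G.nbr c (G.nbr d x) :=
  G.coe_whiteEnd_of_false c (G.white_nbr_eq_false d x)

theorem reachable_whiteEnd (G : ColoredGraph C V) {S : Set C} {c : C} (hc : c ∈ S) (v : V) :
    (G.sub S).Reachable (G.whiteEnd c v) v := by
  cases h : G.white v
  · rw [G.coe_whiteEnd_of_false c h]
    exact (SimpleGraph.Adj.reachable (G.sub_adj_nbr hc v)).symm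
  · rw [G.whiteEnd_coe c ⟨v, h⟩]

/-- A relation on white vertices which contains the steps along the colors of `S` is respected by
adjacency in `G(S)`. -/
theorem rel_whiteEnd_of_adj (G : ColoredGraph C V) {S : Set C} {c : C}
    {r : Setoid G.Whites} (hr : ∀ d ∈ S, ∀ x, r x (G.whitePerm c d x)) {v w : V}
    (h : (G.sub S).Adj v w) : r (G.whiteEnd c v) (G.whiteEnd c w) := by
  obtain ⟨d, hd, rfl⟩ := h
  have key : ∀ x : G.Whites, r (G.whiteEnd c x) (G.whiteEnd c (G.nbr d x)) := by
    intro x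
    have h1 : G.whiteEnd c (G.nbr d x) = G.whitePerm c d x :=
      Subtype.ext (G.coe_whiteEnd_nbr c d x)
    rw [G.whiteEnd_coe, h1]
    exact hr d hd x
  cases h : G.white v
  · have := key ⟨G.nbr d v, G.white_nbr_eq_true d h⟩
    simp only [G.nbr_nbr] at this
    exact r.symm this
  · exact key ⟨v, h⟩

theorem reachable_whitePerm (G : ColoredGraph C V) {S : Set C} {c d : C} (hc : c ∈ S)
    (hd : d ∈ S) (x : G.Whites) : (G.sub S).Reachable x (G.whitePerm c d x) :=
  (SimpleGraph.Adj.reachable (G.sub_adj_nbr hd x)).trans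
    (SimpleGraph.Adj.reachable (G.sub_adj_nbr hc _))

/-- Reachability, as a relation between the white vertices. -/
def whiteReach (G : ColoredGraph C V) (S : SimpleGraph V) : Setoid G.Whites :=
  S.reachableSetoid.comap Subtype.val

theorem card_connectedComponent_sub (G : ColoredGraph C V) {S : Set C} {c : C} (hc : c ∈ S) :
    Nat.card (G.sub S).ConnectedComponent = classes (G.whiteReach (G.sub S)) := by
  refine SimpleGraph.card_connectedComponent_eq _ _ Subtype.val (G.whiteEnd c)
    (fun _ _ h => h) (fun v w => G.rel_whiteEnd_of_adj fun d hd x => G.reachable_whitePerm hc hd x)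
    (fun x => ?_) (G.reachable_whiteEnd hc)
  rw [G.whiteEnd_coe]

/-- The bicolored cycles as the cycles of a permutation of the white vertices. -/
theorem cyc_whitePerm [Finite V] (G : ColoredGraph C V) (a b : C) :
    cyc (G.whitePerm a b) = G.whiteReach (G.sub {a, b}) := by
  refine le_antisymm (cyc_le_iff.2 fun x => G.reachable_whitePerm (by simp) (by simp) x) ?_
  intro x y h
  have := SimpleGraph.rel_of_reachable (r := cyc (G.whitePerm a b)) (f := G.whiteEnd a)
    (fun v w => G.rel_whiteEnd_of_adj ?_) h
  · rwa [G.whiteEnd_coe, G.whiteEnd_coe] at this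
  · rintro d (rfl | rfl) x
    · have : G.whitePerm d d x = x := Subtype.ext (G.nbr_nbr d x)
      rw [this]
    · exact cyc_apply _ x

theorem numCycles_eq [Finite V] (G : ColoredGraph C V) (a b : C) :
    G.numCycles a b = classes (cyc (G.whitePerm a b)) := by
  rw [cyc_whitePerm]
  exact G.card_connectedComponent_sub (Set.mem_insert a {b})

theorem numCycles_comm (G : ColoredGraph C V) (a b : C) : G.numCycles a b = G.numCycles b a := by
  rw [numCycles, numCycles, Set.pair_comm]

theorem card_whites [Finite V] [Nonempty C] (G : ColoredGraph C V) :
    Nat.card V = 2 * Nat.card G.Whites := by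
  obtain ⟨c⟩ := ‹Nonempty C›
  have h1 : Nat.card {v : V // ¬ G.white v = true} = Nat.card G.Whites := by
    refine Nat.card_congr ⟨fun v => ⟨G.nbr c v, G.white_nbr_eq_true c (by simpa using v.2)⟩,
      fun v => ⟨G.nbr c v, by simp [G.white_nbr, v.2]⟩, fun v => ?_, fun v => ?_⟩
    · exact Subtype.ext (G.nbr_nbr c v)
    · exact Subtype.ext (G.nbr_nbr c v)
  classical
  rw [← Nat.card_congr (Equiv.sumCompl fun v => G.white v = true), Nat.card_sum, h1]
  ring

theorem numCycles_congr (G : ColoredGraph C V) (H : ColoredGraph C W) (f : V ≃ W)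
    (hf : ∀ c v, H.nbr c (f v) = f (G.nbr c v)) (a b : C) : G.numCycles a b = H.numCycles a b := by
  let e : G.sub {a, b} ≃g H.sub {a, b} :=
    { toEquiv := f
      map_rel_iff' := by
        intro v w
        refine exists_congr fun c => and_congr_right fun _ => ?_
        rw [hf, f.injective.eq_iff] }
  exact Nat.card_congr e.connectedComponentEquiv

theorem Isomorphic.numCycles_eq {G : ColoredGraph C V} {H : ColoredGraph C W}
    (h : G.Isomorphic H) (a b : C) : G.numCycles a b = H.numCycles a b := by
  obtain ⟨f, -, hf⟩ := h
  exact numCycles_congr G H f hf a b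

theorem Isomorphic.symm {G : ColoredGraph C V} {H : ColoredGraph C W} (h : G.Isomorphic H) :
    H.Isomorphic G := by
  obtain ⟨f, h1, h2⟩ := h
  refine ⟨f.symm, fun v => ?_, fun c v => ?_⟩
  · rw [← h1, f.apply_symm_apply]
  · rw [Equiv.eq_symm_apply, ← h2, f.apply_symm_apply]

instance [Finite V] (B : ColoredGraph (Fin 3) V) : Finite (Pairing B) :=
  Finite.of_injective (fun π => π.pair) (by
    rintro ⟨p, _, _⟩ ⟨q, _, _⟩ h
    cases h; rfl)

instance (B : ColoredGraph (Fin 3) V) : Nonempty (Pairing B) :=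
  ⟨⟨B.nbr 0, B.nbr_nbr 0, B.white_nbr 0⟩⟩

theorem Pairing.zeroCycles_le [Finite V] {B : ColoredGraph (Fin 3) V} (π : Pairing B) :
    π.graph.zeroCycles ≤ B.oneMax :=
  le_ciSup (f := fun π : Pairing B => π.graph.zeroCycles) (Set.finite_range _).bddAbove π

theorem Pairing.isMax_iff [Finite V] {B : ColoredGraph (Fin 3) V} (π : Pairing B) :
    π.IsMax ↔ π.graph.zeroCycles = B.oneMax :=
  ⟨fun h => le_antisymm π.zeroCycles_le (ciSup_le h),
    fun h π' => h ▸ π'.zeroCycles_le⟩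

theorem exists_pairing_isMax [Finite V] (B : ColoredGraph (Fin 3) V) :
    ∃ π : Pairing B, π.IsMax :=
  Finite.exists_max fun π : Pairing B => π.graph.zeroCycles

theorem Isomorphic.oneMax_le [Finite V] [Finite W] {G : ColoredGraph (Fin 3) V}
    {H : ColoredGraph (Fin 3) W} (h : G.Isomorphic H) : G.oneMax ≤ H.oneMax := by
  obtain ⟨f, h1, h2⟩ := h
  refine ciSup_le fun π => ?_
  let π' : Pairing H :=
    { pair := fun w => f (π.pair (f.symm w))
      pair_pair := fun w => by simp [π.pair_pair]
      white_pair := fun w => by rw [h1, π.white_pair, ← h1, f.apply_symm_apply] }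
  have : π.graph.zeroCycles = π'.graph.zeroCycles := by
    refine Finset.sum_congr rfl fun a _ => numCycles_congr _ _ f (fun c v => ?_) _ _
    cases c using Fin.cases with
    | zero => simp [Pairing.graph, π']
    | succ c => simpa [Pairing.graph] using h2 c v
  rw [this]
  exact π'.zeroCycles_le

theorem Isomorphic.oneMax_eq [Finite V] [Finite W] {G : ColoredGraph (Fin 3) V}
    {H : ColoredGraph (Fin 3) W} (h : G.Isomorphic H) : G.oneMax = H.oneMax :=
  le_antisymm h.oneMax_le h.symm.oneMax_le

end ColoredGraph

/-! ### Colored graphs as gluings -/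

theorem SimpleGraph.connected_iff_card {V : Type*} [Finite V] (S : SimpleGraph V) :
    S.Connected ↔ Nat.card S.ConnectedComponent = 1 := by
  rw [Nat.card_eq_one_iff_unique]
  constructor
  · intro h
    exact ⟨h.preconnected.subsingleton_connectedComponent,
      ⟨S.connectedComponentMk h.nonempty.some⟩⟩
  · rintro ⟨h1, ⟨C⟩⟩
    exact { preconnected := fun v w => SimpleGraph.ConnectedComponent.exact (h1.elim _ _)
            nonempty := ⟨C.out⟩ }

namespace ColoredGraph

variable {C : Type} {V W : Type u}

/-- The components of three colors in terms of the permutations of the white vertices. -/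
theorem bub_whitePerm [Finite V] (G : ColoredGraph C V) {S : Set C} (e : Fin 3 → C)
    (he : Set.range e = S) (i : Fin 3) :
    bub (fun d => G.whitePerm (e i) (e d)) = G.whiteReach (G.sub S) := by
  classical
  have hmem : ∀ d, e d ∈ S := fun d => he ▸ ⟨d, rfl⟩
  refine le_antisymm (bub_le_iff.2 fun a b x => ?_) fun x y h => ?_
  · rw [← Equiv.Perm.mul_apply, whitePerm_inv_mul]
    exact G.reachable_whitePerm (hmem a) (hmem b) x
  · have := SimpleGraph.rel_of_reachable (r := bub fun d => G.whitePerm (e i) (e d))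
      (f := G.whiteEnd (e i)) (fun v w => G.rel_whiteEnd_of_adj fun d hd x => ?_) h
    · rwa [G.whiteEnd_coe, G.whiteEnd_coe] at this
    · rw [← he] at hd
      obtain ⟨a, rfl⟩ := hd
      have := bub_step (fun d => G.whitePerm (e i) (e d)) i a x
      rwa [← Equiv.Perm.mul_apply, whitePerm_inv_mul] at this

/-- Bicolored cycles can be counted separately on the fibers of a function which is constant along
the two colors. -/
theorem numCycles_fiber {ι : Type*} [Finite V] [Fintype ι] (H : ColoredGraph C V) (f : V → ι)
    {a b : C} (ha : ∀ v, f (H.nbr a v) = f v) (hb : ∀ v, f (H.nbr b v) = f v) {C' : Type}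
    (K : ∀ i, ColoredGraph C' {v // f v = i}) {a' b' : C'}
    (hKa : ∀ i v, ((K i).nbr a' v : V) = H.nbr a v)
    (hKb : ∀ i v, ((K i).nbr b' v : V) = H.nbr b v) :
    H.numCycles a b = ∑ i, (K i).numCycles a' b' := by
  refine SimpleGraph.card_connectedComponent_fiber _ f ?_ (fun i => (K i).sub {a', b'}) ?_
  · rintro v _ ⟨c, rfl | rfl, rfl⟩
    · exact (ha v).symm
    · exact (hb v).symm
  · intro i v w
    simp [sub, Set.mem_insert_iff, Subtype.ext_iff, hKa, hKb]

section Gluing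

variable (G : ColoredGraph (Fin 4) V)

/-- The colors `1, 2, 3` as permutations of the white vertices; the black vertices are identified
with the white ones along color `1`. -/
def colorPerm (d : Fin 3) : Equiv.Perm G.Whites := G.whitePerm 1 d.succ

/-- The color `0` as a permutation of the white vertices, with the same identification. -/
def zeroPerm : Equiv.Perm G.Whites := G.whitePerm 1 0

theorem colorPerm_inv_mul_zeroPerm (d : Fin 3) :
    (G.colorPerm d)⁻¹ * G.zeroPerm = G.whitePerm d.succ 0 := G.whitePerm_inv_mul 1 _ _

theorem colorPerm_zero : G.colorPerm 0 = 1 := by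
  ext x; exact G.nbr_nbr 1 x

theorem range_succ : Set.range (Fin.succ : Fin 3 → Fin 4) = {c | c ≠ 0} := by
  ext c
  simp

variable [Finite V]

theorem zeroCycles_eq : G.zeroCycles = zc G.colorPerm G.zeroPerm := by
  refine Finset.sum_congr rfl fun d _ => ?_
  rw [colorPerm_inv_mul_zeroPerm, numCycles_comm, numCycles_eq]

theorem bub_colorPerm : bub G.colorPerm = G.whiteReach (G.sub {c | c ≠ 0}) :=
  G.bub_whitePerm Fin.succ range_succ 0

theorem bub_iff {x y : G.Whites} : bub G.colorPerm x y ↔ G.bubbleOf x = G.bubbleOf y := by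
  rw [bub_colorPerm, SimpleGraph.ConnectedComponent.eq]; rfl

theorem card_bubble : Nat.card G.Bubble = classes (bub G.colorPerm) := by
  rw [bub_colorPerm]
  exact G.card_connectedComponent_sub (c := 1) (by simp)

theorem conn_zeroPerm : conn G.colorPerm G.zeroPerm = G.whiteReach (G.sub Set.univ) := by
  classical
  refine le_antisymm (conn_le_iff.2 ⟨fun a b x => ?_, fun x => ?_⟩) fun x y h => ?_
  · rw [← Equiv.Perm.mul_apply]
    rw [show (G.colorPerm a)⁻¹ * G.colorPerm b = _ from G.whitePerm_inv_mul _ _ _]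
    exact G.reachable_whitePerm (Set.mem_univ _) (Set.mem_univ _) x
  · rw [← Equiv.Perm.mul_apply, colorPerm_inv_mul_zeroPerm]
    exact G.reachable_whitePerm (Set.mem_univ _) (Set.mem_univ _) x
  · have := SimpleGraph.rel_of_reachable (r := conn G.colorPerm G.zeroPerm)
      (f := G.whiteEnd 1) (fun v w => G.rel_whiteEnd_of_adj fun d hd x => ?_) h
    · rwa [G.whiteEnd_coe, G.whiteEnd_coe] at this
    · cases d using Fin.cases with
      | zero =>
        have := conn_step G.colorPerm G.zeroPerm 0 x
        rwa [colorPerm_zero] at this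
      | succ d =>
        have := bub_le_conn G.colorPerm G.zeroPerm (bub_step G.colorPerm 0 d x)
        rwa [colorPerm_zero] at this

theorem isConnected_iff : G.IsConnected ↔ classes (conn G.colorPerm G.zeroPerm) = 1 := by
  rw [conn_zeroPerm, ← G.card_connectedComponent_sub (Set.mem_univ 0)]
  exact SimpleGraph.connected_iff_card _

theorem numCycles_succ [Fintype G.Bubble] (a b : Fin 3) :
    G.numCycles a.succ b.succ = ∑ i, (G.bubbleGraph i).numCycles a b :=
  G.numCycles_fiber G.bubbleOf (G.bubbleOf_nbr_succ a) (G.bubbleOf_nbr_succ b)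
    G.bubbleGraph (fun _ _ => rfl) fun _ _ => rfl

end Gluing

section Repair

variable (G : ColoredGraph (Fin 4) V) (P : ∀ b : G.Bubble, Pairing (G.bubbleGraph b))

theorem partner_coe {b : G.Bubble} (v : {v // G.bubbleOf v = b}) :
    G.partner P v = (P b).pair v := by
  obtain ⟨v, rfl⟩ := v
  rfl

theorem bubbleOf_partner (v : V) : G.bubbleOf (G.partner P v) = G.bubbleOf v :=
  ((P (G.bubbleOf v)).pair ⟨v, rfl⟩).2

/-- `G` with the edges of color `0` replaced by the pairs of the given pairings of the bubbles: the
disjoint union of the one-bubble graphs. -/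
abbrev repair : ColoredGraph (Fin 4) V where
  white := G.white
  nbr c := Fin.cases (G.partner P) (fun d => G.nbr d.succ) c
  nbr_nbr c v := by
    cases c using Fin.cases with
    | zero =>
      change G.partner P (G.partner P v) = v
      exact (G.partner_coe P _).trans (congrArg Subtype.val ((P (G.bubbleOf v)).pair_pair ⟨v, rfl⟩))
    | succ d => exact G.nbr_nbr _ v
  white_nbr c v := by
    cases c using Fin.cases with
    | zero => exact (P (G.bubbleOf v)).white_pair ⟨v, rfl⟩
    | succ d => exact G.white_nbr _ v

/-- The partners of the vertices along the edges given by a permutation of the white vertices. -/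
noncomputable def zeroNbr (ρ : Equiv.Perm G.Whites) (v : V) : V :=
  if h : G.white v = true then G.nbr 1 (ρ ⟨v, h⟩)
  else ρ⁻¹ ⟨G.nbr 1 v, G.white_nbr_eq_true 1 (by simpa using h)⟩

theorem zeroNbr_coe (ρ : Equiv.Perm G.Whites) (x : G.Whites) : G.zeroNbr ρ x = G.nbr 1 (ρ x) :=
  dif_pos x.2

theorem zeroNbr_nbr (ρ : Equiv.Perm G.Whites) (x : G.Whites) :
    G.zeroNbr ρ (G.nbr 1 (ρ x)) = x := by
  rw [zeroNbr, dif_neg (by simp [G.white_nbr, (ρ x).2])]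
  simp [G.nbr_nbr]

theorem exists_eq_nbr (ρ : Equiv.Perm G.Whites) (v : V) :
    ∃ x : G.Whites, v = x ∨ v = G.nbr 1 (ρ x) := by
  cases h : G.white v
  · refine ⟨ρ⁻¹ ⟨_, G.white_nbr_eq_true 1 h⟩, Or.inr ?_⟩
    simp [G.nbr_nbr]
  · exact ⟨⟨v, h⟩, Or.inl rfl⟩

/-- `G` with the edges of color `0` replaced by those of a permutation of the white vertices. -/
noncomputable abbrev withZero (ρ : Equiv.Perm G.Whites) : ColoredGraph (Fin 4) V where
  white := G.white
  nbr c := Fin.cases (G.zeroNbr ρ) (fun d => G.nbr d.succ) c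
  nbr_nbr c v := by
    cases c using Fin.cases with
    | zero =>
      change G.zeroNbr ρ (G.zeroNbr ρ v) = v
      obtain ⟨x, rfl | rfl⟩ := G.exists_eq_nbr ρ v
      · rw [zeroNbr_coe, zeroNbr_nbr]
      · rw [zeroNbr_nbr, zeroNbr_coe]
    | succ d => exact G.nbr_nbr _ v
  white_nbr c v := by
    cases c using Fin.cases with
    | zero =>
      change G.white (G.zeroNbr ρ v) = _
      obtain ⟨x, rfl | rfl⟩ := G.exists_eq_nbr ρ v
      · rw [zeroNbr_coe, G.white_nbr, (ρ x).2, x.2]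
      · rw [zeroNbr_nbr, G.white_nbr, (ρ x).2, x.2]; rfl
    | succ d => exact G.white_nbr _ v

theorem withZero_nbr_zero (ρ : Equiv.Perm G.Whites) (x : G.Whites) :
    (G.withZero ρ).nbr 0 x = G.nbr 1 (ρ x) :=
  G.zeroNbr_coe ρ x

theorem zeroPerm_withZero (ρ : Equiv.Perm G.Whites) : (G.withZero ρ).zeroPerm = ρ := by
  ext x
  change (G.withZero ρ).nbr 1 ((G.withZero ρ).nbr 0 x) = _
  rw [withZero_nbr_zero]
  exact G.nbr_nbr 1 _

variable [Finite V]

theorem preserves_iff {ρ : Equiv.Perm G.Whites} :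
    Preserves G.colorPerm ρ ↔ ∀ x : G.Whites, G.bubbleOf x = G.bubbleOf (ρ x) := by
  simp only [Preserves, bub_iff, colorPerm_zero, inv_one, Equiv.Perm.one_apply]

theorem preserves_repair : Preserves G.colorPerm (G.repair P).zeroPerm := by
  rw [preserves_iff]
  intro x
  change _ = G.bubbleOf (G.nbr 1 (G.partner P x))
  rw [← G.bubbleOf_partner P]
  exact (G.bubbleOf_nbr_succ 0 _).symm

/-- The permutations which stay within the bubbles are the families of pairings of the bubbles. -/
theorem exists_zeroPerm_repair {ρ : Equiv.Perm G.Whites} (hρ : Preserves G.colorPerm ρ) :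
    ∃ P : ∀ b : G.Bubble, Pairing (G.bubbleGraph b), (G.repair P).zeroPerm = ρ := by
  rw [preserves_iff] at hρ
  have key : ∀ v, G.bubbleOf ((G.withZero ρ).nbr 0 v) = G.bubbleOf v := by
    have key1 : ∀ x : G.Whites, G.bubbleOf ((G.withZero ρ).nbr 0 x) = G.bubbleOf x := fun x => by
      rw [withZero_nbr_zero, hρ x]
      exact G.bubbleOf_nbr_succ 0 _
    intro v
    cases h : G.white v
    · have := key1 ⟨_, (G.withZero ρ).white_nbr_eq_true 0 h⟩
      rw [(G.withZero ρ).nbr_nbr] at this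
      exact this.symm
    · exact key1 ⟨v, h⟩
  refine ⟨fun b => ⟨fun v => ⟨(G.withZero ρ).nbr 0 v, (key v).trans v.2⟩,
    fun v => Subtype.ext ((G.withZero ρ).nbr_nbr 0 v), fun v => (G.withZero ρ).white_nbr 0 v⟩, ?_⟩
  exact G.zeroPerm_withZero ρ

theorem zc_repair [Fintype G.Bubble] :
    zc G.colorPerm (G.repair P).zeroPerm = ∑ b, (P b).graph.zeroCycles := by
  have h : zc G.colorPerm (G.repair P).zeroPerm = (G.repair P).zeroCycles :=
    (zeroCycles_eq (G.repair P)).symm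
  rw [h]
  unfold zeroCycles
  rw [Finset.sum_comm]
  refine Finset.sum_congr rfl fun a _ => ?_
  exact (G.repair P).numCycles_fiber (a := 0) (b := a.succ) G.bubbleOf (G.bubbleOf_partner P)
    (G.bubbleOf_nbr_succ a) (fun b => (P b).graph) (fun b v => (G.partner_coe P v).symm)
    fun _ _ => rfl

theorem zc_repair_eq_iff [Fintype G.Bubble] :
    zc G.colorPerm (G.repair P).zeroPerm = ∑ b, (G.bubbleGraph b).oneMax ↔ ∀ b, (P b).IsMax := by
  rw [zc_repair, Finset.sum_eq_sum_iff_of_le fun b _ => (P b).zeroCycles_le]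
  simp [Pairing.isMax_iff]

theorem zc_le_sum_oneMax [Fintype G.Bubble] {ρ : Equiv.Perm G.Whites}
    (hρ : Preserves G.colorPerm ρ) : zc G.colorPerm ρ ≤ ∑ b, (G.bubbleGraph b).oneMax := by
  obtain ⟨P, rfl⟩ := G.exists_zeroPerm_repair hρ
  rw [zc_repair]
  exact Finset.sum_le_sum fun b _ => (P b).zeroCycles_le

end Repair

end ColoredGraph

/-! ### Euler's formula for planar bubbles -/

namespace ColoredGraph

/-- The orbits of a permutation, counted by an invariant `f` with a section `i`. -/
theorem numOrbits_eq {D : Type u} {γ : Type*} [Finite D] (σ : Equiv.Perm D) (f : D → γ)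
    (i : γ → D) (hf : ∀ d, f (σ d) = f d) (hi : ∀ g, f (i g) = g)
    (hr : ∀ d, cyc σ (i (f d)) d) : numOrbits σ = Nat.card γ := by
  have hle : cyc σ ≤ Setoid.ker f := cyc_le_iff.2 fun d => (hf d).symm
  refine Nat.card_congr (Equiv.ofBijective
    (Quotient.lift (s := cyc σ) f fun x y h => hle h) ⟨?_, fun g => ⟨Quotient.mk _ (i g), hi g⟩⟩)
  intro p q
  induction p using Quotient.inductionOn with | h x => ?_
  induction q using Quotient.inductionOn with | h y => ?_
  intro h
  have h' : f x = f y := h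
  exact Quotient.sound ((cyc σ).trans ((cyc σ).symm (hr x)) (h' ▸ hr y))

variable {V : Type u} [Finite V] (B : ColoredGraph (Fin 3) V)

theorem numOrbits_rotation : numOrbits B.rotation = Nat.card V := by
  refine numOrbits_eq _ Prod.fst (fun v => (v, 0)) (fun _ => rfl) (fun _ => rfl) ?_
  have key : ∀ v c, cyc B.rotation (v, c) (v, c + 1) := by
    intro v c
    cases h : B.white v
    · refine (cyc B.rotation).symm ?_
      have := cyc_apply B.rotation (v, c + 1)
      simpa [rotation, h] using this
    · have := cyc_apply B.rotation (v, c)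
      simpa [rotation, h] using this
  rintro ⟨v, c⟩
  fin_cases c
  · exact (cyc B.rotation).refl _
  · exact key v 0
  · exact (cyc B.rotation).trans (key v 0) (key v 1)

theorem whiteEnd_nbr (c : Fin 3) (v : V) : B.whiteEnd c (B.nbr c v) = B.whiteEnd c v := by
  cases h : B.white v
  · have h1 := B.white_nbr_eq_true c h
    rw [B.whiteEnd_coe c ⟨_, h1⟩]
    exact Subtype.ext (B.coe_whiteEnd_of_false c h).symm
  · rw [B.whiteEnd_coe c ⟨v, h⟩]
    exact Subtype.ext ((B.coe_whiteEnd_nbr c c ⟨v, h⟩).trans (B.nbr_nbr c v))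

theorem numOrbits_edgePerm : numOrbits B.edgePerm = Nat.card B.Whites * 3 := by
  have : numOrbits B.edgePerm = Nat.card (B.Whites × Fin 3) := by
    refine numOrbits_eq _ (fun d => (B.whiteEnd d.2 d.1, d.2)) (fun g => (g.1, g.2))
      (fun d => ?_) (fun g => ?_) ?_
    · exact congrArg (·, d.2) (B.whiteEnd_nbr d.2 d.1)
    · exact congrArg (·, g.2) (B.whiteEnd_coe g.2 g.1)
    · rintro ⟨v, c⟩
      cases h : B.white v
      · have := cyc_apply B.edgePerm (v, c)
        simp only [B.coe_whiteEnd_of_false c h]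
        exact (cyc _).symm this
      · rw [B.whiteEnd_coe c ⟨v, h⟩]
  rw [this, Nat.card_prod, Nat.card_fin]

theorem facePerm_white (a : Fin 3) (x : B.Whites) :
    (B.rotation * B.edgePerm) (x, a) = (B.nbr a x, a - 1) := by
  simp [rotation, edgePerm, B.white_nbr, x.2]

theorem facePerm_black (a : Fin 3) {v : V} (h : B.white v = false) :
    (B.rotation * B.edgePerm) (v, a) = (B.nbr a v, a + 1) := by
  simp [rotation, edgePerm, B.white_nbr, h]

/-- The faces of the canonical embedding are the bicolored cycles: at a white vertex, the face
which is left along the color `a + 1` alternates the colors `a + 1` and `a`. -/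
theorem numOrbits_facePerm :
    numOrbits (B.rotation * B.edgePerm) = ∑ a, B.numCycles a (a + 1) := by
  have hs : ∀ {a b : Fin 3} {x y : B.Whites}, a = b → cyc (B.whitePerm b (b + 1)) x y →
      (⟨a, Quotient.mk _ x⟩ : Σ a, Quotient (cyc (B.whitePerm a (a + 1)))) =
        ⟨b, Quotient.mk _ y⟩ := by
    rintro a _ x y rfl h
    exact congrArg (Sigma.mk a) (Quotient.sound h)
  have hstep : ∀ (a : Fin 3) {x y : B.Whites}, cyc (B.whitePerm a (a + 1)) x y →
      cyc (B.rotation * B.edgePerm) (x, a + 1) (y, a + 1) := by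
    intro a x y h
    have hle : cyc (B.whitePerm a (a + 1)) ≤
        (cyc (B.rotation * B.edgePerm)).comap (fun x : B.Whites => ((x : V), a + 1)) := by
      refine cyc_le_iff.2 fun x => ?_
      have h1 := cyc_apply (B.rotation * B.edgePerm) (x, a + 1)
      have h2 := cyc_apply (B.rotation * B.edgePerm) (B.nbr (a + 1) x, a)
      rw [facePerm_white, add_sub_cancel_right] at h1
      rw [B.facePerm_black a (B.white_nbr_eq_false _ x)] at h2
      exact (cyc _).trans h1 h2
    exact hle h
  simp only [numCycles_eq]
  rw [show ∑ a, classes (cyc (B.whitePerm a (a + 1))) = _ from Nat.card_sigma.symm]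
  refine numOrbits_eq _ (fun d => ⟨if B.white d.1 then d.2 - 1 else d.2,
    Quotient.mk _ (B.whiteEnd d.2 d.1)⟩) (fun g => (g.2.out.1, g.1 + 1)) ?_ ?_ ?_
  · rintro ⟨v, c⟩
    cases h : B.white v
    · rw [facePerm_black B c h]
      obtain ⟨x, rfl⟩ : ∃ x : B.Whites, B.nbr c x = v :=
        ⟨⟨_, B.white_nbr_eq_true c h⟩, B.nbr_nbr c v⟩
      refine hs (by simp [B.nbr_nbr, x.2]) ?_
      simp only [B.nbr_nbr, whiteEnd_coe, whiteEnd_nbr]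
      exact (cyc _).refl _
    · rw [facePerm_white B c ⟨v, h⟩]
      obtain ⟨a, rfl⟩ : ∃ a, c = a + 1 := ⟨c - 1, by simp⟩
      have hw : B.whiteEnd a (B.nbr (a + 1) v) = B.whitePerm a (a + 1) ⟨v, h⟩ :=
        Subtype.ext (B.coe_whiteEnd_nbr a (a + 1) ⟨v, h⟩)
      refine (hs (b := a) (y := ⟨v, h⟩) ?_ ?_).trans (hs (b := a) ?_ ?_).symm
      · simp [B.white_nbr, h]
      · simp only [add_sub_cancel_right, hw]
        exact (cyc _).symm (cyc_apply _ _)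
      · simp
      · rw [B.whiteEnd_coe (a + 1) ⟨v, h⟩]
  · rintro ⟨a, q⟩
    refine (hs (b := a) (y := q.out) ?_ ?_).trans (congrArg (Sigma.mk a) q.out_eq)
    · rw [if_pos q.out.2, add_sub_cancel_right]
    · rw [whiteEnd_coe]
  · rintro ⟨v, c⟩
    have hout : ∀ (a : Fin 3) (x : B.Whites), cyc (B.rotation * B.edgePerm)
        ((Quotient.mk (cyc (B.whitePerm a (a + 1))) x).out, a + 1) (x, a + 1) := fun a x =>
      hstep a (Quotient.mk_out (s := cyc (B.whitePerm a (a + 1))) x)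
    cases h : B.white v
    · have h1 := hout c (B.whiteEnd c v)
      have h2 := cyc_apply (B.rotation * B.edgePerm) (v, c)
      rw [facePerm_black B c h] at h2
      rw [B.coe_whiteEnd_of_false c h] at h1
      simp only [Bool.false_eq_true, if_false]
      exact (cyc _).trans h1 ((cyc _).symm h2)
    · obtain ⟨a, rfl⟩ : ∃ a, c = a + 1 := ⟨c - 1, by simp⟩
      have h1 := hout a (B.whiteEnd (a + 1) v)
      rw [B.whiteEnd_coe (a + 1) ⟨v, h⟩] at h1
      simp only [if_true]
      rw [B.whiteEnd_coe (a + 1) ⟨v, h⟩]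
      rw [show a + 1 - 1 = a by simp]
      exact h1

/-- A connected graph with three colors whose bicolored cycles satisfy Euler's formula of the
sphere. In contrast to `IsPlanar`, this is expressed by numbers which are evidently invariant under
isomorphisms. -/
def IsSpherical {V : Type u} (B : ColoredGraph (Fin 3) V) : Prop :=
  B.IsConnected ∧ 2 * ∑ a, B.numCycles a (a + 1) = Nat.card V + 4

variable {B} in
theorem IsPlanar.isSpherical (h : B.IsPlanar) : B.IsSpherical := by
  have h1 := h.2
  refine ⟨h.1, ?_⟩
  rw [numOrbits_rotation, numOrbits_edgePerm, numOrbits_facePerm, card_whites B] at h1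
  rw [card_whites B]
  omega

theorem Isomorphic.isSpherical {V W : Type u} {G : ColoredGraph (Fin 3) V}
    {H : ColoredGraph (Fin 3) W} (h : G.Isomorphic H) (hG : G.IsSpherical) : H.IsSpherical := by
  have hc := h.numCycles_eq
  obtain ⟨f, -, hf⟩ := h
  have e : G.sub Set.univ ≃g H.sub Set.univ :=
    { toEquiv := f
      map_rel_iff' := by
        intro v w
        refine exists_congr fun c => and_congr_right fun _ => ?_
        rw [hf, f.injective.eq_iff] }
  refine ⟨e.connected_iff.1 hG.1, ?_⟩
  simp only [← hc, ← Nat.card_congr f]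
  exact hG.2

end ColoredGraph

/-! ### The planar part of a colored graph -/

namespace ColoredGraph

section Flatten

variable {V : Type u} (G : ColoredGraph (Fin 4) V) (m : G.Bubble)

open Classical in
/-- The bubbles of `G`, with the marked bubble `m` replaced by bubbles with two vertices, one for
each edge of color `1`. -/
noncomputable abbrev flatten : ColoredGraph (Fin 3) V where
  white := G.white
  nbr d v := if G.bubbleOf v = m then G.nbr 1 v else G.nbr d.succ v
  nbr_nbr d v := by
    have h1 := G.bubbleOf_nbr_succ 0 v
    have h2 := G.bubbleOf_nbr_succ d v
    rw [show (Fin.succ 0 : Fin 4) = 1 from rfl] at h1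
    by_cases h : G.bubbleOf v = m
    · simp only [if_pos h, h1, G.nbr_nbr]
    · simp only [if_neg h, h2, G.nbr_nbr]
  white_nbr d v := by
    split_ifs
    · exact G.white_nbr 1 v
    · exact G.white_nbr d.succ v

theorem flatten_nbr_of_eq {v : V} (h : G.bubbleOf v = m) (d : Fin 3) :
    (G.flatten m).nbr d v = G.nbr 1 v := if_pos h

theorem flatten_nbr_of_ne {v : V} (h : G.bubbleOf v ≠ m) (d : Fin 3) :
    (G.flatten m).nbr d v = G.nbr d.succ v := if_neg h

theorem flatten_nbr_zero (v : V) : (G.flatten m).nbr 0 v = G.nbr 1 v := by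
  by_cases h : G.bubbleOf v = m
  · exact G.flatten_nbr_of_eq m h 0
  · exact G.flatten_nbr_of_ne m h 0

theorem bubbleOf_flatten_nbr (d : Fin 3) (v : V) :
    G.bubbleOf ((G.flatten m).nbr d v) = G.bubbleOf v := by
  by_cases h : G.bubbleOf v = m
  · rw [G.flatten_nbr_of_eq m h]
    exact G.bubbleOf_nbr_succ 0 v
  · rw [G.flatten_nbr_of_ne m h]
    exact G.bubbleOf_nbr_succ d v

/-- The part of the flattened graph on the vertices of a bubble of `G`. -/
noncomputable def flattenBubble (b : G.Bubble) :
    ColoredGraph (Fin 3) {v : V // G.bubbleOf v = b} where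
  white v := G.white v
  nbr d v := ⟨(G.flatten m).nbr d v, (G.bubbleOf_flatten_nbr m d v).trans v.2⟩
  nbr_nbr d v := Subtype.ext ((G.flatten m).nbr_nbr d v)
  white_nbr d v := (G.flatten m).white_nbr d v

theorem flattenBubble_of_ne {b : G.Bubble} (hb : b ≠ m) :
    G.flattenBubble m b = G.bubbleGraph b := by
  have h : (fun (d : Fin 3) (v : {v : V // G.bubbleOf v = b}) =>
      (⟨(G.flatten m).nbr d v, (G.bubbleOf_flatten_nbr m d v).trans v.2⟩ :
        {v : V // G.bubbleOf v = b})) = (G.bubbleGraph b).nbr := by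
    funext d v
    exact Subtype.ext (G.flatten_nbr_of_ne m (fun e => hb (v.2.symm.trans e)) d)
  unfold flattenBubble
  congr 1

/-- Euler's formula for a graph all of whose components have two vertices. -/
theorem euler_of_nbr_eq [Finite V] (K : ColoredGraph (Fin 3) V)
    (h : ∀ a v, K.nbr a v = K.nbr 0 v) :
    Nat.card V + 4 * Nat.card (K.sub Set.univ).ConnectedComponent =
      2 * ∑ a, K.numCycles a (a + 1) := by
  have h1 : ∀ a b, K.numCycles a b = Nat.card K.Whites := by
    intro a b
    have : K.whitePerm a b = 1 := by
      ext x
      rw [coe_whitePerm, h b, h a, K.nbr_nbr]; rfl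
    rw [numCycles_eq, this, classes_cyc_one]
  have h2 : K.sub Set.univ = K.sub {0, 0} := by
    ext v w
    simp only [sub, Set.mem_univ, true_and, Set.pair_eq_singleton, Set.mem_singleton_iff,
      exists_eq_left]
    exact ⟨fun ⟨a, ha⟩ => (h a v) ▸ ha, fun h => ⟨0, h⟩⟩
  have h3 : Nat.card (K.sub Set.univ).ConnectedComponent = Nat.card K.Whites := by
    rw [h2]; exact h1 0 0
  rw [h3, K.card_whites]
  simp only [h1, Finset.sum_const, Finset.card_univ, Fintype.card_fin, smul_eq_mul]
  ring

theorem euler_flatten [Finite V] (hG : ∀ b ≠ m, (G.bubbleGraph b).IsSpherical) :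
    Nat.card V + 4 * Nat.card ((G.flatten m).sub Set.univ).ConnectedComponent =
      2 * ∑ a, (G.flatten m).numCycles a (a + 1) := by
  have := Fintype.ofFinite G.Bubble
  have h1 : Nat.card V = ∑ b, Nat.card {v // G.bubbleOf v = b} := by
    rw [← Nat.card_sigma, Nat.card_congr (Equiv.sigmaFiberEquiv G.bubbleOf)]
  have h2 : Nat.card ((G.flatten m).sub Set.univ).ConnectedComponent =
      ∑ b, Nat.card ((G.flattenBubble m b).sub Set.univ).ConnectedComponent := by
    refine SimpleGraph.card_connectedComponent_fiber _ G.bubbleOf ?_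
      (fun b => (G.flattenBubble m b).sub Set.univ) ?_
    · rintro v _ ⟨c, -, rfl⟩
      exact (G.bubbleOf_flatten_nbr m c v).symm
    · intro b v w
      exact exists_congr fun c => and_congr_right fun _ => Subtype.ext_iff
  have h3 : ∀ a, (G.flatten m).numCycles a (a + 1) =
      ∑ b, (G.flattenBubble m b).numCycles a (a + 1) := fun a =>
    numCycles_fiber _ G.bubbleOf (G.bubbleOf_flatten_nbr m _) (G.bubbleOf_flatten_nbr m _)
      (G.flattenBubble m) (fun _ _ => rfl) fun _ _ => rfl
  simp only [h1, h2, h3]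
  rw [Finset.sum_comm, Finset.mul_sum, Finset.mul_sum, ← Finset.sum_add_distrib]
  refine Finset.sum_congr rfl fun b _ => ?_
  by_cases hb : b = m
  · refine euler_of_nbr_eq _ fun a v => Subtype.ext ?_
    have hv := v.2.trans hb
    exact (G.flatten_nbr_of_eq m hv a).trans (G.flatten_nbr_of_eq m hv 0).symm
  · rw [G.flattenBubble_of_ne m hb, (hG b hb).2,
      (SimpleGraph.connected_iff_card _).1 (hG b hb).1, mul_one]

/-- If all bubbles but `m` are spherical, the hypotheses of `PlanarOff.exists_treeLike` hold. -/
theorem planarOff [Finite V] (hG : ∀ b ≠ m, (G.bubbleGraph b).IsSpherical) :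
    PlanarOff {x : G.Whites | G.bubbleOf x = m} G.colorPerm (G.flatten m |>.whitePerm 0) where
  eq_off x hx d := by
    have hx' : G.bubbleOf x ≠ m := hx
    refine Subtype.ext ?_
    rw [coe_whitePerm, flatten_nbr_zero, G.flatten_nbr_of_ne m hx']
    rfl
  trivial x hx a b := by
    have hx' : G.bubbleOf x = m := hx
    refine Subtype.ext ?_
    rw [coe_whitePerm, coe_whitePerm, flatten_nbr_zero, flatten_nbr_zero,
      G.flatten_nbr_of_eq m hx', G.flatten_nbr_of_eq m hx']
  connected τ' hτ' x hx y hy := by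
    classical
    let r : Setoid G.Whites :=
      { r := fun z w => (G.bubbleOf z = G.bubbleOf w) ∧ (G.bubbleOf z = m → bub τ' z w)
        iseqv :=
          { refl := fun z => ⟨rfl, fun _ => (bub τ').refl z⟩
            symm := fun h => ⟨h.1.symm, fun k => (bub τ').symm (h.2 (h.1.trans k))⟩
            trans := fun h k => ⟨h.1.trans k.1, fun e =>
              (bub τ').trans (h.2 e) (k.2 (h.1.symm.trans e))⟩ } }
    have hle : bub G.colorPerm ≤ r := by
      refine bub_le_iff.2 fun a b z => ?_
      obtain ⟨w, hw⟩ : ∃ w, w = (G.colorPerm a)⁻¹ (G.colorPerm b z) := ⟨_, rfl⟩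
      have hzw : G.colorPerm a w = G.colorPerm b z := by rw [hw, apply_inv_self']
      have hbub := G.bub_iff.1 (bub_of_eq hzw)
      rw [← hw]
      refine ⟨hbub.symm, fun k => (bub τ').symm (bub_of_eq (a := a) (b := b) ?_)⟩
      rw [hτ' w (hbub.trans k), hτ' z k, hzw]
    have hxy : bub G.colorPerm x y :=
      G.bub_iff.2 ((show G.bubbleOf x = m from hx).trans (show G.bubbleOf y = m from hy).symm)
    exact (hle hxy).2 hx
  euler := by
    have h1 := G.euler_flatten m hG
    have h2 : bub ((G.flatten m).whitePerm 0) = _ :=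
      (G.flatten m).bub_whitePerm id (Set.range_id) 0
    have h3 := (G.flatten m).card_connectedComponent_sub (Set.mem_univ 0)
    have h4 : faces ((G.flatten m).whitePerm 0) = ∑ a, (G.flatten m).numCycles a (a + 1) := by
      refine Finset.sum_congr rfl fun a _ => ?_
      rw [whitePerm_inv_mul, numCycles_eq]
    rw [card_whites G, h3] at h1
    rw [h2, h4]
    have h5 : Nat.card G.Whites = Nat.card (G.flatten m).Whites := rfl
    omega

end Flatten

end ColoredGraph

/-! ### Edge-cuts of color 0 -/

namespace PermGluing

/-- If all but one of the steps of a permutation stay in a class of `r`, then so does this one,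
since the other steps lead around its cycle. -/
theorem rel_apply_of_forall_ne {α : Type*} [Finite α] {r : Setoid α} {σ : Equiv.Perm α} {y : α}
    (h : ∀ z, z ≠ y → r z (σ z)) (z : α) : r z (σ z) := by
  by_cases hz : z = y
  · subst hz
    have key : ∀ n : ℕ, r (σ z) ((σ ^ (n + 1)) z) ∨ r (σ z) z := by
      intro n
      induction n with
      | zero => exact Or.inl (r.refl _)
      | succ n ih =>
        rcases ih with ih | ih
        · by_cases hy : (σ ^ (n + 1)) z = z
          · right; rwa [hy] at ih
          · left
            rw [pow_succ', Equiv.Perm.mul_apply]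
            exact r.trans ih (h _ hy)
        · exact Or.inr ih
    have ho : (σ ^ ((orderOf σ - 1) + 1)) z = z := by
      rw [Nat.sub_add_cancel (orderOf_pos σ), pow_orderOf_eq_one]; rfl
    rcases key (orderOf σ - 1) with k | k
    · rw [ho] at k; exact r.symm k
    · exact r.symm k
  · exact h z hz

end PermGluing

namespace ColoredGraph

variable {V : Type u} (G : ColoredGraph (Fin 4) V)

theorem zeroEdge_nbr (v : V) : G.zeroEdge (G.nbr 0 v) = G.zeroEdge v := by
  simp [zeroEdge, G.nbr_nbr, Sym2.eq_swap]

theorem zeroEdge_inj {x y : G.Whites} (h : G.zeroEdge x = G.zeroEdge y) : x = y := by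
  rcases Sym2.eq_iff.1 h with ⟨h, -⟩ | ⟨h, -⟩
  · exact Subtype.ext h
  · have h1 := x.2
    rw [h, G.white_nbr_eq_false] at h1
    exact absurd h1 (by decide)

theorem deleteZero_reachable_succ (S : Set (Sym2 V)) (d : Fin 3) (v : V) :
    (G.deleteZero S).Reachable v (G.nbr d.succ v) :=
  SimpleGraph.Adj.reachable ⟨d.succ, rfl, fun h => absurd h (Fin.succ_ne_zero d)⟩

variable [Finite V]

theorem bub_le_deleteZero (S : Set (Sym2 V)) :
    bub G.colorPerm ≤ G.whiteReach (G.deleteZero S) := by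
  classical
  refine bub_le_iff.2 fun a b x => ?_
  rw [← Equiv.Perm.mul_apply,
    show (G.colorPerm a)⁻¹ * G.colorPerm b = _ from G.whitePerm_inv_mul _ _ _]
  exact (G.deleteZero_reachable_succ S b x).trans (G.deleteZero_reachable_succ S a _)

theorem deleteZero_zeroPerm {S : Set (Sym2 V)} {x : G.Whites} (hx : G.zeroEdge x ∉ S) :
    G.whiteReach (G.deleteZero S) x (G.zeroPerm x) :=
  (SimpleGraph.Adj.reachable (G := G.deleteZero S) ⟨0, rfl, fun _ => hx⟩).trans
    (G.deleteZero_reachable_succ S 0 _)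

/-- Removing edges of color `0` keeps `G` connected if the bubbles and a permutation of the white
vertices, which only uses the remaining edges and steps within the bubbles, connect it. The step
at one vertex `y` need not be checked. -/
theorem deleteZero_connected {S : Set (Sym2 V)} {σ : Equiv.Perm G.Whites}
    (hσ : classes (conn G.colorPerm σ) = 1) (y : G.Whites)
    (h : ∀ x, x ≠ y → G.whiteReach (G.deleteZero S) x (σ x)) : (G.deleteZero S).Connected := by
  have hle : conn G.colorPerm σ ≤ G.whiteReach (G.deleteZero S) := by
    refine sup_le (G.bub_le_deleteZero S) (cyc_le_iff.2 fun x => ?_)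
    rw [colorPerm_zero, inv_one, one_mul]
    exact rel_apply_of_forall_ne h x
  have hr : ∀ x y, G.whiteReach (G.deleteZero S) x y := by
    intro x y
    have := (Nat.card_eq_one_iff_unique.1 hσ).1
    exact hle (Quotient.exact (Subsingleton.elim (Quotient.mk (conn G.colorPerm σ) x) ⟦y⟧))
  have hw : ∀ v, (G.deleteZero S).Reachable (G.whiteEnd 1 v) v := by
    intro v
    cases h : G.white v
    · rw [G.coe_whiteEnd_of_false 1 h]
      exact (G.deleteZero_reachable_succ S 0 v).symm
    · rw [G.whiteEnd_coe 1 ⟨v, h⟩]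
  exact { preconnected := fun v w => (hw v).symm.trans ((hr _ _).trans (hw w))
          nonempty := ⟨y⟩ }

theorem conn_of_deleteZero {S : Set (Sym2 V)} {σ : Equiv.Perm G.Whites}
    (h : ∀ x : G.Whites, G.zeroEdge x ∉ S → σ x = G.zeroPerm x) {x y : G.Whites}
    (hxy : (G.deleteZero S).Reachable x y) : conn G.colorPerm σ x y := by
  classical
  have hstep : ∀ (x : G.Whites) c, (c = 0 → G.zeroEdge x ∉ S) →
      conn G.colorPerm σ x (G.whitePerm 1 c x) := by
    intro x c hc
    cases c using Fin.cases with
    | zero =>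
      have := conn_step G.colorPerm σ 0 x
      rwa [colorPerm_zero, h x (hc rfl)] at this
    | succ d =>
      have := bub_le_conn G.colorPerm σ (bub_step G.colorPerm 0 d x)
      rwa [colorPerm_zero] at this
  have hcoe : ∀ (x : G.Whites) c, G.whiteEnd 1 (G.nbr c x) = G.whitePerm 1 c x := fun x c =>
    Subtype.ext (G.coe_whiteEnd_nbr 1 c x)
  have := SimpleGraph.rel_of_reachable (r := conn G.colorPerm σ) (f := G.whiteEnd 1) ?_ hxy
  · rwa [G.whiteEnd_coe, G.whiteEnd_coe] at this
  · rintro v _ ⟨c, rfl, hc⟩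
    cases hv : G.white v
    · obtain ⟨x, rfl⟩ : ∃ x : G.Whites, G.nbr c x = v :=
        ⟨⟨_, G.white_nbr_eq_true c hv⟩, G.nbr_nbr c v⟩
      rw [G.nbr_nbr, hcoe, whiteEnd_coe]
      refine (conn _ _).symm (hstep x c ?_)
      rintro rfl
      rw [← zeroEdge_nbr]
      exact hc rfl
    · have h1 := hcoe ⟨v, hv⟩ c
      simp only at h1
      rw [h1, G.whiteEnd_coe 1 ⟨v, hv⟩]
      exact hstep ⟨v, hv⟩ c hc

/-- The edges of color `0` at two vertices of a chain which follow each other form a 2-edge-cut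
if and only if reconnecting them disconnects the graph. -/
theorem isZeroEdgeCut_iff [DecidableEq G.Whites] (hG : G.IsConnected) {x y : G.Whites}
    (hxy : x ≠ y) (hb : bub G.colorPerm x (G.zeroPerm y)) :
    G.IsZeroEdgeCut {G.zeroEdge x, G.zeroEdge y} ↔
      ¬ conn G.colorPerm (G.zeroPerm * Equiv.swap y x) y x := by
  rw [isConnected_iff] at hG
  have hsingle : ∀ (T : Set (Sym2 V)) (z : G.Whites), T ⊆ {G.zeroEdge z} →
      (G.deleteZero T).Connected := by
    intro T z hT
    refine G.deleteZero_connected hG z fun x hx => G.deleteZero_zeroPerm fun k => hx ?_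
    exact G.zeroEdge_inj (hT k)
  constructor
  · rintro ⟨-, h, -⟩ hk
    refine h (G.deleteZero_connected (σ := G.zeroPerm * Equiv.swap y x) ?_ y fun z hz => ?_)
    · have h1 : conn G.colorPerm G.zeroPerm y x := by
        have := (Nat.card_eq_one_iff_unique.1 hG).1
        exact Quotient.exact (Subsingleton.elim (Quotient.mk (conn _ _) y) ⟦x⟧)
      rwa [← classes_conn_eq h1 hk] at hG
    · by_cases hzx : z = x
      · subst hzx
        rw [Equiv.Perm.mul_apply, Equiv.swap_apply_right]
        exact G.bub_le_deleteZero _ hb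
      · rw [Equiv.Perm.mul_apply, Equiv.swap_apply_of_ne_of_ne hz hzx]
        refine G.deleteZero_zeroPerm ?_
        rintro (k | k)
        · exact hzx (G.zeroEdge_inj k)
        · exact hz (G.zeroEdge_inj k)
  · intro h
    refine ⟨?_, fun hc => h ?_, ?_⟩
    · rintro e (rfl | rfl)
      · exact ⟨_, rfl⟩
      · exact ⟨_, rfl⟩
    · refine G.conn_of_deleteZero ?_ (hc.preconnected y x)
      intro z hz
      rw [Equiv.Perm.mul_apply, Equiv.swap_apply_of_ne_of_ne]
      · rintro rfl; exact hz (Or.inr rfl)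
      · rintro rfl; exact hz (Or.inl rfl)
    · intro T hT
      by_cases hx : G.zeroEdge x ∈ T
      · refine hsingle T x fun e he => ?_
        rcases hT.1 he with k | k
        · exact k
        · refine absurd ?_ hT.2
          rintro e' (rfl | rfl)
          · exact hx
          · exact k ▸ he
      · refine hsingle T y fun e he => ?_
        rcases hT.1 he with rfl | k
        · exact absurd he hx
        · exact k

end ColoredGraph

/-! ### Chains -/

namespace ColoredGraph

variable {V : Type u} (G : ColoredGraph (Fin 4) V)
  (P : ∀ b : G.Bubble, Pairing (G.bubbleGraph b))

theorem partner_partner (v : V) : G.partner P (G.partner P v) = v :=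
  (G.repair P).nbr_nbr 0 v

theorem white_partner (v : V) : G.white (G.partner P v) = !G.white v :=
  (G.repair P).white_nbr 0 v

/-- The step along a chain from one pair to the next one. -/
theorem coe_chain (x : G.Whites) :
    (((G.repair P).zeroPerm⁻¹ * G.zeroPerm) x : V) = G.partner P (G.nbr 0 x) := by
  change G.partner P (G.nbr 1 (G.nbr 1 (G.nbr 0 x))) = _
  rw [G.nbr_nbr]

/-- The closed chains as the bicolored cycles of a graph with two colors. -/
def chain : ColoredGraph Bool V where
  white := G.white
  nbr c := bif c then G.partner P else G.nbr 0
  nbr_nbr c := by cases c; exacts [G.nbr_nbr 0, G.partner_partner P]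
  white_nbr c := by cases c; exacts [G.white_nbr 0, G.white_partner P]

theorem chainGraph_eq : G.chainGraph P = (G.chain P).sub Set.univ := by
  ext v w
  simp only [chainGraph, SimpleGraph.fromRel_adj, sub, Set.mem_univ, true_and, Bool.exists_bool]
  change _ ↔ G.nbr 0 v = w ∨ G.partner P v = w
  constructor
  · rintro ⟨-, (h | h) | h | h⟩
    · exact Or.inl h.symm
    · exact Or.inr h.symm
    · exact Or.inl (by rw [h, G.nbr_nbr])
    · exact Or.inr (by rw [h, partner_partner])
  · rintro (h | h)
    · exact ⟨fun e => G.nbr_ne 0 v (h.trans e.symm), Or.inl (Or.inl h.symm)⟩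
    · refine ⟨fun e => ?_, Or.inl (Or.inr h.symm)⟩
      have := G.white_partner P v
      rw [h, ← e] at this
      cases hv : G.white v <;> simp [hv] at this

variable [Finite V]

theorem cyc_chain : cyc ((G.repair P).zeroPerm⁻¹ * G.zeroPerm) =
    (G.chain P).whiteReach (G.chainGraph P) := by
  have h1 : (G.chain P).whitePerm true false = (G.repair P).zeroPerm⁻¹ * G.zeroPerm := by
    ext x
    exact (G.coe_chain P x).symm
  have h2 : (Set.univ : Set Bool) = {true, false} := by
    ext c; cases c <;> simp
  rw [← h1, chainGraph_eq, h2]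
  exact (G.chain P).cyc_whitePerm true false

theorem card_chains : Nat.card (G.chainGraph P).ConnectedComponent =
    classes (cyc ((G.repair P).zeroPerm⁻¹ * G.zeroPerm)) := by
  rw [cyc_chain, chainGraph_eq]
  exact (G.chain P).card_connectedComponent_sub (Set.mem_univ true)

theorem chainGraph_reachable_partner (v : V) :
    (G.chainGraph P).Reachable v (G.partner P v) := by
  rw [chainGraph_eq]
  exact SimpleGraph.Adj.reachable ((G.chain P).sub_adj_nbr (Set.mem_univ true) v)

theorem chainGraph_reachable_nbr (v : V) : (G.chainGraph P).Reachable v (G.nbr 0 v) := by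
  rw [chainGraph_eq]
  exact SimpleGraph.Adj.reachable ((G.chain P).sub_adj_nbr (Set.mem_univ false) v)

theorem exists_white_partner (v : V) : ∃ x : G.Whites, v = x ∨ v = G.partner P x := by
  cases h : G.white v
  · exact ⟨⟨G.partner P v, by rw [white_partner, h]; rfl⟩,
      Or.inr (G.partner_partner P v).symm⟩
  · exact ⟨⟨v, h⟩, Or.inl rfl⟩

/-- In a connected graph whose pairings are tree-like, the bubbles and the chains form a tree: the
edges of their incidence graph are the pairs, so this is the count of vertices and edges. -/
theorem incidenceGraph_isTree (hG : G.IsConnected)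
    (h : TreeLike G.colorPerm (G.repair P).zeroPerm G.zeroPerm) :
    (∀ v w : V, G.bubbleOf v = G.bubbleOf w → (G.chainGraph P).Reachable v w →
      w = v ∨ w = G.partner P v) ∧ (G.incidenceGraph P).IsTree := by
  classical
  have huniq : ∀ x y : G.Whites, G.bubbleOf x = G.bubbleOf y →
      (G.chainGraph P).Reachable x y → x = y := by
    intro x y hb hc
    refine h.eq_of_bub (G.preserves_repair P) (G.bub_iff.2 hb) ?_
    rw [cyc_chain]
    exact hc
  have hrep : ∀ v : V, ∃ x : G.Whites, (v = x ∨ v = G.partner P x) ∧ G.bubbleOf v = G.bubbleOf x ∧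
      (G.chainGraph P).Reachable v x := by
    intro v
    obtain ⟨x, rfl | rfl⟩ := G.exists_white_partner P v
    · exact ⟨x, Or.inl rfl, rfl, SimpleGraph.Reachable.refl _⟩
    · exact ⟨x, Or.inr rfl, G.bubbleOf_partner P x, (G.chainGraph_reachable_partner P x).symm⟩
  refine ⟨fun v w hb hc => ?_, ?_⟩
  · obtain ⟨x, hx, hxb, hxc⟩ := hrep v
    obtain ⟨y, hy, hyb, hyc⟩ := hrep w
    have hxy := huniq x y (hxb.symm.trans (hb.trans hyb)) (hxc.symm.trans (hc.trans hyc))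
    subst hxy
    rcases hx with rfl | rfl <;> rcases hy with rfl | rfl
    · exact Or.inl rfl
    · exact Or.inr rfl
    · exact Or.inr (G.partner_partner P _).symm
    · exact Or.inl rfl
  · have hadj : ∀ v, (G.incidenceGraph P).Adj (Sum.inl (G.bubbleOf v))
        (Sum.inr ((G.chainGraph P).connectedComponentMk v)) := fun v =>
      (SimpleGraph.fromRel_adj _ _ _).2 ⟨by simp, Or.inl ⟨v, rfl, rfl⟩⟩
    rw [SimpleGraph.isTree_iff_connected_and_card]
    constructor
    · have hstep : ∀ v w, (G.sub Set.univ).Adj v w → (G.incidenceGraph P).reachableSetoid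
          (Sum.inl (G.bubbleOf v)) (Sum.inl (G.bubbleOf w)) := by
        rintro v _ ⟨c, -, rfl⟩
        cases c using Fin.cases with
        | zero =>
          have h1 := (hadj (G.nbr 0 v)).reachable
          rw [← SimpleGraph.ConnectedComponent.sound (G.chainGraph_reachable_nbr P v)] at h1
          exact (hadj v).reachable.trans h1.symm
        | succ d =>
          rw [G.bubbleOf_nbr_succ]
      obtain ⟨v₀⟩ := hG.nonempty
      have h0 : ∀ p, (G.incidenceGraph P).Reachable (Sum.inl (G.bubbleOf v₀)) p := by
        rintro (b | c)
        · induction b using SimpleGraph.ConnectedComponent.ind with | h v => ?_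
          exact SimpleGraph.rel_of_reachable hstep (hG.preconnected v₀ v)
        · induction c using SimpleGraph.ConnectedComponent.ind with | h v => ?_
          have h1 : (G.incidenceGraph P).Reachable (Sum.inl (G.bubbleOf v₀))
              (Sum.inl (G.bubbleOf v)) :=
            SimpleGraph.rel_of_reachable hstep (hG.preconnected v₀ v)
          exact h1.trans (hadj v).reachable
      exact { preconnected := fun p q => (h0 p).symm.trans (h0 q)
              nonempty := ⟨Sum.inl (G.bubbleOf v₀)⟩ }
    · have hE : Nat.card (G.incidenceGraph P).edgeSet = Nat.card G.Whites := by
        refine (Nat.card_congr (Equiv.ofBijective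
          (fun x : G.Whites => ⟨s(_, _), hadj x⟩) ⟨?_, ?_⟩)).symm
        · intro x y hxy
          have h1 := congrArg Subtype.val hxy
          rcases Sym2.eq_iff.1 h1 with ⟨h1, h2⟩ | ⟨h1, -⟩
          · exact huniq x y (Sum.inl_injective h1)
              (SimpleGraph.ConnectedComponent.exact (Sum.inr_injective h2))
          · exact absurd h1 (by simp)
        · have hmk : ∀ v, ∃ x : G.Whites, s(Sum.inl (G.bubbleOf x),
              Sum.inr ((G.chainGraph P).connectedComponentMk x)) = s(Sum.inl (G.bubbleOf v),
              Sum.inr ((G.chainGraph P).connectedComponentMk v)) := by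
            intro v
            obtain ⟨x, -, hb, hc⟩ := hrep v
            exact ⟨x, by rw [hb, SimpleGraph.ConnectedComponent.sound hc]⟩
          rintro ⟨e, he⟩
          induction e using Sym2.ind with | h p q => ?_
          have he' : (G.incidenceGraph P).Adj p q := he
          unfold incidenceGraph at he'
          rcases ((SimpleGraph.fromRel_adj _ _ _).1 he').2 with ⟨v, rfl, rfl⟩ | ⟨v, rfl, rfl⟩
          · obtain ⟨x, hx⟩ := hmk v
            exact ⟨x, Subtype.ext hx⟩
          · obtain ⟨x, hx⟩ := hmk v
            exact ⟨x, Subtype.ext (hx.trans Sym2.eq_swap)⟩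
      have h1 := h
      rw [TreeLike, G.isConnected_iff.1 hG] at h1
      rw [hE, Nat.card_sum, card_chains, card_bubble, h1]

end ColoredGraph

/-! ### The maximal 2-cut property and maximality -/

namespace ColoredGraph

variable {V : Type u} [Finite V] (G : ColoredGraph (Fin 4) V)

/-- All the bubbles have the maximal 2-cut property if and only if the graph is tree-like for some
optimal pairings. -/
theorem forall_maximalTwoCut_iff (hG : G.IsConnected) : (∀ b, G.MaximalTwoCut b) ↔
    ∃ P : ∀ b : G.Bubble, Pairing (G.bubbleGraph b), (∀ b, (P b).IsMax) ∧
      TreeLike G.colorPerm (G.repair P).zeroPerm G.zeroPerm := by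
  classical
  have hbub : ∀ (P : ∀ b : G.Bubble, Pairing (G.bubbleGraph b)) (x y : G.Whites),
      G.nbr 0 y = G.partner P x → bub G.colorPerm x (G.zeroPerm y) := by
    intro P x y h
    rw [bub_iff]
    change _ = G.bubbleOf (G.nbr 1 (G.nbr 0 y))
    rw [h, ← G.bubbleOf_partner P]
    exact (G.bubbleOf_nbr_succ 0 _).symm
  constructor
  · intro h
    choose P hP hcut using h
    refine ⟨P, hP, TreeLike.of_forall_cut (G.preserves_repair P) fun y x hyx hxy => ?_⟩
    have h1 : G.nbr 0 y = G.partner P x := by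
      rw [← hyx, coe_chain, partner_partner]
    rcases hcut (G.bubbleOf x) ⟨x, rfl⟩ with k | ⟨-, -, k⟩
    · refine absurd (Subtype.ext ?_) hxy
      rw [← G.nbr_nbr 0 x, ← G.nbr_nbr 0 y, h1]
      exact congrArg (G.nbr 0) k
    · have k' : G.IsZeroEdgeCut {G.zeroEdge x, G.zeroEdge (G.partner P x)} := k
      rw [← h1, zeroEdge_nbr, G.isZeroEdgeCut_iff hG hxy (hbub P x y h1)] at k'
      exact k'
  · rintro ⟨P, hP, hT⟩ b
    have key : ∀ x : G.Whites, G.nbr 0 x = G.partner P x ∨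
        (G.bubbleOf (G.nbr 0 x) ≠ G.bubbleOf x ∧
          G.bubbleOf (G.nbr 0 (G.partner P x)) ≠ G.bubbleOf x ∧
          G.IsZeroEdgeCut {G.zeroEdge x, G.zeroEdge (G.partner P x)}) := by
      intro x
      have heq : ∀ z y : G.Whites, ((G.repair P).zeroPerm⁻¹ * G.zeroPerm) z = y →
          G.bubbleOf z = G.bubbleOf y → z = y := fun z y hzy hb =>
        hT.eq_of_bub (G.preserves_repair P) (G.bub_iff.2 hb) (hzy ▸ cyc_apply _ z)
      obtain ⟨y, hy⟩ : ∃ y : G.Whites, (y : V) = G.nbr 0 (G.partner P x) :=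
        ⟨⟨_, (G.chain P).white_nbr_eq_true false
          ((G.chain P).white_nbr_eq_false true x)⟩, rfl⟩
      have hy' : G.nbr 0 y = G.partner P x := by rw [hy, G.nbr_nbr]
      have hyx : ((G.repair P).zeroPerm⁻¹ * G.zeroPerm) y = x :=
        Subtype.ext (by rw [coe_chain, hy', partner_partner])
      by_cases hxy : x = y
      · left; rw [← hy', hxy]
      · refine Or.inr ⟨fun hb => hxy ?_, fun hb => hxy ?_, ?_⟩
        · obtain ⟨z, hz⟩ : ∃ z, ((G.repair P).zeroPerm⁻¹ * G.zeroPerm) x = z := ⟨_, rfl⟩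
          have hxz : x = z := heq x z hz (by
            rw [← hz, coe_chain, bubbleOf_partner, hb])
          rw [← hxz, ← hyx] at hz
          rw [← hyx]
          exact Equiv.injective _ (by rw [hz, hyx])
        · rw [← hy] at hb
          exact (heq y x hyx hb).symm
        · rw [← hy', zeroEdge_nbr, G.isZeroEdgeCut_iff hG hxy (hbub P x y hy')]
          exact hT.cut (G.preserves_repair P) (Ne.symm hxy) (hyx ▸ cyc_apply _ y)
    refine ⟨P b, hP b, ?_⟩
    rintro ⟨v, rfl⟩
    change G.nbr 0 v = G.partner P v ∨ (G.Leaves _ v ∧ G.Leaves _ (G.partner P v) ∧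
      G.IsZeroEdgeCut {G.zeroEdge v, G.zeroEdge (G.partner P v)})
    obtain ⟨x, rfl | rfl⟩ := G.exists_white_partner P v
    · exact (key x).imp_right fun ⟨h1, h2, h3⟩ =>
        ⟨⟨rfl, h1⟩, ⟨G.bubbleOf_partner P x, h2⟩, h3⟩
    · rw [partner_partner, bubbleOf_partner]
      rcases key x with h | ⟨h1, h2, h3⟩
      · exact Or.inl (by rw [← h, G.nbr_nbr])
      · exact Or.inr ⟨⟨G.bubbleOf_partner P x, h2⟩, ⟨rfl, h1⟩, by rwa [Set.pair_comm]⟩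

/-- The maximal number of bicolored cycles with color `0`, and the graphs which attain it. -/
theorem zeroCycles_le_and_eq_iff [Fintype G.Bubble] (hG : G.IsConnected) (m : G.Bubble)
    (hm : ∀ b ≠ m, (G.bubbleGraph b).IsSpherical) :
    (G.zeroCycles : ℤ) ≤ ∑ b, ((G.bubbleGraph b).oneMax : ℤ) - 3 * (Nat.card G.Bubble - 1) ∧
    ((G.zeroCycles : ℤ) = ∑ b, ((G.bubbleGraph b).oneMax : ℤ) - 3 * (Nat.card G.Bubble - 1) ↔
      ∀ b, G.MaximalTwoCut b) := by
  classical
  rw [G.forall_maximalTwoCut_iff hG]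
  have hscore : (G.zeroCycles : ℤ) = score G.colorPerm G.zeroPerm + 3 := by
    rw [score, ← zeroCycles_eq, G.isConnected_iff.1 hG]
    push_cast; ring
  have hself : ∀ {ρ : Equiv.Perm G.Whites}, Preserves G.colorPerm ρ →
      score G.colorPerm ρ = zc G.colorPerm ρ - 3 * Nat.card G.Bubble := by
    intro ρ hρ
    rw [score, hρ.conn_self, card_bubble]
  have hle : ∀ π, score G.colorPerm π ≤
      ∑ b, ((G.bubbleGraph b).oneMax : ℤ) - 3 * Nat.card G.Bubble := by
    intro π
    obtain ⟨π', hπ'⟩ := exists_isMaximizer G.colorPerm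
    obtain ⟨ρ, hρ, hT⟩ := (G.planarOff m hm).exists_treeLike hπ'
    refine (hπ' π).trans ?_
    rw [hT.score_eq hρ, hself hρ]
    have := G.zc_le_sum_oneMax hρ
    zify at this
    linarith
  refine ⟨?_, fun h => ?_, ?_⟩
  · linarith [hle G.zeroPerm]
  · have hmax : IsMaximizer G.colorPerm G.zeroPerm := fun π' => by linarith [hle π']
    obtain ⟨ρ, hρ, hT⟩ := (G.planarOff m hm).exists_treeLike hmax
    obtain ⟨P, rfl⟩ := G.exists_zeroPerm_repair hρ
    refine ⟨P, ?_, hT⟩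
    rw [← zc_repair_eq_iff]
    have h1 := hT.score_eq hρ
    rw [hself hρ] at h1
    zify
    linarith
  · rintro ⟨P, hP, hT⟩
    have h1 := hT.score_eq (G.preserves_repair P)
    rw [hself (G.preserves_repair P), (G.zc_repair_eq_iff P).2 hP] at h1
    push_cast at h1
    linarith

end ColoredGraph

/-! ### Graphs with prescribed bubbles -/

namespace ColoredGraph

section Built

variable {V : Type u} [Finite V] {G : ColoredGraph (Fin 4) V} {N : ℕ} {Us : Fin N → Type u}
  [∀ i, Finite (Us i)] {Bs : ∀ i, ColoredGraph (Fin 3) (Us i)} {n : Fin N → ℕ}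
  {U : Type u} [Finite U] {B : ColoredGraph (Fin 3) U}

/-- Sums over the bubbles of a graph with prescribed bubbles. -/
theorem sum_bubbles [Fintype G.Bubble] {m : G.Bubble} {t : {b : G.Bubble // b ≠ m} → Fin N}
    (hn : ∀ i, Nat.card {b // t b = i} = n i) {R : Type*} [CommRing R] (F : G.Bubble → R) {x : R}
    {y : Fin N → R} (hx : F m = x) (hy : ∀ b, F b.1 = y (t b)) :
    ∑ b, F b = x + ∑ i, (n i : R) * y i := by
  classical
  rw [← (Equiv.optionSubtypeNe m).sum_comp F, Fintype.sum_option]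
  simp only [Equiv.optionSubtypeNe_none, Equiv.optionSubtypeNe_some, hx, hy]
  rw [← Fintype.sum_fiberwise' t y]
  simp [← hn, Nat.card_eq_fintype_card]

/-- The maximal number of bicolored cycles with color `0` of a graph with prescribed bubbles. -/
noncomputable def maxZeroCycles (B : ColoredGraph (Fin 3) U) (Bs : ∀ i, ColoredGraph (Fin 3) (Us i))
    (n : Fin N → ℕ) : ℤ :=
  (B.oneMax : ℤ) + ∑ i, (n i : ℤ) * (((Bs i).oneMax : ℤ) - 3)

theorem IsBuiltFrom.zeroCycles_le_and_eq_iff (h : G.IsBuiltFrom B Bs n)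
    (hBs : ∀ i, (Bs i).IsPlanar) :
    (G.zeroCycles : ℤ) ≤ maxZeroCycles B Bs n ∧
      ((G.zeroCycles : ℤ) = maxZeroCycles B Bs n ↔ ∀ b, G.MaximalTwoCut b) := by
  have := Fintype.ofFinite G.Bubble
  obtain ⟨hG, m, t, hm, ht, hn⟩ := h
  have h1 := G.zeroCycles_le_and_eq_iff hG m fun b hb =>
    (ht ⟨b, hb⟩).symm.isSpherical (hBs _).isSpherical
  have h2 : ∑ b, ((G.bubbleGraph b).oneMax : ℤ) =
      (B.oneMax : ℤ) + ∑ i, (n i : ℤ) * ((Bs i).oneMax : ℤ) :=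
    sum_bubbles hn _ (by rw [hm.oneMax_eq]) fun b => by rw [(ht b).oneMax_eq]
  have h3 : (Nat.card G.Bubble : ℤ) = 1 + ∑ i, (n i : ℤ) * 1 := by
    have := sum_bubbles (R := ℤ) (y := fun _ => 1) hn (fun _ => 1) rfl fun _ => rfl
    simpa [Nat.card_eq_fintype_card] using this
  have h4 : ∑ b, ((G.bubbleGraph b).oneMax : ℤ) - 3 * (Nat.card G.Bubble - 1) =
      maxZeroCycles B Bs n := by
    rw [h2, h3, maxZeroCycles]
    simp only [mul_sub, mul_one, Finset.sum_sub_distrib, ← Finset.sum_mul]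
    ring
  rwa [h4] at h1

/-- The number of bicolored cycles without color `0` only depends on the bubbles. -/
theorem IsBuiltFrom.totalCycles_eq (B : ColoredGraph (Fin 3) U)
    (Bs : ∀ i, ColoredGraph (Fin 3) (Us i)) (n : Fin N → ℕ) : ∃ k : ℤ,
    ∀ (V : Type u) [Finite V] (G : ColoredGraph (Fin 4) V), G.IsBuiltFrom B Bs n →
      (G.totalCycles : ℤ) = G.zeroCycles + k := by
  refine ⟨∑ a : Fin 3, ∑ b ∈ Finset.Ioi a, ((B.numCycles a b : ℤ) +
    ∑ i, (n i : ℤ) * ((Bs i).numCycles a b : ℤ)), ?_⟩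
  rintro V _ G ⟨hG, m, t, hm, ht, hn⟩
  have := Fintype.ofFinite G.Bubble
  have h1 : ∀ a b : Fin 3, (B.numCycles a b : ℤ) +
      ∑ i, (n i : ℤ) * ((Bs i).numCycles a b : ℤ) = G.numCycles a.succ b.succ := by
    intro a b
    rw [numCycles_succ]
    push_cast
    exact (sum_bubbles hn _ (by rw [hm.numCycles_eq]) fun b => by rw [(ht b).numCycles_eq]).symm
  simp only [h1]
  unfold totalCycles zeroCycles
  rw [Fin.sum_univ_succ]
  push_cast
  have h2 : Finset.Ioi (0 : Fin 4) = Finset.univ.map (Fin.succEmb 3) := by decide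
  have h3 : ∀ a : Fin 3, Finset.Ioi a.succ = (Finset.Ioi a).map (Fin.succEmb 3) := by
    decide
  simp only [h2, h3, Finset.sum_map, Fin.coe_succEmb]

end Built

/-- The edges of color `0` can be chosen such that the graph is connected and all its bubbles
have the maximal 2-cut property. -/
theorem exists_withZero {V : Type u} [Finite V] [Nonempty V] (G : ColoredGraph (Fin 4) V) :
    ∃ π, (G.withZero π).IsConnected ∧ ∀ b, (G.withZero π).MaximalTwoCut b := by
  classical
  have : Nonempty G.Whites := ‹Nonempty V›.map (G.whiteEnd 1)
  have : Nonempty {ρ // Preserves G.colorPerm ρ} :=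
    ⟨G.colorPerm 0, fun x => bub_step G.colorPerm 0 0 x⟩
  obtain ⟨⟨ρ, hρ⟩, hmax⟩ :=
    Finite.exists_max fun ρ : {ρ // Preserves G.colorPerm ρ} => zc G.colorPerm ρ.1
  obtain ⟨π, hc, hT⟩ := exists_connected_treeLike hρ
  have hz := G.zeroPerm_withZero π
  have hconn : (G.withZero π).IsConnected := by
    rw [isConnected_iff, hz]
    exact hc
  refine ⟨π, hconn, ((G.withZero π).forall_maximalTwoCut_iff hconn).2 ?_⟩
  have := Fintype.ofFinite (G.withZero π).Bubble
  obtain ⟨P, hP⟩ := (G.withZero π).exists_zeroPerm_repair (ρ := ρ) hρ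
  refine ⟨P, ?_, ?_⟩
  · rw [← zc_repair_eq_iff]
    refine le_antisymm ?_ ?_
    · exact zc_le_sum_oneMax _ (preserves_repair _ P)
    · choose Q hQ using fun b => exists_pairing_isMax ((G.withZero π).bubbleGraph b)
      rw [← ((G.withZero π).zc_repair_eq_iff Q).2 hQ, hP]
      exact hmax ⟨_, (G.withZero π).preserves_repair Q⟩
  · rw [hP, hz]
    exact hT

section Sigma

variable {J : Type} {X : J → Type u} (H : ∀ j, ColoredGraph (Fin 3) (X j))

/-- The disjoint union of bubbles, with edges of color `0` parallel to those of color `1`. -/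
def disjointUnion : ColoredGraph (Fin 4) (Σ j, X j) where
  white v := (H v.1).white v.2
  nbr c v := ⟨v.1, (H v.1).nbr (Fin.cases 0 id c) v.2⟩
  nbr_nbr c v := by simp [(H v.1).nbr_nbr]
  white_nbr c v := (H v.1).white_nbr _ v.2

variable {H}

theorem fst_eq_of_bubbleOf_eq {G : ColoredGraph (Fin 4) (Σ j, X j)}
    (hG : ∀ (d : Fin 3) v, G.nbr d.succ v = ⟨v.1, (H v.1).nbr d v.2⟩) {v w : Σ j, X j}
    (h : G.bubbleOf v = G.bubbleOf w) : v.1 = w.1 := by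
  have := SimpleGraph.rel_of_reachable (r := Setoid.ker (id : J → J)) (f := Sigma.fst) ?_
    (SimpleGraph.ConnectedComponent.exact h)
  · exact this
  · rintro v _ ⟨c, hc, rfl⟩
    obtain ⟨d, rfl⟩ := Fin.exists_succ_eq.2 hc
    rw [hG]

theorem bubbleOf_mk_eq {G : ColoredGraph (Fin 4) (Σ j, X j)}
    (hG : ∀ (d : Fin 3) v, G.nbr d.succ v = ⟨v.1, (H v.1).nbr d v.2⟩)
    (hH : ∀ j, (H j).IsConnected) (j : J) (x y : X j) :
    G.bubbleOf ⟨j, x⟩ = G.bubbleOf ⟨j, y⟩ := by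
  have := SimpleGraph.rel_of_reachable (r := Setoid.ker G.bubbleOf) (f := Sigma.mk j) ?_
    ((hH j).preconnected x y)
  · exact this
  · rintro v _ ⟨d, -, rfl⟩
    have h1 := G.bubbleOf_nbr_succ d ⟨j, v⟩
    rw [hG] at h1
    exact h1.symm

theorem isomorphic_of_bubbleOf_eq {G : ColoredGraph (Fin 4) (Σ j, X j)}
    (hw : ∀ v, G.white v = (H v.1).white v.2)
    (hG : ∀ (d : Fin 3) v, G.nbr d.succ v = ⟨v.1, (H v.1).nbr d v.2⟩)
    (hH : ∀ j, (H j).IsConnected) {b : G.Bubble} {j : J} {x₀ : X j}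
    (hb : G.bubbleOf ⟨j, x₀⟩ = b) : (G.bubbleGraph b).Isomorphic (H j) := by
  refine Isomorphic.symm ⟨Equiv.ofBijective
    (fun x => ⟨⟨j, x⟩, (bubbleOf_mk_eq hG hH j x x₀).trans hb⟩) ⟨fun x y h => ?_, ?_⟩,
    fun x => hw _, fun d x => Subtype.ext (hG d _)⟩
  · exact eq_of_heq (Sigma.mk.inj (congrArg Subtype.val h)).2
  · rintro ⟨⟨i, x⟩, hx⟩
    obtain rfl : i = j := fst_eq_of_bubbleOf_eq hG (hx.trans hb.symm)
    exact ⟨x, rfl⟩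

end Sigma

theorem exists_isBuiltFrom {N : ℕ} {Us : Fin N → Type u} [∀ i, Finite (Us i)]
    {Bs : ∀ i, ColoredGraph (Fin 3) (Us i)} (hBs : ∀ i, (Bs i).IsConnected) (n : Fin N → ℕ)
    {U : Type u} [Finite U] {B : ColoredGraph (Fin 3) U} (hB : B.IsConnected) :
    ∃ (V : Type u) (_ : Finite V) (G : ColoredGraph (Fin 4) V),
      G.IsBuiltFrom B Bs n ∧ ∀ b, G.MaximalTwoCut b := by
  let J : Type := Option (Σ i, Fin (n i))
  let X : J → Type u := fun j => j.elim U fun p => Us p.1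
  let H : ∀ j, ColoredGraph (Fin 3) (X j) := fun j => match j with
    | none => B
    | some p => Bs p.1
  have hH : ∀ j, (H j).IsConnected := fun j => match j with
    | none => hB
    | some p => hBs p.1
  have hX : ∀ j, Finite (X j) := fun j => match j with
    | none => inferInstanceAs (Finite U)
    | some p => inferInstanceAs (Finite (Us p.1))
  have hne : ∀ j, Nonempty (X j) := fun j => (hH j).nonempty
  have : Nonempty (Σ j, X j) := ⟨⟨none, (hne none).some⟩⟩
  obtain ⟨π, hconn, hcut⟩ := exists_withZero (disjointUnion H)
  generalize hG : (disjointUnion H).withZero π = G at hconn hcut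
  have hw : ∀ v, G.white v = (H v.1).white v.2 := by subst hG; exact fun v => rfl
  have hn : ∀ (d : Fin 3) v, G.nbr d.succ v = ⟨v.1, (H v.1).nbr d v.2⟩ := by
    subst hG; exact fun d v => rfl
  have hidx : ∀ b : G.Bubble, ∃ (j : J) (x : X j), G.bubbleOf ⟨j, x⟩ = b := by
    intro b
    induction b using SimpleGraph.ConnectedComponent.ind with | h v => ?_
    exact ⟨v.1, v.2, rfl⟩
  let m : G.Bubble := G.bubbleOf ⟨none, (hne none).some⟩
  have hsome : ∀ b : {b : G.Bubble // b ≠ m}, ∃ (p : Σ i, Fin (n i)) (x : Us p.1),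
      G.bubbleOf ⟨some p, x⟩ = b := by
    rintro ⟨b, hb⟩
    obtain ⟨_ | p, x, rfl⟩ := hidx b
    · exact absurd (bubbleOf_mk_eq hn hH none _ _) hb
    · exact ⟨p, x, rfl⟩
  choose p x hx using hsome
  refine ⟨Σ j, X j, inferInstance, G, ⟨hconn, m, fun b => (p b).1, ?_, ?_, ?_⟩, hcut⟩
  · exact isomorphic_of_bubbleOf_eq hw hn hH (j := none) rfl
  · exact fun b => isomorphic_of_bubbleOf_eq hw hn hH (j := some (p b)) (hx b)
  · intro i
    have hp : ∀ (q : Σ i, Fin (n i)) (y : Us q.1) (b : {b : G.Bubble // b ≠ m}),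
        G.bubbleOf ⟨some q, y⟩ = b → p b = q := by
      intro q y b hb
      have := fst_eq_of_bubbleOf_eq hn ((hx b).trans hb.symm)
      exact Option.some_injective _ this
    rw [← Nat.card_fin (n i)]
    let y : ∀ k : Fin (n i), Us i := fun k => (hne (some ⟨i, k⟩)).some
    have hy : ∀ k : Fin (n i), G.bubbleOf ⟨some ⟨i, k⟩, y k⟩ ≠ m := by
      intro k h
      exact absurd (fst_eq_of_bubbleOf_eq hn h) (by simp)
    symm
    refine Nat.card_congr (Equiv.ofBijective
      (fun k => ⟨⟨G.bubbleOf ⟨some ⟨i, k⟩, y k⟩, hy k⟩, congrArg Sigma.fst (hp ⟨i, k⟩ (y k) _ rfl)⟩) ⟨?_, ?_⟩)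
    · intro k l h
      have h1 : G.bubbleOf ⟨some ⟨i, k⟩, y k⟩ = G.bubbleOf ⟨some ⟨i, l⟩, y l⟩ :=
        congrArg (fun b => b.1.1) h
      have h2 := Option.some_injective _ (fst_eq_of_bubbleOf_eq hn h1)
      exact eq_of_heq (Sigma.mk.inj h2).2
    · rintro ⟨b, rfl⟩
      refine ⟨(p b).2, Subtype.ext (Subtype.ext ?_)⟩
      exact (bubbleOf_mk_eq hn hH (some (p b)) _ _).trans (hx b)

end ColoredGraph

theorem theorem2 {N : ℕ} {Us : Fin N → Type u} [∀ i, Finite (Us i)]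
    (Bs : ∀ i, ColoredGraph (Fin 3) (Us i)) (hBs : ∀ i, (Bs i).IsPlanar) (n : Fin N → ℕ)
    {U : Type u} [Finite U] (B : ColoredGraph (Fin 3) U) (hB : B.IsConnected) :
    (∀ (V : Type u) [Finite V] (G : ColoredGraph (Fin 4) V), G.IsBuiltFrom B Bs n →
      (G.MaximizesAmong ColoredGraph.zeroCycles B Bs n ↔ ∀ b : G.Bubble, G.MaximalTwoCut b) ∧
      (G.MaximizesAmong ColoredGraph.totalCycles B Bs n ↔ ∀ b : G.Bubble, G.MaximalTwoCut b) ∧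
      (G.MaximizesAmong ColoredGraph.zeroCycles B Bs n → G.IsTreeLike)) ∧
    IsGreatest
      {k : ℤ | ∃ (V : Type u) (_ : Finite V) (G : ColoredGraph (Fin 4) V),
        G.IsBuiltFrom B Bs n ∧ (G.zeroCycles : ℤ) = k}
      ((B.oneMax : ℤ) + ∑ i, (n i : ℤ) * (((Bs i).oneMax : ℤ) - 3)) := by
  obtain ⟨V₀, _, G₀, h₀, hcut₀⟩ := ColoredGraph.exists_isBuiltFrom (fun i => (hBs i).1) n hB
  have hval₀ := (h₀.zeroCycles_le_and_eq_iff hBs).2.2 hcut₀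
  obtain ⟨k, hk⟩ := ColoredGraph.IsBuiltFrom.totalCycles_eq B Bs n
  have hzero : ∀ (V : Type u) [Finite V] (G : ColoredGraph (Fin 4) V), G.IsBuiltFrom B Bs n →
      (G.MaximizesAmong ColoredGraph.zeroCycles B Bs n ↔ ∀ b : G.Bubble, G.MaximalTwoCut b) := by
    intro V _ G hG
    rw [← (hG.zeroCycles_le_and_eq_iff hBs).2]
    constructor
    · rintro ⟨-, h⟩
      have h1 := h V₀ G₀ h₀
      have h2 := (hG.zeroCycles_le_and_eq_iff hBs).1
      zify at h1
      linarith
    · refine fun h => ⟨hG, fun V' _ G' hG' => ?_⟩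
      have h1 := (hG'.zeroCycles_le_and_eq_iff hBs).1
      zify
      linarith
  refine ⟨fun V _ G hG => ⟨hzero V G hG, ?_, fun h => ?_⟩, ?_, ?_⟩
  · rw [← hzero V G hG]
    refine and_congr_right fun _ => forall_congr' fun V' => forall_congr' fun _ =>
      forall_congr' fun G' => forall_congr' fun hG' => ?_
    have h1 := hk V G hG
    have h2 := hk V' G' hG'
    zify
    rw [h1, h2]
    exact add_le_add_iff_right k
  · obtain ⟨P, hP, hT⟩ := (G.forall_maximalTwoCut_iff hG.1).1 ((hzero V G hG).1 h)
    exact ⟨P, hP, G.incidenceGraph_isTree P hG.1 hT⟩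
  · exact ⟨V₀, ‹_›, G₀, h₀, hval₀⟩
  · rintro _ ⟨V, _, G, hG, rfl⟩
    exact (hG.zeroCycles_le_and_eq_iff hBs).1
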